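/- **Theorem 8.6.** Let $V$ be a Euclidean Jordan algebra: a finite-dimensional commutative real algebra with unit $e$ satisfying $(ab)a^2=a(ba^2)$, with an inner product such that $(ab\,|\,c)=(b\,|\,ac)$. Write $L(x)y=xy$. Let $W=\operatorname{int}\{x^2 : x\in V\}$ be its symmetric cone and let $G=\operatorname{Aut}_0(W)\subseteq GL(V)$ be the identity component of $\{g\in GL(V): g(W)=W\}$, with Lie algebra $\mathfrak g$. Fix a Jordan frame $c_1,\dots,c_l$ of $V$ (a complete system of orthogonal primitive idempotents), put $\mathfrak a=\bigoplus_j\mathbb R L(c_j)$, let $\Sigma\subseteq\mathfrak a^*$ be the set of restricted roots of $(\mathfrak g,\mathfrak a)$, and set $$\Omega=\{X\in\mathfrak a : |\alpha(X)|<\tfrac{\pi}{2}\ \text{ for all }\alpha\in\Sigma\}.$$ (If $V$ is simple, then $\Omega=\{\sum_j x_jL(c_j) : |x_i-x_j|<\pi \text{ for all } i,j\}$.) Let $V_{\mathbb C}=V\oplus iV$ be the complexification, with $z\mapsto\bar z$ the conjugation with respect to $V$ and with the complex bilinear product, on which $G$ and $\exp(i\mathfrak a)$ act by complex linear extension. Define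 the square-root domain $$\Xi^{1/2}=G\exp\!\left(\tfrac{i}{2}\Omega\right)(e)\subseteq V_{\mathbb C},$$ and, for $z,w\in V_{\mathbb C}$, the polarized quadratic representation $$P(z,w)=L(z)L(w)+L(w)L(z)-L(zw)\in\operatorname{End}(V_{\mathbb C}).$$ Then $\Xi^{1/2}$ is open in $V_{\mathbb C}$, $\det P(z,\bar z)$ is real and positive for every $z\in\Xi^{1/2}$, and the function $$\varphi:\Xi^{1/2}\to\mathbb R,\qquad \varphi(z)=\log\det P(z,\bar z)^{-1},$$ is plurisubharmonic: it is upper semicontinuous, and for all $z,w\in V_{\mathbb C}$ with $\{z+\zeta w:\zeta\in\mathbb C,\ |\zeta|\le 1\}\subseteq\Xi^{1/2}$ the function $\theta\mapsto\varphi(z+e^{i\theta}w)$ is integrable on $[0,2\pi]$ and $\varphi(z)\le\frac1{2\pi}\int_0^{2\pi}\varphi(z+e^{i\theta}w)\,d\theta$. -/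

import Mathlib

noncomputable section

set_option linter.unusedSectionVars false
set_option linter.unusedSimpArgs false

/-! ### Euclidean Jordan algebras -/

/-- A Euclidean Jordan algebra: a commutative real algebra with unit satisfying the Jordan identity
`(a b) a² = a (b a²)` (the parent `IsCommJordan`), with an inner product that is associative,
`(a b | c) = (b | a c)`. Finite dimensionality is a separate hypothesis. -/
class EuclideanJordanAlgebra (V : Type*) [NormedAddCommGroup V] [InnerProductSpace ℝ V] extends
    CommMagma V, MulOneClass V, IsCommJordan V where
  mul_add' : ∀ a b c : V, a * (b + c) = a * b + a * c
  mul_smul' : ∀ (r : ℝ) (a b : V), a * (r • b) = r • (a * b)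
  inner_mul' : ∀ a b c : V, inner ℝ (a * b) c = inner ℝ b (a * c)

namespace EuclideanJordanAlgebra

section Algebra

variable {V : Type*} [NormedAddCommGroup V] [InnerProductSpace ℝ V] [EuclideanJordanAlgebra V]

theorem add_mul' (a b c : V) : (a + b) * c = a * c + b * c := by
  rw [mul_comm, mul_add', mul_comm c a, mul_comm c b]

theorem smul_mul' (r : ℝ) (a b : V) : (r • a) * b = r • (a * b) := by
  rw [mul_comm, mul_smul', mul_comm b a]

theorem mul_neg' (a b : V) : a * (-b) = -(a * b) := by
  have h := mul_smul' (-1 : ℝ) a b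
  simpa using h

variable [FiniteDimensional ℝ V]

/-- The multiplication operator `L(x) y = x y`. -/
def L (x : V) : V →L[ℝ] V :=
  LinearMap.toContinuousLinearMap
    { toFun := fun y => x * y
      map_add' := mul_add' x
      map_smul' := fun r y => mul_smul' r x y }

end Algebra

/-! ### Jordan frames -/

section Frame

variable {V : Type*} [NormedAddCommGroup V] [InnerProductSpace ℝ V] [EuclideanJordanAlgebra V]

/-- A primitive idempotent: a nonzero idempotent that is not the sum of two nonzero idempotents. -/
def IsPrimitiveIdempotent (c : V) : Prop :=
  c ≠ 0 ∧ c * c = c ∧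
    ∀ a b : V, a * a = a → b * b = b → a + b = c → a = 0 ∨ b = 0

/-- A Jordan frame: a complete system of orthogonal primitive idempotents. -/
structure IsJordanFrame {l : ℕ} (c : Fin l → V) : Prop where
  primitive : ∀ i, IsPrimitiveIdempotent (c i)
  orthogonal : ∀ i j, i ≠ j → c i * c j = 0
  complete : ∑ i, c i = 1

end Frame

/-! ### The symmetric cone and its group -/

section Group

variable (V : Type*) [NormedAddCommGroup V] [InnerProductSpace ℝ V] [EuclideanJordanAlgebra V]

/-- The symmetric cone `W = int {x²}`. -/
def cone : Set V := interior (Set.range fun x : V => x * x)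

/-- `Aut(W)`, the group of all `g ∈ GL(V)` with `g(W) = W`. -/
def autCone : Subgroup (V →L[ℝ] V)ˣ where
  carrier := {g | (g : V →L[ℝ] V) '' cone V = cone V}
  one_mem' := by simp
  mul_mem' := by
    intro g h hg hh
    change (fun x => (g : V →L[ℝ] V) ((h : V →L[ℝ] V) x)) '' cone V = cone V
    rw [← Set.image_image (g : V →L[ℝ] V) (h : V →L[ℝ] V) (cone V)]
    exact (congrArg _ hh).trans hg
  inv_mem' := by
    intro g hg
    change ((g⁻¹ : (V →L[ℝ] V)ˣ) : V →L[ℝ] V) '' cone V = cone V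
    conv_lhs => rw [← show (g : V →L[ℝ] V) '' cone V = cone V from hg]
    rw [Set.image_image]
    have h : ∀ x, ((g⁻¹ : (V →L[ℝ] V)ˣ) : V →L[ℝ] V) ((g : V →L[ℝ] V) x) = x := fun x =>
      DFunLike.congr_fun (Units.inv_mul g) x
    simp [h]

/-- `G = Aut₀(W)`, the identity component of `Aut(W)`. -/
def G : Subgroup (V →L[ℝ] V)ˣ :=
  (Subgroup.connectedComponentOfOne (autCone V)).map (autCone V).subtype

/-- The Lie algebra of `G`: all `X ∈ End(V)` with `exp(tX) ∈ G` for every real `t`. -/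
def lieG : Set (V →L[ℝ] V) :=
  {X | ∀ t : ℝ, ∃ g ∈ G V, (g : V →L[ℝ] V) = NormedSpace.exp (t • X)}

end Group

/-! ### Restricted roots and the set `Ω` -/

section Roots

variable {V : Type*} [NormedAddCommGroup V] [InnerProductSpace ℝ V] [EuclideanJordanAlgebra V]
  [FiniteDimensional ℝ V]

/-- The maximal abelian subspace `𝔞 = ⨁ ℝ L(c_j)` attached to a Jordan frame. -/
def frakA {l : ℕ} (c : Fin l → V) : Submodule ℝ (V →L[ℝ] V) :=
  Submodule.span ℝ (Set.range fun j => L (c j))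

/-- The restricted roots `Σ(𝔤, 𝔞)`: the nonzero `α ∈ 𝔞*` whose root space
`{X ∈ 𝔤 : [H, X] = α(H) X for all H ∈ 𝔞}` is nonzero. -/
def IsRestrictedRoot {l : ℕ} (c : Fin l → V) (α : Module.Dual ℝ (frakA c)) : Prop :=
  α ≠ 0 ∧ ∃ X ∈ lieG V, X ≠ 0 ∧
    ∀ H : frakA c, (H : V →L[ℝ] V) * X - X * (H : V →L[ℝ] V) = α H • X

/-- `Ω = {X ∈ 𝔞 : |α(X)| < π/2 for all restricted roots α}`. -/
def Omega {l : ℕ} (c : Fin l → V) : Set (frakA c) :=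
  {X | ∀ α : Module.Dual ℝ (frakA c), IsRestrictedRoot c α → |α X| < Real.pi / 2}

end Roots

/-! ### The complexification -/

/-- The complexification `V_ℂ = V ⊕ iV`; the pair `(x, y)` stands for `x + iy`. -/
def Cx (V : Type*) : Type _ := V × V

namespace Cx

section Basic

variable {V : Type*} [NormedAddCommGroup V] [InnerProductSpace ℝ V]

/-- The element `x + iy`. -/
def mk (x y : V) : Cx V := (x, y)

/-- The real part `x` of `x + iy`. -/
def re (z : Cx V) : V := z.1

/-- The imaginary part `y` of `x + iy`. -/
def im (z : Cx V) : V := z.2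

@[ext] theorem ext {z w : Cx V} (h₁ : z.re = w.re) (h₂ : z.im = w.im) : z = w :=
  Prod.ext h₁ h₂

@[simp] theorem re_mk (x y : V) : (mk x y).re = x := rfl

@[simp] theorem im_mk (x y : V) : (mk x y).im = y := rfl

section Aux

/-- The additive group underlying `V_ℂ`; afterwards reached through the normed structure. -/
@[reducible] def addCommGroupAux : AddCommGroup (Cx V) := inferInstanceAs (AddCommGroup (V × V))

attribute [local instance] addCommGroupAux

theorem re_add_aux (z w : Cx V) : (z + w).re = z.re + w.re := rfl

theorem im_add_aux (z w : Cx V) : (z + w).im = z.im + w.im := rfl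

theorem re_zero_aux : (0 : Cx V).re = 0 := rfl

theorem im_zero_aux : (0 : Cx V).im = 0 := rfl

/-- Scalar multiplication `(a + ib)(x + iy) = (ax - by) + i(ay + bx)`. -/
@[reducible] def smulAux : SMul ℂ (Cx V) :=
  ⟨fun a z => mk (a.re • z.re - a.im • z.im) (a.re • z.im + a.im • z.re)⟩

attribute [local instance] smulAux

theorem re_smul_aux (a : ℂ) (z : Cx V) : (a • z).re = a.re • z.re - a.im • z.im := rfl

theorem im_smul_aux (a : ℂ) (z : Cx V) : (a • z).im = a.re • z.im + a.im • z.re := rfl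

/-- The complex vector space underlying `V_ℂ`; afterwards reached through the normed structure. -/
@[reducible] def moduleAux : Module ℂ (Cx V) where
  one_smul z := by
    ext <;> simp [re_add_aux, im_add_aux, re_zero_aux, im_zero_aux, re_smul_aux, im_smul_aux]
  mul_smul a b z := by
    ext <;> simp [re_add_aux, im_add_aux, re_zero_aux, im_zero_aux, re_smul_aux, im_smul_aux] <;> module
  smul_zero a := by
    ext <;> simp [re_add_aux, im_add_aux, re_zero_aux, im_zero_aux, re_smul_aux, im_smul_aux]
  smul_add a z w := by
    ext <;> simp [re_add_aux, im_add_aux, re_zero_aux, im_zero_aux, re_smul_aux, im_smul_aux] <;> module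
  add_smul a b z := by
    ext <;> simp [re_add_aux, im_add_aux, re_zero_aux, im_zero_aux, re_smul_aux, im_smul_aux] <;> module
  zero_smul z := by
    ext <;> simp [re_add_aux, im_add_aux, re_zero_aux, im_zero_aux, re_smul_aux, im_smul_aux]

attribute [local instance] moduleAux

/-- The Hermitian extension of the inner product of `V`, conjugate linear in the first variable. -/
@[reducible] def core : InnerProductSpace.Core ℂ (Cx V) where
  inner z w := ⟨inner ℝ z.re w.re + inner ℝ z.im w.im, inner ℝ z.re w.im - inner ℝ z.im w.re⟩
  conj_inner_symm z w := by
    apply Complex.ext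
    · simp [real_inner_comm]
    · simp [real_inner_comm]
  re_inner_nonneg z := by
    simpa using add_nonneg (real_inner_self_nonneg (x := z.re)) (real_inner_self_nonneg (x := z.im))
  add_left z w u := by
    apply Complex.ext
    · simp [inner_add_left, re_add_aux, im_add_aux]; ring
    · simp [inner_add_left, re_add_aux, im_add_aux]; ring
  smul_left z w a := by
    apply Complex.ext
    · simp [inner_add_left, inner_sub_left, real_inner_smul_left, re_smul_aux, im_smul_aux]; ring
    · simp [inner_add_left, inner_sub_left, real_inner_smul_left, re_smul_aux, im_smul_aux]; ring
  definite z h := by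
    have h' := congrArg Complex.re h
    simp only [Complex.zero_re] at h'
    have h1 := real_inner_self_nonneg (x := z.re)
    have h2 := real_inner_self_nonneg (x := z.im)
    ext
    · exact inner_self_eq_zero.mp (by linarith : inner ℝ z.re z.re = 0)
    · exact inner_self_eq_zero.mp (by linarith : inner ℝ z.im z.im = 0)

instance instNormedAddCommGroup : NormedAddCommGroup (Cx V) :=
  InnerProductSpace.Core.toNormedAddCommGroup (cd := core)

instance instInnerProductSpace : InnerProductSpace ℂ (Cx V) :=
  InnerProductSpace.ofCore core.toCore

end Aux

@[simp] theorem re_add (z w : Cx V) : (z + w).re = z.re + w.re := rfl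

@[simp] theorem im_add (z w : Cx V) : (z + w).im = z.im + w.im := rfl

@[simp] theorem re_zero : (0 : Cx V).re = 0 := rfl

@[simp] theorem im_zero : (0 : Cx V).im = 0 := rfl

@[simp] theorem re_smul (a : ℂ) (z : Cx V) : (a • z).re = a.re • z.re - a.im • z.im := rfl

@[simp] theorem im_smul (a : ℂ) (z : Cx V) : (a • z).im = a.re • z.im + a.im • z.re := rfl

instance instFiniteDimensional [FiniteDimensional ℝ V] : FiniteDimensional ℂ (Cx V) := by
  let f : (V × V) →ₗ[ℝ] Cx V :=
    { toFun := fun p => mk p.1 p.2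
      map_add' := fun _ _ => rfl
      map_smul' := fun r p => by
        change mk (r • p.1) (r • p.2) = (r : ℂ) • mk p.1 p.2
        apply ext
        · rw [re_smul]; simp
        · rw [im_smul]; simp }
  have hf : Function.Surjective f := fun z => ⟨(z.re, z.im), rfl⟩
  have : Module.Finite ℝ (Cx V) := Module.Finite.of_surjective f hf
  exact Module.Finite.of_restrictScalars_finite ℝ ℂ (Cx V)

/-- Complex conjugation with respect to the real form `V`. -/
def conj (z : Cx V) : Cx V := mk z.re (-z.im)

/-- The complex linear extension to `V_ℂ` of a linear operator on `V`. -/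
def complexify [FiniteDimensional ℝ V] (A : V →L[ℝ] V) : Cx V →L[ℂ] Cx V :=
  LinearMap.toContinuousLinearMap
    { toFun := fun z => mk (A z.re) (A z.im)
      map_add' := fun z w => by ext <;> simp
      map_smul' := fun a z => by ext <;> simp }

end Basic

/-! ### The Jordan algebra `V_ℂ` and the quadratic representation -/

section Jordan

variable {V : Type*} [NormedAddCommGroup V] [InnerProductSpace ℝ V] [EuclideanJordanAlgebra V]

/-- The complex bilinear extension of the Jordan product. -/
instance instMul : Mul (Cx V) :=
  ⟨fun z w => mk (z.re * w.re - z.im * w.im) (z.re * w.im + z.im * w.re)⟩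

@[simp] theorem re_mul (z w : Cx V) : (z * w).re = z.re * w.re - z.im * w.im := rfl

@[simp] theorem im_mul (z w : Cx V) : (z * w).im = z.re * w.im + z.im * w.re := rfl

/-- The unit `e`, viewed in `V_ℂ`. -/
instance instOne : One (Cx V) := ⟨mk 1 0⟩

/-- The multiplication operator `L(z) w = z w` on `V_ℂ`. -/
def mulLeft (z : Cx V) : Cx V →ₗ[ℂ] Cx V where
  toFun w := z * w
  map_add' u w := by
    ext <;> simp only [re_mul, im_mul, re_add, im_add, mul_add'] <;> abel
  map_smul' a w := by
    ext <;> simp only [re_mul, im_mul, re_smul, im_smul, RingHom.id_apply, sub_eq_add_neg,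
      mul_add', mul_neg', mul_smul'] <;> module

/-- The polarized quadratic representation `P(z, w) = L(z) L(w) + L(w) L(z) - L(z w)`. -/
def P (z w : Cx V) : Cx V →ₗ[ℂ] Cx V :=
  mulLeft z ∘ₗ mulLeft w + mulLeft w ∘ₗ mulLeft z - mulLeft (z * w)

/-- The function `φ(z) = log det P(z, z̄)⁻¹`. (The determinant is a complex number; that it is real
and positive on the domain of interest is asserted wherever this function is used.) -/
def phi (z : Cx V) : ℝ := Real.log ((LinearMap.det (P z (conj z)))⁻¹).re

/-- The square-root domain `Ξ^{1/2} = G exp(i Ω/2)(e) ⊆ V_ℂ`. -/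
def sqrtDomain [FiniteDimensional ℝ V] {l : ℕ} (c : Fin l → V) : Set (Cx V) :=
  {z | ∃ g ∈ G V, ∃ X ∈ Omega c,
    z = complexify (g : V →L[ℝ] V)
      (NormedSpace.exp (Complex.I • complexify ((1 / 2 : ℝ) • (X : V →L[ℝ] V))) 1)}

end Jordan

end Cx

end EuclideanJordanAlgebra

/-! ### Plurisubharmonic functions -/

/-- A real-valued function `f` is plurisubharmonic on the open set `U` if it is upper semicontinuous
there and satisfies the sub-mean value inequality
`f(z) ≤ (1/2π) ∫₀^{2π} f(z + e^{iθ} w) dθ` for every closed complex disc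
`{z + ζ w : |ζ| ≤ 1}` contained in `U`, the integral being (absolutely) convergent. -/
def PlurisubharmonicOn {E : Type*} [NormedAddCommGroup E] [NormedSpace ℂ E]
    (f : E → ℝ) (U : Set E) : Prop :=
  IsOpen U ∧ UpperSemicontinuousOn f U ∧
    ∀ z w : E, (∀ ζ : ℂ, ‖ζ‖ ≤ 1 → z + ζ • w ∈ U) →
      CircleIntegrable (fun ζ : ℂ => f (z + ζ • w)) 0 1 ∧
        f z ≤ Real.circleAverage (fun ζ : ℂ => f (z + ζ • w)) 0 1

end

/-! Write z = x + iy. The mixed terms of P(z, z̄) cancel, so P(z, z̄) is the complex linear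
extension of P(x) + P(y) (`re_P`, `im_P`). Up to G, a point of the domain has x = ∑ cos(x_j) c_j and
y = ∑ sin(x_j) c_j, and on the Peirce space V_ij the operator P(x) + P(y) is the scalar cos x_i cos
x_j + sin x_i sin x_j = cos(x_i - x_j). The condition defining Ω amounts to |x_i - x_j| < π/2
whenever V_ij ≠ 0 (`mem_Omega_iff`, `mem_sqrtDomain_iff`). Hence P(z, z̄) is positive definite
(`inner_P_pos`), and its determinant is real and positive.

Openness (`isOpen_sqrtDomain`): on each simple component the angles x_j spread over less than π/2,
so a rotation by a central e^{-iθ} brings them into (-π/4, π/4). There the condition reads x ± y ∈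
W, which is open. Conversely, any pair with a ± b ∈ W is brought by G to diagonal form with such
angles (`exists_polar_diag`).

The sub-mean value inequality rests on a curvature estimate: the form ∑ ([L(x_k), L(y_k)] x_m | y_m)
is negative semidefinite (`sum_inner_lieL_nonpos`). It gives, whenever zv = wu, the inequality ⟨v,
P(z, z̄)v⟩ - 2 Re⟨u, P(z, w̄)v⟩ + ⟨u, P(w, w̄)u⟩ ≤ 0 (`re_inner_P_le`). Put S = P(z, z̄)⁻¹ P(w, z̄).
Solving zv = wu for v and completing the square yields P(w, w̄) ≤ S* P(z, z̄) S, and therefore P(z +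
ζw, conj(z + ζw)) ≤ (1 + ζS)* P(z, z̄) (1 + ζS). Taking determinants, φ(z + ζw) ≥ φ(z) - 2 log
|det(1 + ζS)|. On the closed disc det(1 + ζS) is holomorphic without zeros, so the logarithm has
circle mean log |det 1| = 0 (`phi_le_circleAverage`).

The Jordan theory is built from the axioms. Primitivity gives V_ii = ℝc_i by maximizing a cubic
form; diagonalization comes from maximizing a linear functional over a compact group of
automorphisms; an automorphism of W fixing e is a Jordan automorphism because it preserves the
extreme points of [0, e], whence the polar decomposition `exists_polar`. -/

noncomputable section

set_option linter.unusedSectionVars false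
set_option linter.unusedSimpArgs false

/-! ### Jordan identities for a commutative bilinear product -/

/-- A bilinear product that is commutative and satisfies the Jordan identity. -/
structure IsJordanMul {𝕜 A : Type*} [Field 𝕜] [AddCommGroup A] [Module 𝕜 A]
    (m : A →ₗ[𝕜] A →ₗ[𝕜] A) : Prop where
  comm : ∀ a b, m a b = m b a
  jordan : ∀ a b, m (m a b) (m a a) = m a (m b (m a a))

namespace IsJordanMul

variable {𝕜 A : Type*} [Field 𝕜] [CharZero 𝕜] [AddCommGroup A] [Module 𝕜 A]

/-- The polarized quadratic representation of a bilinear product. -/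
def quad (m : A →ₗ[𝕜] A →ₗ[𝕜] A) (x y : A) : A →ₗ[𝕜] A :=
  m x ∘ₗ m y + m y ∘ₗ m x - m (m x y)

variable {m : A →ₗ[𝕜] A →ₗ[𝕜] A}

theorem quad_apply (x y u : A) : quad m x y u = m x (m y u) + m y (m x u) - m (m x y) u := rfl

/-- The relation [L(x), L(x²)] = 0 is cubic in x; inclusion-exclusion over the subsums of a + b + c
extracts its trilinear part, in which each term occurs twice. -/
theorem linearized (h : IsJordanMul m) (a b c d : A) :
    m a (m (m b c) d) - m (m b c) (m a d) + (m b (m (m a c) d) - m (m a c) (m b d)) +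
      (m c (m (m a b) d) - m (m a b) (m c d)) = 0 := by
  have key : ∀ x, m x (m (m x x) d) = m (m x x) (m x d) := fun x => by
    rw [h.comm (m x x) d, ← h.jordan x d, h.comm]
  have h1 := key (a + b + c)
  have h2 := key (a + b)
  have h3 := key (a + c)
  have h4 := key (b + c)
  have h5 := key a
  have h6 := key b
  have h7 := key c
  have e1 : m b a = m a b := h.comm _ _
  have e2 : m c a = m a c := h.comm _ _
  have e3 : m c b = m b c := h.comm _ _
  simp only [map_add, LinearMap.add_apply, e1, e2, e3] at h1 h2 h3 h4
  linear_combination (norm := module) (1 / 2 : 𝕜) • (h1 - h2 - h3 - h4 + h5 + h6 + h7)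

theorem commute_sq (h : IsJordanMul m) (a b d : A) :
    m b (m (m a a) d) - m (m a a) (m b d) + (2 : 𝕜) • (m a (m (m a b) d) - m (m a b) (m a d)) = 0 := by
  have := h.linearized a a b d
  linear_combination (norm := module) this

/-- The operator `L((ab)d)` in terms of products of multiplication operators. -/
theorem mul_mul_mul (h : IsJordanMul m) (a b d u : A) :
    m a (m d (m b u)) + m b (m d (m a u)) + m (m (m a b) d) u =
      m (m a d) (m b u) + m (m b d) (m a u) + m (m a b) (m d u) := by
  have := h.linearized a b u d
  rw [h.comm (m b u) d, h.comm (m a u) d, h.comm u (m (m a b) d), h.comm u d,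
    h.comm (m b u) (m a d), h.comm (m a u) (m b d)] at this
  linear_combination (norm := module) this

/-- The right-hand side of `mul_mul_mul` is symmetric in its three elements, so two instances with
permuted arguments have equal left-hand sides, and their difference is this identity. -/
theorem lie_lie (h : IsJordanMul m) (a b d u : A) :
    m a (m b (m d u)) - m b (m a (m d u)) - (m d (m a (m b u)) - m d (m b (m a u))) =
      m (m a (m b d) - m b (m a d)) u := by
  have h1 := h.mul_mul_mul b d a u
  have h2 := h.mul_mul_mul a d b u
  rw [h.comm (m b d) a] at h1
  rw [h.comm (m a d) b] at h2
  rw [h.comm d a] at h1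
  rw [h.comm d b] at h2
  rw [h.comm b a] at h1
  simp only [map_sub, LinearMap.sub_apply]
  linear_combination (norm := module) h2 - h1

/-- Commutators of multiplication operators are derivations. -/
theorem lie_mul (h : IsJordanMul m) (a b x y : A) :
    m a (m b (m x y)) - m b (m a (m x y)) =
      m (m a (m b x) - m b (m a x)) y + m x (m a (m b y) - m b (m a y)) := by
  have := h.lie_lie a b x y
  simp only [map_sub] at this ⊢
  linear_combination (norm := module) this

/-- Infinitesimal form of P(gx) = g P(x) g* for g = exp L(v); `IsStr.Q_exp` integrates it back. -/
theorem mul_quad_add_quad_mul (h : IsJordanMul m) (v x u : A) :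
    m v (quad m x x u) + quad m x x (m v u) = (2 : 𝕜) • quad m (m v x) x u := by
  have h1 := h.mul_mul_mul x v x u
  have h2 := h.commute_sq x v u
  rw [h.comm v x]
  rw [h.comm v x] at h1
  simp only [quad_apply, map_add, map_sub]
  linear_combination (norm := module) (2 : 𝕜) • h1 - h2

theorem quad_comm (h : IsJordanMul m) (x y : A) : quad m x y = quad m y x := by
  ext u; simp only [quad_apply, h.comm x y]; abel

theorem mul_quad_add_quad_mul' (h : IsJordanMul m) (v x y u : A) :
    m v (quad m x y u) + quad m x y (m v u) = quad m (m v x) y u + quad m x (m v y) u := by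
  have h1 := h.mul_quad_add_quad_mul v (x + y) u
  have h2 := h.mul_quad_add_quad_mul v x u
  have h3 := h.mul_quad_add_quad_mul v y u
  simp only [quad_apply, map_add, map_sub, LinearMap.add_apply, h.comm y x,
    h.comm (m v y) x, h.comm y (m v x)] at h1 h2 h3 ⊢
  linear_combination (norm := module) (1 / 2 : 𝕜) • (h1 - h2 - h3)

/-- The previous identity is applied for a and b in both orders; the cross terms P(ax, bx) cancel by
symmetry. -/
theorem lie_quad (h : IsJordanMul m) (a b x u : A) :
    m a (m b (quad m x x u)) - m b (m a (quad m x x u)) -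
      (quad m x x (m a (m b u)) - quad m x x (m b (m a u))) =
      (2 : 𝕜) • quad m (m a (m b x) - m b (m a x)) x u := by
  have h1 := h.mul_quad_add_quad_mul b x u
  have h2 := h.mul_quad_add_quad_mul a x u
  have h3 := h.mul_quad_add_quad_mul a x (m b u)
  have h4 := h.mul_quad_add_quad_mul b x (m a u)
  have h5 := h.mul_quad_add_quad_mul' a (m b x) x u
  have h6 := h.mul_quad_add_quad_mul' b (m a x) x u
  have h7 : quad m (m b x) (m a x) u = quad m (m a x) (m b x) u := by rw [h.quad_comm]
  have h1' := congrArg (m a) h1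
  have h2' := congrArg (m b) h2
  have e : quad m (m a (m b x) - m b (m a x)) x u =
      quad m (m a (m b x)) x u - quad m (m b (m a x)) x u := by
    simp only [quad_apply, map_sub, LinearMap.sub_apply]; abel
  rw [e]
  simp only [map_add, map_smul] at h1' h2'
  linear_combination (norm := module) h1' - h2' - h3 + h4 + (2 : 𝕜) • h5 - (2 : 𝕜) • h6 + (2 : 𝕜) • h7

end IsJordanMul

namespace EuclideanJordanAlgebra

/-! ### Calculus of multiplication operators -/

section Basic

variable {V : Type*} [NormedAddCommGroup V] [InnerProductSpace ℝ V] [EuclideanJordanAlgebra V]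

theorem mul_zero' (a : V) : a * 0 = 0 := by simpa using mul_smul' (0 : ℝ) a 0

theorem zero_mul' (a : V) : 0 * a = 0 := by rw [mul_comm, mul_zero']

theorem neg_mul' (a b : V) : -a * b = -(a * b) := by rw [mul_comm, mul_neg', mul_comm]

theorem mul_sub' (a b c : V) : a * (b - c) = a * b - a * c := by
  rw [sub_eq_add_neg, mul_add', mul_neg', sub_eq_add_neg]

theorem sub_mul' (a b c : V) : (a - b) * c = a * c - b * c := by
  rw [mul_comm, mul_sub', mul_comm c a, mul_comm c b]

/-- The Jordan product as a bilinear map. -/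
def mulBilin : V →ₗ[ℝ] V →ₗ[ℝ] V :=
  LinearMap.mk₂ ℝ (fun x y => x * y) add_mul' smul_mul' mul_add' mul_smul'

@[simp] theorem mulBilin_apply (x y : V) : mulBilin x y = x * y := rfl

theorem isJordanMul : IsJordanMul (mulBilin (V := V)) where
  comm a b := mul_comm a b
  jordan a b := IsCommJordan.lmul_comm_rmul_rmul a b

theorem mul_sum' {ι : Type*} (s : Finset ι) (a : V) (f : ι → V) :
    a * ∑ i ∈ s, f i = ∑ i ∈ s, a * f i := map_sum (mulBilin a) f s

theorem sum_mul' {ι : Type*} (s : Finset ι) (a : V) (f : ι → V) :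
    (∑ i ∈ s, f i) * a = ∑ i ∈ s, f i * a := by
  simp only [mul_comm _ a, mul_sum']

theorem linearized (a b c d : V) :
    a * ((b * c) * d) - (b * c) * (a * d) + (b * ((a * c) * d) - (a * c) * (b * d)) +
      (c * ((a * b) * d) - (a * b) * (c * d)) = 0 :=
  isJordanMul.linearized a b c d

theorem commute_sq (a b d : V) :
    b * ((a * a) * d) - (a * a) * (b * d) +
      (2 : ℝ) • (a * ((a * b) * d) - (a * b) * (a * d)) = 0 :=
  isJordanMul.commute_sq a b d

theorem lie_lie (a b d u : V) :
    a * (b * (d * u)) - b * (a * (d * u)) - (d * (a * (b * u)) - d * (b * (a * u))) =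
      (a * (b * d) - b * (a * d)) * u :=
  isJordanMul.lie_lie a b d u

theorem lie_mul (a b x y : V) :
    a * (b * (x * y)) - b * (a * (x * y)) =
      (a * (b * x) - b * (a * x)) * y + x * (a * (b * y) - b * (a * y)) :=
  isJordanMul.lie_mul a b x y

theorem inner_mul_left (a b c : V) : inner ℝ (a * b) c = inner ℝ b (a * c) := inner_mul' a b c

theorem inner_mul_right (a b c : V) : inner ℝ b (a * c) = inner ℝ (a * b) c := (inner_mul' a b c).symm

end Basic

section Operators

variable {V : Type*} [NormedAddCommGroup V] [InnerProductSpace ℝ V] [EuclideanJordanAlgebra V]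
  [FiniteDimensional ℝ V]

@[simp] theorem L_apply (x y : V) : L x y = x * y := rfl

theorem L_add (x y : V) : L (x + y) = L x + L y := by ext u; simp [add_mul']

theorem L_smul (r : ℝ) (x : V) : L (r • x) = r • L x := by ext u; simp [smul_mul']

theorem L_one : L (1 : V) = 1 := by ext u; simp

theorem L_zero : L (0 : V) = 0 := by ext u; simp [zero_mul']

theorem L_sum {ι : Type*} (s : Finset ι) (f : ι → V) : L (∑ i ∈ s, f i) = ∑ i ∈ s, L (f i) := by
  ext u; simp [sum_mul', _root_.sum_apply]

theorem continuous_L : Continuous (L : V → V →L[ℝ] V) :=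
  LinearMap.continuous_of_finiteDimensional
    ({ toFun := L, map_add' := L_add, map_smul' := L_smul } : V →ₗ[ℝ] V →L[ℝ] V)

theorem continuous_mul' {X : Type*} [TopologicalSpace X] {f g : X → V} (hf : Continuous f)
    (hg : Continuous g) : Continuous fun x => f x * g x :=
  (continuous_L.comp hf).clm_apply hg

/-- The polarized quadratic representation of `V`. -/
def Q (x y : V) : V →L[ℝ] V := L x * L y + L y * L x - L (x * y)

theorem Q_apply (x y u : V) : Q x y u = x * (y * u) + y * (x * u) - (x * y) * u := rfl

theorem Q_comm (x y : V) : Q x y = Q y x := by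
  ext u; simp only [Q_apply, mul_comm x y]; abel

theorem Q_one_right (x : V) : Q x 1 = L x := by ext u; simp [Q_apply]

theorem Q_self_one (x : V) : Q x x 1 = x * x := by simp [Q_apply]

theorem Q_add_left (x y z : V) : Q (x + y) z = Q x z + Q y z := by
  ext u; simp only [Q_apply, add_mul', mul_add', _root_.add_apply]; abel

theorem Q_smul_left (r : ℝ) (x z : V) : Q (r • x) z = r • Q x z := by
  ext u
  simp only [Q_apply, smul_mul', mul_smul', _root_.smul_apply, smul_add, smul_sub]

theorem Q_smul_right (r : ℝ) (x z : V) : Q z (r • x) = r • Q z x := by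
  rw [Q_comm, Q_smul_left, Q_comm]

theorem inner_Q (x y u v : V) : inner ℝ (Q x y u) v = inner ℝ u (Q x y v) := by
  simp only [Q_apply, inner_add_left, inner_sub_left, inner_add_right, inner_sub_right,
    inner_mul_left]
  ring

theorem mul_Q_add_Q_mul (v x u : V) :
    v * Q x x u + Q x x (v * u) = (2 : ℝ) • Q (v * x) x u :=
  isJordanMul.mul_quad_add_quad_mul v x u

theorem mul_Q_add_Q_mul' (v x y u : V) :
    v * Q x y u + Q x y (v * u) = Q (v * x) y u + Q x (v * y) u :=
  isJordanMul.mul_quad_add_quad_mul' v x y u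

theorem lie_Q (a b x u : V) :
    a * (b * Q x x u) - b * (a * Q x x u) - (Q x x (a * (b * u)) - Q x x (b * (a * u))) =
      (2 : ℝ) • Q (a * (b * x) - b * (a * x)) x u :=
  isJordanMul.lie_quad a b x u

end Operators

/-! ### The Peirce decomposition -/

section Peirce

variable {V : Type*} [NormedAddCommGroup V] [InnerProductSpace ℝ V] [EuclideanJordanAlgebra V]
  [FiniteDimensional ℝ V]

/-- Three equal arguments in `mul_mul_mul`. The roots 0, 1/2, 1 of the cubic are the Peirce
eigenvalues. -/
theorem idempotent_cubic {c : V} (hc : c * c = c) (u : V) :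
    (2 : ℝ) • (c * (c * (c * u))) - (3 : ℝ) • (c * (c * u)) + c * u = 0 := by
  have h := isJordanMul.mul_mul_mul c c c u
  simp only [mulBilin_apply, hc] at h
  linear_combination (norm := module) h

/-- The Peirce space `V(c, 1)` is closed under squares. -/
theorem peirce_one_sq {c x : V} (hc : c * c = c) (hx : c * x = x) : c * (x * x) = x * x := by
  set q := x * x with hq
  have h := mul_Q_add_Q_mul c x c
  have hQ : Q x x c = (2 : ℝ) • q - c * q := by
    rw [Q_apply, mul_comm x c, hx, ← hq, mul_comm q c]; module
  rw [hc, hx, hQ, mul_sub', mul_smul'] at h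
  have h3 := idempotent_cubic hc q
  -- That is, (L(c) - 1)(L(c) - 2) q = 0; the only root shared with the Peirce cubic is 1.
  have h' : c * (c * q) = (3 : ℝ) • (c * q) - (2 : ℝ) • q := by
    linear_combination (norm := module) -h
  rw [h', mul_sub', mul_smul', mul_smul', h'] at h3
  linear_combination (norm := module) (1/6 : ℝ) • h3

/-- An idempotent whose Peirce space `V(c, 1)` contains an element orthogonal to `c` is not
primitive: the maximum of `(x² | x)` on the unit sphere of `V(c, 1)` is attained at a multiple of a
smaller idempotent. -/
theorem IsPrimitiveIdempotent.peirce_one {c : V} (hc : IsPrimitiveIdempotent c) {x : V}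
    (hx : c * x = x) : ∃ r : ℝ, x = r • c := by
  obtain ⟨hc0, hcc, hprim⟩ := hc
  set f : V → ℝ := fun y => inner ℝ (y * y) y with hf
  have hfc : Continuous f := (continuous_mul' continuous_id continuous_id).inner continuous_id
  let S : Set V := {y | c * y = y} ∩ Metric.sphere 0 1
  have hSc : IsCompact S := by
    apply (isCompact_sphere (0 : V) 1).inter_left
    exact isClosed_eq (continuous_mul' continuous_const continuous_id) continuous_id
  have hcn : 0 < ‖c‖ := norm_pos_iff.mpr hc0
  have hnS : ‖c‖⁻¹ • c ∈ S := by
    refine ⟨by simp [mul_smul', hcc], ?_⟩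
    simp [norm_smul, hcn.ne']
  obtain ⟨n, hnS', hmax⟩ := hSc.exists_isMaxOn ⟨_, hnS⟩ hfc.continuousOn
  obtain ⟨hn1, hn2⟩ := hnS'
  simp only [Set.mem_ofPred_eq] at hn1
  simp only [mem_sphere_iff_norm, sub_zero] at hn2
  set lam := f n with hlam
  have hbound : ∀ y : V, c * y = y → f y ≤ lam * ‖y‖ ^ 3 := by
    intro y hy
    by_cases hy0 : y = 0
    · simp [hf, hy0]
    have hyn : 0 < ‖y‖ := norm_pos_iff.mpr hy0
    have h := hmax (show ‖y‖⁻¹ • y ∈ S from ⟨by simp [mul_smul', hy], by simp [norm_smul, hyn.ne']⟩)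
    have e : f (‖y‖⁻¹ • y) = f y / ‖y‖ ^ 3 := by
      simp only [hf, mul_smul', smul_mul', real_inner_smul_left, real_inner_smul_right]
      field_simp
    simp only [Set.mem_ofPred_eq, e] at h
    rwa [div_le_iff₀ (by positivity)] at h
  have hlam1 : ‖c‖⁻¹ ≤ lam := by
    have h := hbound c hcc
    simp only [hf, hcc, real_inner_self_eq_norm_sq] at h
    rw [inv_le_iff_one_le_mul₀ hcn]
    have h4 : ‖c‖ ^ 2 * 1 ≤ ‖c‖ ^ 2 * (lam * ‖c‖) := by linarith [h]
    exact le_of_mul_le_mul_left h4 (by positivity)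
  have hlam0 : 0 < lam := lt_of_lt_of_le (by positivity) hlam1
  have hexp : ∀ (y z : V) (t : ℝ), f (y + t • z) =
      f y + 3 * t * inner ℝ (y * y) z + 3 * t ^ 2 * inner ℝ (z * z) y + t ^ 3 * f z := by
    intro y z t
    simp only [hf, mul_add', add_mul', mul_smul', smul_mul', inner_add_left, inner_add_right,
      real_inner_smul_left, real_inner_smul_right]
    have e1 : inner ℝ (y * z) y = inner ℝ (y * y) z := by
      rw [inner_mul_left, real_inner_comm]
    have e2 : inner ℝ (z * y) y = inner ℝ (y * y) z := by rw [mul_comm, e1]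
    have e3 : inner ℝ (z * y) z = inner ℝ (z * z) y := by rw [inner_mul_left, real_inner_comm]
    have e4 : inner ℝ (y * z) z = inner ℝ (z * z) y := by rw [mul_comm, e3]
    rw [e1, e2, e3, e4]; ring
  -- Lagrange condition for the maximum: the gradient of the cubic form at n is 3n², and n² stays in
  -- the Peirce space.
  have hcrit : n * n = lam • n := by
    set h := n * n - lam • n with hh
    have hch : c * h = h := by rw [hh, mul_sub', mul_smul', peirce_one_sq hcc hn1, hn1]
    have horth : inner ℝ n h = 0 := by
      rw [hh, inner_sub_right, real_inner_smul_right, real_inner_self_eq_norm_sq, hn2, hlam, hf]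
      simp only [real_inner_comm n]; ring
    have hnh : inner ℝ (n * n) h = ‖h‖ ^ 2 := by
      have : n * n = h + lam • n := by rw [hh]; abel
      rw [this, inner_add_left, real_inner_smul_left, horth, real_inner_self_eq_norm_sq]; ring
    by_contra hne
    have hh0 : 0 < ‖h‖ := norm_pos_iff.mpr (by rw [hh]; exact sub_ne_zero.mpr hne)
    -- Moving from n along h gains 3t‖h‖² to first order, while the bound grows only to second
    -- order. The cube of the norm, which is at least 1, is replaced by its fourth power to avoid a
    -- square root.
    have key : ∀ t : ℝ, 0 ≤ t → t ≤ 1 → 3 * t * ‖h‖ ^ 2 + 3 * t ^ 2 * inner ℝ (h * h) n + t ^ 3 * f h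
        ≤ lam * ((1 + t ^ 2 * ‖h‖ ^ 2) ^ 2 - 1) := by
      intro t _ _
      have h1 := hbound (n + t • h) (by rw [mul_add', mul_smul', hn1, hch])
      rw [hexp, hnh] at h1
      have h2 : ‖n + t • h‖ ^ 2 = 1 + t ^ 2 * ‖h‖ ^ 2 := by
        rw [norm_add_sq_real, real_inner_smul_right, horth, hn2, norm_smul, mul_pow]
        simp
      have h3 : 1 ≤ ‖n + t • h‖ := by
        have : (1:ℝ) ^ 2 ≤ ‖n + t • h‖ ^ 2 := by rw [h2]; nlinarith [sq_nonneg (t * ‖h‖)]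
        exact (sq_le_sq₀ zero_le_one (norm_nonneg _)).mp this
      have h4 : ‖n + t • h‖ ^ 3 ≤ (1 + t ^ 2 * ‖h‖ ^ 2) ^ 2 := by
        rw [← h2, ← pow_mul]; exact pow_le_pow_right₀ h3 (by norm_num)
      have h5 := mul_le_mul_of_nonneg_left h4 hlam0.le
      rw [← hlam] at h1
      linarith
    set A := ‖h‖ ^ 2 with hA
    have hApos : 0 < A := by positivity
    set B := inner ℝ (h * h) n
    set C := f h
    have key2 : ∀ t : ℝ, 0 < t → t ≤ 1 → 3 * A ≤ t * (3 * |B| + |C| + lam * (2 * A + A ^ 2)) := by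
      intro t ht ht1
      have h1 := key t ht.le ht1
      have h2 : -(t * |B|) ≤ t * B := by
        rw [← mul_neg]; exact mul_le_mul_of_nonneg_left (neg_abs_le B) ht.le
      have h3 : -(t * |C|) ≤ t ^ 2 * C := by
        have := mul_le_mul_of_nonneg_left (neg_abs_le C) (sq_nonneg t)
        have h4 : t ^ 2 * |C| ≤ t * |C| :=
          mul_le_mul_of_nonneg_right (by nlinarith) (abs_nonneg C)
        linarith
      have h5 : t * (3 * A + 3 * (t * B) + t ^ 2 * C) ≤ t * (lam * (2 * t * A + t ^ 3 * A ^ 2)) := by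
        nlinarith [h1]
      have h6 := le_of_mul_le_mul_left h5 ht
      have h7 : t ^ 3 * A ^ 2 ≤ t * A ^ 2 := by
        apply mul_le_mul_of_nonneg_right _ (sq_nonneg A)
        calc t ^ 3 = t * t ^ 2 := by ring
          _ ≤ t * 1 := mul_le_mul_of_nonneg_left (by nlinarith) ht.le
          _ = t := mul_one t
      have h8 := mul_le_mul_of_nonneg_left h7 hlam0.le
      linarith
    set M := 3 * |B| + |C| + lam * (2 * A + A ^ 2)
    have hM : 0 < M := by positivity
    have h1 := key2 (min 1 (A / M)) (by positivity) (min_le_left _ _)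
    have h2 : min 1 (A / M) * M ≤ A / M * M :=
      mul_le_mul_of_nonneg_right (min_le_right _ _) hM.le
    rw [div_mul_cancel₀ _ hM.ne'] at h2
    linarith
  set d := lam⁻¹ • n with hd
  have hdd : d * d = d := by
    rw [hd, mul_smul', smul_mul', hcrit, smul_smul, smul_smul]
    congr 1; field_simp
  have hcd : c * d = d := by rw [hd, mul_smul', hn1]
  have hd0 : d ≠ 0 := by
    rw [hd]; exact smul_ne_zero (inv_ne_zero hlam0.ne') (by rintro rfl; simp at hn2)
  -- The maximizer, rescaled, is an idempotent d below c, and c - d is idempotent too; primitivity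
  -- leaves d = c, which fixes the maximum as 1/‖c‖.
  have hdc : d = c := by
    rcases hprim d (c - d) hdd (by
      rw [mul_sub', sub_mul', sub_mul', hcc, hdd, hcd, mul_comm d c, hcd]; abel)
      (by abel) with h | h
    · exact absurd h hd0
    · rw [sub_eq_zero] at h; exact h.symm
  have hlc : lam = ‖c‖⁻¹ := by
    have : ‖d‖ = lam⁻¹ := by rw [hd, norm_smul, hn2]; simp [abs_of_pos hlam0]
    rw [← hdc, this, inv_inv]
  set r := inner ℝ c x / ‖c‖ ^ 2 with hr
  refine ⟨r, ?_⟩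
  by_contra hne
  set h := x - r • c with hh
  have hch : c * h = h := by rw [hh, mul_sub', mul_smul', hx, hcc]
  have hh0 : 0 < ‖h‖ := norm_pos_iff.mpr (sub_ne_zero.mpr hne)
  have horth : inner ℝ c h = 0 := by
    rw [hh, inner_sub_right, real_inner_smul_right, real_inner_self_eq_norm_sq, hr]
    field_simp; ring
  -- With th of the same norm as c, the cubic form at c + th is at least 4‖c‖², whereas the maximum
  -- allows only ‖c‖⁻¹(√2‖c‖)³ = 2√2‖c‖². The sign condition on f h is met by h or by -h.
  have key : ∀ h : V, c * h = h → inner ℝ c h = 0 → 0 < ‖h‖ → 0 ≤ f h → False := by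
    intro h hch horth hh0 hfh
    set t := ‖c‖ / ‖h‖ with htdef
    have ht : t * ‖h‖ = ‖c‖ := by rw [htdef]; field_simp
    have hft : 0 ≤ t ^ 3 * f h := mul_nonneg (by positivity) hfh
    have h1 := hbound (c + t • h) (by rw [mul_add', mul_smul', hcc, hch])
    rw [hexp, hcc, horth, inner_mul_left, mul_comm h c, hch, real_inner_self_eq_norm_sq] at h1
    have hfcc : f c = ‖c‖ ^ 2 := by simp only [hf, hcc, real_inner_self_eq_norm_sq]
    have h2 : ‖c + t • h‖ ^ 2 = 2 * ‖c‖ ^ 2 := by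
      rw [norm_add_sq_real, real_inner_smul_right, horth, norm_smul, mul_pow, Real.norm_eq_abs,
        sq_abs, ← mul_pow, ht]
      ring
    have h3 : t ^ 2 * ‖h‖ ^ 2 = ‖c‖ ^ 2 := by rw [← mul_pow, ht]
    have h4 : 4 * ‖c‖ ^ 3 ≤ ‖c + t • h‖ ^ 3 := by
      have : 4 * ‖c‖ ^ 2 ≤ lam * ‖c + t • h‖ ^ 3 := by
        rw [hfcc] at h1; nlinarith
      rw [hlc, inv_mul_eq_div, le_div_iff₀ hcn] at this
      linarith
    have h5 : (4 * ‖c‖ ^ 3) ^ 2 ≤ (‖c + t • h‖ ^ 3) ^ 2 := by gcongr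
    have h6 : (‖c + t • h‖ ^ 3) ^ 2 = 8 * ‖c‖ ^ 6 := by
      rw [← pow_mul, show 3 * 2 = 2 * 3 from rfl, pow_mul, h2]; ring
    rw [h6] at h5
    nlinarith [pow_pos hcn 6]
  rcases le_total 0 (f h) with hfh | hfh
  · exact key h hch horth hh0 hfh
  · refine key (-h) (by rw [mul_neg', hch]) (by rw [inner_neg_right, horth, neg_zero])
      (by rwa [norm_neg]) ?_
    have hneg : f (-h) = -f h := by simp only [hf, mul_neg', neg_mul', inner_neg_right]; simp
    linarith

end Peirce

end EuclideanJordanAlgebra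

namespace EuclideanJordanAlgebra

/-! ### Peirce decomposition with respect to a Jordan frame -/

section FramePeirce

variable {V : Type*} [NormedAddCommGroup V] [InnerProductSpace ℝ V] [EuclideanJordanAlgebra V]
  [FiniteDimensional ℝ V] {l : ℕ} {c : Fin l → V}

/-- The element `∑ h_j c_j`. -/
def diag (c : Fin l → V) (h : Fin l → ℝ) : V := ∑ j, h j • c j

/-- The operator `P(c_i, c_j)`, a multiple of the projection onto the Peirce space `V_ij`. -/
def peirce (c : Fin l → V) (i j : Fin l) : V →L[ℝ] V := Q (c i) (c j)

theorem peirce_comm (c : Fin l → V) (i j : Fin l) : peirce c i j = peirce c j i := Q_comm _ _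

namespace IsJordanFrame

variable (hc : IsJordanFrame c)
include hc

theorem ne_zero (i : Fin l) : c i ≠ 0 := (hc.primitive i).1

theorem idem (i : Fin l) : c i * c i = c i := (hc.primitive i).2.1

theorem mul_eq (i j : Fin l) : c i * c j = if i = j then c i else 0 := by
  split_ifs with h
  · rw [h, hc.idem]
  · exact hc.orthogonal i j h

theorem mul_left_comm (i j : Fin l) (u : V) : c i * (c j * u) = c j * (c i * u) := by
  rcases eq_or_ne i j with rfl | h
  · rfl
  have h1 := commute_sq (c i) (c j) u
  rw [hc.idem, hc.orthogonal i j h, zero_mul', zero_mul', mul_zero', sub_zero, smul_zero,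
    add_zero, sub_eq_zero] at h1
  exact h1.symm

/-- By bilinearity the sum is P(e, e), the identity. It runs over ordered pairs, so each
off-diagonal space is counted twice. -/
theorem sum_peirce (u : V) : ∑ i, ∑ j, peirce c i j u = u := by
  simp only [peirce, Q_apply, Finset.sum_sub_distrib, Finset.sum_add_distrib]
  have h1 : ∑ i, ∑ j, c i * (c j * u) = u := by
    simp only [← mul_sum', ← sum_mul', hc.complete, one_mul]
  have h2 : ∑ i, ∑ j, c j * (c i * u) = u := by
    rw [Finset.sum_comm]; exact h1
  have h3 : ∑ i, ∑ j, c i * c j * u = u := by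
    simp only [← sum_mul', ← mul_sum', hc.complete, mul_one, one_mul]
  rw [h1, h2, h3]; abel

theorem peirce_mul (i j k : Fin l) (u : V) :
    peirce c i j (c k * u) = c k * peirce c i j u := by
  simp only [peirce, Q_apply, mul_add', mul_sub']
  rw [hc.mul_left_comm j k, hc.mul_left_comm i k (c j * u), hc.mul_left_comm i k u,
    hc.mul_left_comm j k (c i * u), hc.mul_eq i j]
  split_ifs
  · rw [hc.mul_left_comm i k u]
  · simp [zero_mul', mul_zero']

theorem mul_peirce (i j k : Fin l) (u : V) :
    c k * peirce c i j u =
      (((if k = i then 1 else 0) + (if k = j then 1 else 0) : ℝ) / 2) • peirce c i j u := by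
  have h := mul_Q_add_Q_mul' (c k) (c i) (c j) u
  change c k * peirce c i j u + peirce c i j (c k * u) = _ at h
  rw [hc.peirce_mul] at h
  have e1 : Q (c k * c i) (c j) u = (if k = i then (1 : ℝ) else 0) • peirce c i j u := by
    rw [hc.mul_eq]; split_ifs with hk
    · rw [hk, one_smul]; rfl
    · rw [zero_smul, ← zero_smul ℝ (0 : V), Q_smul_left]; simp
  have e2 : Q (c i) (c k * c j) u = (if k = j then (1 : ℝ) else 0) • peirce c i j u := by
    rw [hc.mul_eq]; split_ifs with hk
    · rw [hk, one_smul]; rfl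
    · rw [zero_smul, ← zero_smul ℝ (0 : V), Q_smul_right]; simp
  rw [e1, e2] at h
  linear_combination (norm := module) (1 / 2 : ℝ) • h

theorem diag_mul_peirce (h : Fin l → ℝ) (i j : Fin l) (u : V) :
    diag c h * peirce c i j u = ((h i + h j) / 2) • peirce c i j u := by
  simp only [diag, sum_mul', smul_mul', hc.mul_peirce, smul_smul, ← Finset.sum_smul]
  congr 1
  have : ∀ k, h k * (((if k = i then 1 else 0) + if k = j then 1 else 0) / 2) =
      (if k = i then h k / 2 else 0) + (if k = j then h k / 2 else 0) := by
    intro k; split_ifs <;> ring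
  simp only [this, Finset.sum_add_distrib, Finset.sum_ite_eq', Finset.mem_univ, if_true]
  ring

theorem peirce_diag_mul (h : Fin l → ℝ) (i j : Fin l) (u : V) :
    peirce c i j (diag c h * u) = ((h i + h j) / 2) • peirce c i j u := by
  rw [← hc.diag_mul_peirce]
  simp only [diag, sum_mul', smul_mul', map_sum, map_smul, hc.peirce_mul]

theorem diag_mul_diag (h k : Fin l → ℝ) : diag c h * diag c k = diag c (fun j => h j * k j) := by
  simp only [diag, sum_mul', mul_sum', smul_mul', mul_smul', hc.mul_eq, smul_ite, smul_zero,
    Finset.sum_ite_eq', Finset.mem_univ, if_true, smul_smul, mul_comm (k _)]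

theorem diag_one : diag c (fun _ => 1) = 1 := by simp [diag, hc.complete]

theorem Q_diag_peirce (h k : Fin l → ℝ) (i j : Fin l) (u : V) :
    Q (diag c h) (diag c k) (peirce c i j u) = ((h i * k j + h j * k i) / 2) • peirce c i j u := by
  rw [Q_apply, hc.diag_mul_diag]
  simp only [hc.diag_mul_peirce, mul_smul', smul_smul]
  module

/-- For i ≠ j the operator P(c_i, c_j) is half the orthogonal projection onto V_ij, hence the factor
1/2; for i = j it is the projection itself. -/
theorem peirce_peirce (i j : Fin l) (u : V) :
    peirce c i j (peirce c i j u) = (if i = j then (1 : ℝ) else 1 / 2) • peirce c i j u := by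
  conv_lhs => rw [peirce, Q_apply]
  change c i * (c j * peirce c i j u) + c j * (c i * peirce c i j u) -
    c i * c j * peirce c i j u = _
  rw [hc.mul_eq]
  split_ifs with hij
  · subst hij
    simp only [hc.mul_peirce, mul_smul', if_true]
    module
  · simp only [hc.mul_peirce, mul_smul', if_true, zero_mul', hij, Ne.symm hij, if_false]
    module

theorem inner_peirce_nonneg (i j : Fin l) (u : V) : 0 ≤ inner ℝ (peirce c i j u) u := by
  have h := hc.peirce_peirce i j u
  have h2 : inner ℝ (peirce c i j u) (peirce c i j u) =
      (if i = j then (1 : ℝ) else 1 / 2) * inner ℝ (peirce c i j u) u := by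
    rw [← real_inner_smul_left, ← h]; exact (inner_Q _ _ _ _).symm
  have h3 : 0 ≤ inner ℝ (peirce c i j u) (peirce c i j u) := real_inner_self_nonneg
  rw [h2] at h3
  split_ifs at h3 <;> linarith

theorem peirce_self (i : Fin l) (u : V) : ∃ r : ℝ, peirce c i i u = r • c i := by
  apply (hc.primitive i).peirce_one
  rw [hc.mul_peirce]; simp

theorem peirce_apply_self (i : Fin l) : peirce c i i (c i) = c i := by
  simp [peirce, Q_apply, hc.idem]

theorem diag_apply (h : Fin l → ℝ) (i : Fin l) : c i * diag c h = h i • c i := by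
  simp only [diag, mul_sum', mul_smul', hc.mul_eq, smul_ite, smul_zero, Finset.sum_ite_eq,
    Finset.mem_univ, if_true]

/-- An element without off-diagonal Peirce components lies in the span of the frame. -/
theorem exists_diag {u : V} (h : ∀ i j, i ≠ j → peirce c i j u = 0) : ∃ β, u = diag c β := by
  choose r hr using fun i => hc.peirce_self i u
  refine ⟨r, ?_⟩
  conv_lhs => rw [← hc.sum_peirce u]
  refine Finset.sum_congr rfl fun i _ => ?_
  rw [Finset.sum_eq_single i (fun j _ hj => h i j hj.symm) (by simp), hr]

theorem inner_diag (h : Fin l → ℝ) (i : Fin l) : inner ℝ (diag c h) (c i) = h i * ‖c i‖ ^ 2 := by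
  have e : inner ℝ (diag c h) (c i) = inner ℝ (c i * diag c h) (c i) := by
    rw [inner_mul_left, hc.idem]
  rw [e, hc.diag_apply, real_inner_smul_left, real_inner_self_eq_norm_sq]

/-- The operator `L(∑ β_j c_j)` is positive semidefinite iff all `β_j` are nonnegative. -/
theorem inner_diag_mul_nonneg_iff (β : Fin l → ℝ) :
    (∀ u, 0 ≤ inner ℝ (diag c β * u) u) ↔ ∀ j, 0 ≤ β j := by
  constructor
  · intro h j
    have h1 := h (c j)
    rw [mul_comm, hc.diag_apply, real_inner_smul_left, real_inner_self_eq_norm_sq] at h1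
    exact nonneg_of_mul_nonneg_left h1 (by have := norm_pos_iff.mpr (hc.ne_zero j); positivity)
  · intro h u
    have e : diag c β * u = ∑ i, ∑ j, ((β i + β j) / 2) • peirce c i j u := by
      conv_lhs => rw [← hc.sum_peirce u]
      simp only [mul_sum', hc.diag_mul_peirce]
    rw [e]
    simp only [sum_inner, real_inner_smul_left]
    exact Finset.sum_nonneg fun i _ => Finset.sum_nonneg fun j _ =>
      mul_nonneg (by linarith [h i, h j]) (hc.inner_peirce_nonneg i j u)

/-- The action of a diagonal element on `V_ij` up to the derivation `[L(c_i), L(u)]`. -/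
theorem lie_diag_peirce {i j : Fin l} (hij : i ≠ j) (h : Fin l → ℝ) (u v : V) :
    diag c h * (peirce c i j u * v) - peirce c i j u * (diag c h * v) =
      (h i - h j) • (c i * (peirce c i j u * v) - peirce c i j u * (c i * v)) := by
  set w := peirce c i j u with hw
  have hk : ∀ k, c k * w = (((if k = i then 1 else 0) + (if k = j then 1 else 0) : ℝ) / 2) • w :=
    fun k => hc.mul_peirce i j k u
  have key : ∀ k, k ≠ i → c k * (w * v) - w * (c k * v) =
      (if k = j then -1 else 0 : ℝ) • (c i * (w * v) - w * (c i * v)) := by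
    intro k hki
    have h1 := linearized (c i) (c k) w v
    rw [hc.orthogonal i k hki.symm, hk i, hk k] at h1
    simp only [zero_mul', mul_zero', if_true, hij, if_false, hki, smul_mul', mul_smul'] at h1
    split_ifs at h1 ⊢ with hkj
    · linear_combination (norm := module) (2 : ℝ) • h1
    · linear_combination (norm := module) (2 : ℝ) • h1
  simp only [diag, sum_mul', mul_sum', smul_mul', mul_smul', ← Finset.sum_sub_distrib, ← smul_sub]
  have e : ∀ k, h k • (c k * (w * v) - w * (c k * v)) =
      ((if k = i then h k else 0) - (if k = j then h k else 0)) •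
        (c i * (w * v) - w * (c i * v)) := by
    intro k
    by_cases hki : k = i
    · subst hki; simp [hij]
    · rw [key k hki, smul_smul]; congr 1; split_ifs <;> simp
  simp only [e, ← Finset.sum_smul, Finset.sum_sub_distrib, Finset.sum_ite_eq', Finset.mem_univ,
    if_true]

theorem diag_single (k : Fin l) : diag c (Pi.single k 1) = c k := by
  simp [diag, Pi.single_apply]

theorem mul_peirce_mul {i j k : Fin l} (hij : i ≠ j) (hki : k ≠ i) (hkj : k ≠ j) (u v : V) :
    c k * (peirce c i j u * v) = peirce c i j u * (c k * v) := by
  have h := hc.lie_diag_peirce hij (Pi.single k 1) u v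
  rw [hc.diag_single, Pi.single_eq_of_ne hki.symm, Pi.single_eq_of_ne hkj.symm, sub_zero,
    zero_smul, sub_eq_zero] at h
  exact h

theorem inner_mul_nonneg (k : Fin l) (u : V) : 0 ≤ inner ℝ (c k * u) u := by
  have := (hc.inner_diag_mul_nonneg_iff (Pi.single k 1)).mpr (fun j => by
    rw [Pi.single_apply]; split_ifs <;> norm_num) u
  rwa [hc.diag_single] at this

theorem peirce_eq_two_smul {i j : Fin l} (hij : i ≠ j) (u : V) :
    peirce c i j u = (2 : ℝ) • (c i * (c j * u)) := by
  rw [peirce, Q_apply, hc.orthogonal i j hij, zero_mul', hc.mul_left_comm j i]; module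

/-- Squares of elements of `V_ij` lie in `V_ii + V_jj`. -/
theorem peirce_sq {i j : Fin l} (hij : i ≠ j) (x : V) :
    ∃ β : Fin l → ℝ, peirce c i j x * peirce c i j x = diag c β ∧
      β j * ‖c j‖ ^ 2 = ‖peirce c i j x‖ ^ 2 / 2 ∧ ∀ k, k ≠ i → k ≠ j → β k = 0 := by
  set u := peirce c i j x with hu
  have hiu : c i * u = (1 / 2 : ℝ) • u := by rw [hu, hc.mul_peirce]; simp [hij]
  have hju : c j * u = (1 / 2 : ℝ) • u := by rw [hu, hc.mul_peirce]; simp [hij.symm]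
  have hpu : ∀ p, p ≠ i → p ≠ j → c p * (u * u) = 0 := by
    intro p hpi hpj
    rw [hu, hc.mul_peirce_mul hij hpi hpj, hc.mul_peirce]
    simp [hpi, hpj, mul_zero']
  have hsum : c i * (u * u) + c j * (u * u) = u * u := by
    have h1 : ∑ p, c p * (u * u) = u * u := by rw [← sum_mul', hc.complete, one_mul]
    rw [← Finset.add_sum_erase _ _ (Finset.mem_univ i), ← Finset.add_sum_erase _ _
      (Finset.mem_erase.mpr ⟨hij.symm, Finset.mem_univ j⟩), Finset.sum_eq_zero] at h1
    · rwa [add_zero] at h1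
    · intro p hp
      simp only [Finset.mem_erase] at hp
      exact hpu p hp.2.1 hp.1
  -- P(u)c_j = u² - c_j u² lies in V(c_i, 1) by the fundamental identity, which leaves no V_ij
  -- component in u².
  have hijsq : c i * (c j * (u * u)) = 0 := by
    have h1 := mul_Q_add_Q_mul (c i) u (c j)
    have h2 : Q u u (c j) = u * u - c j * (u * u) := by
      rw [Q_apply, mul_comm u (c j), hju, mul_smul', mul_comm (u * u)]; module
    rw [hiu, Q_smul_left, hc.orthogonal i j hij, map_zero, add_zero, _root_.smul_apply, h2,
      mul_sub'] at h1
    linear_combination (norm := module) hsum - h1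
  obtain ⟨β, hβ⟩ : ∃ β, u * u = diag c β := by
    apply hc.exists_diag
    intro p q hpq
    rw [hc.peirce_eq_two_smul hpq]
    by_cases hp : p ≠ i ∧ p ≠ j
    · rw [hc.mul_left_comm, hpu p hp.1 hp.2, mul_zero', smul_zero]
    by_cases hq : q ≠ i ∧ q ≠ j
    · rw [hpu q hq.1 hq.2, mul_zero', smul_zero]
    have : (p = i ∧ q = j) ∨ (p = j ∧ q = i) := by grind
    rcases this with ⟨rfl, rfl⟩ | ⟨rfl, rfl⟩
    · rw [hijsq, smul_zero]
    · rw [hc.mul_left_comm, hijsq, smul_zero]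
  refine ⟨β, hβ, ?_, ?_⟩
  · rw [← hc.inner_diag, ← hβ, inner_mul_left, mul_comm u (c j), hju, real_inner_smul_right,
      real_inner_self_eq_norm_sq]
    ring
  · intro k hki hkj
    have h1 := hc.diag_apply β k
    rw [← hβ, hpu k hki hkj] at h1
    exact (smul_eq_zero.mp h1.symm).resolve_right (hc.ne_zero k)

/-- Being joined by a nonzero Peirce space is a transitive relation. -/
theorem peirce_trans {i j k : Fin l} (hij : peirce c i j ≠ 0) (hjk : peirce c j k ≠ 0) :
    peirce c i k ≠ 0 := by
  rcases eq_or_ne i j with rfl | hij'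
  · exact hjk
  rcases eq_or_ne j k with rfl | hjk'
  · exact hij
  rcases eq_or_ne i k with rfl | hik'
  · intro h
    have := hc.peirce_apply_self i
    rw [h] at this
    exact hc.ne_zero i this.symm
  obtain ⟨x, hx⟩ : ∃ x, peirce c i j x ≠ 0 := by
    by_contra hcon; push Not at hcon; exact hij (ContinuousLinearMap.ext hcon)
  obtain ⟨y, hy⟩ : ∃ y, peirce c j k y ≠ 0 := by
    by_contra hcon; push Not at hcon; exact hjk (ContinuousLinearMap.ext hcon)
  intro hik
  set u := peirce c i j x with hu
  set v := peirce c j k y with hv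
  have hku : c k * u = 0 := by
    rw [hu, hc.mul_peirce]; simp [hik'.symm, hjk'.symm]
  have hju : c j * u = (1 / 2 : ℝ) • u := by
    rw [hu, hc.mul_peirce]; simp [hij'.symm]
  have hkv : c k * v = (1 / 2 : ℝ) • v := by
    rw [hv, hc.mul_peirce]; simp [hjk'.symm]
  have hjv : c j * v = (1 / 2 : ℝ) • v := by
    rw [hv, hc.mul_peirce]; simp [hjk']
  have hiu : c i * u = (1 / 2 : ℝ) • u := by
    rw [hu, hc.mul_peirce]; simp [hij']
  have hiv : c i * v = 0 := by
    rw [hv, hc.mul_peirce]; simp [hik', hij']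
  -- L(c_k) would act on P(u)v by -1/2, but L(c_k) is positive semidefinite.
  have hQ : Q u u v = 0 := by
    have h1 := mul_Q_add_Q_mul (c k) u v
    rw [hku, hkv, map_smul, show Q (0 : V) u = 0 by
      rw [← zero_smul ℝ (0 : V), Q_smul_left, zero_smul], zero_apply, smul_zero] at h1
    have h2 : c k * Q u u v = (-(1 / 2) : ℝ) • Q u u v := by
      linear_combination (norm := module) h1
    have h3 := hc.inner_mul_nonneg k (Q u u v)
    rw [h2, real_inner_smul_left, real_inner_self_eq_norm_sq] at h3
    have : ‖Q u u v‖ ^ 2 = 0 := le_antisymm (by linarith) (sq_nonneg _)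
    simpa using this
  obtain ⟨β, hβ, hβj, hβk⟩ := hc.peirce_sq hij' x
  rw [← hu] at hβ hβj
  have hdv : (u * u) * v = (β j / 2) • v := by
    rw [hβ, hv, hc.diag_mul_peirce, hβk k hik'.symm hjk'.symm, add_zero]
  -- If uv = 0, then P(u)v = -u²v = -(β_j/2)v, and its vanishing contradicts β_j‖c_j‖² = ‖u‖²/2 > 0.
  -- So uv is a nonzero element of V_ik.
  have huv : u * v ≠ 0 := by
    intro h0
    rw [Q_apply, h0, mul_zero', add_zero, zero_sub, neg_eq_zero, hdv] at hQ
    have h1 : β j = 0 := by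
      have := (smul_eq_zero.mp hQ).resolve_right hy
      linarith
    rw [h1, zero_mul] at hβj
    have : ‖u‖ ^ 2 = 0 := by linarith
    exact hx (by simpa using this)
  have h1 : c k * (u * v) = (1 / 2 : ℝ) • (u * v) := by
    rw [hu, hc.mul_peirce_mul hij' hik'.symm hjk'.symm, hkv, mul_smul']
  have h2 : c i * (u * v) = (1 / 2 : ℝ) • (u * v) := by
    rw [mul_comm u v, hv, hc.mul_peirce_mul hjk' hij' hik', hiu, mul_smul']
  have h3 : peirce c i k (u * v) = (1 / 2 : ℝ) • (u * v) := by
    rw [hc.peirce_eq_two_smul hik', h1, mul_smul', h2]; module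
  rw [hik, zero_apply] at h3
  exact huv ((smul_eq_zero.mp h3.symm).resolve_left (by norm_num))

end IsJordanFrame

end FramePeirce

end EuclideanJordanAlgebra

namespace EuclideanJordanAlgebra

open NormedSpace (exp)

/-! ### One-parameter groups and the quadratic representation -/

section Exp

variable {V : Type*} [NormedAddCommGroup V] [InnerProductSpace ℝ V]
  [FiniteDimensional ℝ V]

theorem exp_mul_exp_neg (X : V →L[ℝ] V) : exp X * exp (-X) = 1 := by
  let : NormedAlgebra ℚ (V →L[ℝ] V) := NormedAlgebra.restrictScalars ℚ ℝ _
  rw [← NormedSpace.exp_add_of_commute (Commute.neg_right (Commute.refl X)), add_neg_cancel,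
    NormedSpace.exp_zero]

theorem exp_neg_mul_exp (X : V →L[ℝ] V) : exp (-X) * exp X = 1 := by
  simpa using exp_mul_exp_neg (-X)

theorem exp_exp_neg_apply (X : V →L[ℝ] V) (x : V) : exp X (exp (-X) x) = x :=
  DFunLike.congr_fun (exp_mul_exp_neg X) x

theorem exp_neg_exp_apply (X : V →L[ℝ] V) (x : V) : exp (-X) (exp X x) = x :=
  DFunLike.congr_fun (exp_neg_mul_exp X) x

/-- The exponential as an invertible operator. -/
def expUnit (X : V →L[ℝ] V) : (V →L[ℝ] V)ˣ :=
  ⟨exp X, exp (-X), exp_mul_exp_neg X, exp_neg_mul_exp X⟩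

@[simp] theorem coe_expUnit (X : V →L[ℝ] V) : (expUnit X : V →L[ℝ] V) = exp X := rfl

theorem continuous_exp_smul (X : V →L[ℝ] V) : Continuous fun t : ℝ => exp (t • X) :=
  continuous_iff_continuousAt.mpr fun t => (hasDerivAt_exp_smul_const X t).continuousAt

theorem hasDerivAt_exp_smul_apply (X : V →L[ℝ] V) (x : V) (t : ℝ) :
    HasDerivAt (fun s : ℝ => exp (s • X) x) (X (exp (t • X) x)) t :=
  (hasDerivAt_exp_smul_const' X t).clm_apply (hasDerivAt_const t x) |>.congr_deriv (by simp)

/-- Eigenvectors of `X` are eigenvectors of `exp X`. -/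
theorem exp_apply_of_eigenvector' {𝕜 E : Type*} [RCLike 𝕜] [NormedAddCommGroup E] [NormedSpace 𝕜 E]
    [CompleteSpace E] {X : E →L[𝕜] E} {x : E} {r : 𝕜} (h : X x = r • x) :
    exp X x = exp r • x := by
  have hf : ∀ t : 𝕜, HasDerivAt (fun t : 𝕜 => exp (t • (-r)) • exp (t • X) x) 0 t := by
    intro t
    have h1 := hasDerivAt_exp_smul_const (-r) t
    have h2 := h1.smul ((hasDerivAt_exp_smul_const X t).clm_apply (hasDerivAt_const t x))
    refine h2.congr_deriv ?_
    simp only [ContinuousLinearMap.mul_apply', ContinuousLinearMap.coe_comp, Function.comp_apply,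
      map_zero, add_zero, _root_.mul_apply_eq_comp, h, map_smul]
    module
  have h0 := is_const_of_deriv_eq_zero (fun t => (hf t).differentiableAt)
    (fun t => (hf t).deriv) 1 0
  simp only [one_smul, zero_smul, NormedSpace.exp_zero, _root_.one_apply_eq_self] at h0
  have h1 : exp r * exp (-r) = 1 := by
    let : NormedAlgebra ℚ 𝕜 := NormedAlgebra.restrictScalars ℚ 𝕜 _
    rw [← NormedSpace.exp_add, add_neg_cancel, NormedSpace.exp_zero]
  conv_rhs => rw [← h0]
  rw [smul_smul, h1, one_smul]

theorem exp_apply_of_eigenvector {X : V →L[ℝ] V} {x : V} {r : ℝ} (h : X x = r • x) :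
    exp X x = Real.exp r • x := by
  have : CompleteSpace V := FiniteDimensional.complete ℝ V
  rw [exp_apply_of_eigenvector' h, Real.exp_eq_exp_ℝ]

theorem inner_exp_of_symm {X : V →L[ℝ] V} (h : ∀ u v, inner ℝ (X u) v = inner ℝ u (X v)) (u v : V) :
    inner ℝ (exp X u) v = inner ℝ u (exp X v) := by
  have hadj : ContinuousLinearMap.adjoint X = X := by
    ext v
    exact ext_inner_left ℝ fun w => by rw [ContinuousLinearMap.adjoint_inner_right, h]
  have h1 : ContinuousLinearMap.adjoint (exp X) = exp X := by
    have := NormedSpace.star_exp X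
    rwa [ContinuousLinearMap.star_eq_adjoint, ContinuousLinearMap.star_eq_adjoint, hadj] at this
  conv_rhs => rw [← h1]
  rw [ContinuousLinearMap.adjoint_inner_right]

end Exp

/-! ### The structure Lie algebra and its one-parameter groups -/

section Str

variable {V : Type*} [NormedAddCommGroup V] [InnerProductSpace ℝ V] [EuclideanJordanAlgebra V]
  [FiniteDimensional ℝ V]

theorem hasDerivAt_L {x : ℝ → V} {x' : V} {t : ℝ} (hx : HasDerivAt x x' t) :
    HasDerivAt (fun s => L (x s)) (L x') t := by
  let LC : V →L[ℝ] V →L[ℝ] V := LinearMap.toContinuousLinearMap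
    { toFun := L, map_add' := L_add, map_smul' := L_smul }
  exact LC.hasFDerivAt.comp_hasDerivAt t hx

theorem hasDerivAt_mul {x y : ℝ → V} {x' y' : V} {t : ℝ} (hx : HasDerivAt x x' t)
    (hy : HasDerivAt y y' t) : HasDerivAt (fun s => x s * y s) (x' * y t + x t * y') t :=
  (hasDerivAt_L hx).clm_apply hy

theorem hasDerivAt_Q {x y : ℝ → V} {x' y' : V} {t : ℝ} (hx : HasDerivAt x x' t)
    (hy : HasDerivAt y y' t) :
    HasDerivAt (fun s => Q (x s) (y s)) (Q x' (y t) + Q (x t) y') t := by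
  have h1 := (hasDerivAt_L hx).mul (hasDerivAt_L hy)
  have h2 := (hasDerivAt_L hy).mul (hasDerivAt_L hx)
  refine ((h1.add h2).sub (hasDerivAt_L (hasDerivAt_mul hx hy))).congr_deriv ?_
  simp only [Q, L_add]; abel

/-- `X` belongs to the Lie algebra of the structure group, with partner `X'`. -/
def IsStr (X X' : V →L[ℝ] V) : Prop :=
  ∀ x u, X (Q x x u) + Q x x (X' u) = (2 : ℝ) • Q (X x) x u

/-- The derivation `[L(x), L(y)]`. -/
def lieL (x y : V) : V →L[ℝ] V := L x * L y - L y * L x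

theorem lieL_apply (x y u : V) : lieL x y u = x * (y * u) - y * (x * u) := rfl

theorem lieL_mul (x y a b : V) : lieL x y (a * b) = lieL x y a * b + a * lieL x y b :=
  lie_mul x y a b

theorem lieL_one (x y : V) : lieL x y 1 = 0 := by
  simp only [lieL_apply, mul_one, mul_comm x y, sub_self]

theorem inner_lieL (x y u v : V) : inner ℝ (lieL x y u) v = -inner ℝ u (lieL x y v) := by
  simp only [lieL_apply, inner_sub_left, inner_sub_right, inner_mul_left]; ring

/-- The partner is the adjoint: multiplications are self-adjoint and the inner derivations are skew.
-/
theorem isStr (v x y : V) : IsStr (L v + lieL x y) (L v - lieL x y) := by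
  intro z u
  have h1 := mul_Q_add_Q_mul v z u
  have h2 := lie_Q x y z u
  simp only [_root_.add_apply, _root_.sub_apply, L_apply, lieL_apply, map_sub, map_add] at h1 h2 ⊢
  have h3 : Q (v * z + (x * (y * z) - y * (x * z))) z u =
    Q (v * z) z u + Q (x * (y * z) - y * (x * z)) z u := by
    rw [Q_add_left]; rfl
  rw [h3]
  linear_combination (norm := module) h1 + h2

theorem isStr_L (v : V) : IsStr (L v) (L v) := by
  have := isStr v 0 (0 : V)
  simpa [lieL, L_zero] using this

theorem isStr_lieL (x y : V) : IsStr (lieL x y) (-lieL x y) := by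
  have := isStr 0 x y
  simpa [L_zero] using this

/-- By the infinitesimal relation, exp(-sX) P(exp(sX)x) exp(-sX') has zero derivative in s. -/
theorem IsStr.Q_exp {X X' : V →L[ℝ] V} (h : IsStr X X') (t : ℝ) (x : V) :
    Q (exp (t • X) x) (exp (t • X) x) = exp (t • X) * Q x x * exp (t • X') := by
  set y : ℝ → V := fun s => exp (s • X) x with hy
  have hf : ∀ s : ℝ, HasDerivAt
      (fun s : ℝ => exp (s • (-X)) * Q (y s) (y s) * exp (s • (-X'))) 0 s := by
    intro s
    have h1 := hasDerivAt_Q (hasDerivAt_exp_smul_apply X x s) (hasDerivAt_exp_smul_apply X x s)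
    have h2 := ((hasDerivAt_exp_smul_const (-X) s).mul h1).mul
      (hasDerivAt_exp_smul_const' (-X') s)
    refine h2.congr_deriv ?_
    have h3 : X * Q (y s) (y s) + Q (y s) (y s) * X' = Q (X (y s)) (y s) + Q (y s) (X (y s)) := by
      ext u
      have := h (y s) u
      rw [Q_comm (y s) (X (y s)), ← two_smul ℝ]
      exact this
    change (exp (s • -X) * -X * Q (y s) (y s) + exp (s • -X) * (Q (X (y s)) (y s) +
      Q (y s) (X (y s)))) * exp (s • -X') + exp (s • -X) * Q (y s) (y s) * (-X' * exp (s • -X')) = 0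
    rw [← h3]
    generalize exp (s • -X) = A, exp (s • -X') = B, Q (y s) (y s) = C
    noncomm_ring
  have h0 := is_const_of_deriv_eq_zero (fun s => (hf s).differentiableAt)
    (fun s => (hf s).deriv) t 0
  simp only [hy, zero_smul, NormedSpace.exp_zero, _root_.one_apply_eq_self, one_mul, mul_one] at h0
  rw [← h0, smul_neg, smul_neg]
  calc _ = (exp (t • X) * exp (-(t • X))) * Q (exp (t • X) x) (exp (t • X) x) *
      (exp (-(t • X')) * exp (t • X')) := by
        rw [exp_mul_exp_neg, exp_neg_mul_exp, one_mul, mul_one]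
    _ = _ := by simp only [mul_assoc]

theorem exp_apply_of_eq_zero {X : V →L[ℝ] V} {x : V} (h : X x = 0) : exp X x = x := by
  have := exp_apply_of_eigenvector (X := X) (x := x) (r := 0) (by rw [h, zero_smul])
  simpa using this

/-- Operators satisfying `P(gx) = g P(x) g⁻¹` and fixing the unit are automorphisms. -/
theorem map_mul_of_Q {k k' : V →L[ℝ] V} (h1' : k' 1 = 1)
    (h : ∀ x, Q (k x) (k x) = k * Q x x * k') (x y : V) : k (x * y) = k x * k y := by
  have sq : ∀ x, k (x * x) = k x * k x := by
    intro x
    have := DFunLike.congr_fun (h x) 1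
    rw [Q_self_one] at this
    rw [this, _root_.mul_apply_eq_comp, _root_.mul_apply_eq_comp, h1', Q_self_one]
  have e := sq (x + y)
  simp only [add_mul', mul_add', map_add, sq, mul_comm y x, mul_comm (k y) (k x)] at e
  linear_combination (norm := module) (1 / 2 : ℝ) • e

theorem exp_lieL_mul (x y : V) (t : ℝ) (a b : V) :
    exp (t • lieL x y) (a * b) = exp (t • lieL x y) a * exp (t • lieL x y) b := by
  apply map_mul_of_Q (k' := exp (t • (-lieL x y)))
  · exact exp_apply_of_eq_zero (by simp [lieL_one])
  · exact fun z => (isStr_lieL x y).Q_exp t z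

theorem norm_exp_lieL (x y : V) (t : ℝ) (a : V) : ‖exp (t • lieL x y) a‖ = ‖a‖ := by
  have hf : ∀ s : ℝ, HasDerivAt
      (fun s : ℝ => inner ℝ (exp (s • lieL x y) a) (exp (s • lieL x y) a)) 0 s := by
    intro s
    have h1 := hasDerivAt_exp_smul_apply (lieL x y) a s
    refine (h1.inner ℝ h1).congr_deriv ?_
    rw [inner_lieL]; ring
  have h0 := is_const_of_deriv_eq_zero (fun s => (hf s).differentiableAt)
    (fun s => (hf s).deriv) t 0
  simp only [zero_smul, NormedSpace.exp_zero, _root_.one_apply_eq_self, real_inner_self_eq_norm_sq] at h0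
  exact (sq_eq_sq₀ (norm_nonneg _) (norm_nonneg _)).mp h0

end Str

/-! ### Compact groups of automorphisms and the spectral theorem -/

section Aut

variable (V : Type*) [NormedAddCommGroup V] [InnerProductSpace ℝ V] [EuclideanJordanAlgebra V]
  [FiniteDimensional ℝ V]

/-- The isometric automorphisms commuting with all operators that commute with every `L(x)`. -/
def isoAut : Set (V →L[ℝ] V) :=
  {k | (∀ x y, k (x * y) = k x * k y) ∧ k 1 = 1 ∧ (∀ x, ‖k x‖ = ‖x‖) ∧
    ∀ T : V →L[ℝ] V, (∀ x, T * L x = L x * T) → T * k = k * T}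

variable {V}

theorem one_mem_isoAut : (1 : V →L[ℝ] V) ∈ isoAut V :=
  ⟨fun _ _ => rfl, rfl, fun _ => rfl, fun T _ => by rw [mul_one, one_mul]⟩

theorem exp_lieL_mul_mem_isoAut (x y : V) (t : ℝ) {k : V →L[ℝ] V} (hk : k ∈ isoAut V) :
    exp (t • lieL x y) * k ∈ isoAut V := by
  obtain ⟨h1, h2, h3, h4⟩ := hk
  refine ⟨fun a b => ?_, ?_, fun a => ?_, fun T hT => ?_⟩
  · simp only [_root_.mul_apply_eq_comp, h1, exp_lieL_mul]
  · rw [_root_.mul_apply_eq_comp, h2]; exact exp_apply_of_eq_zero (by simp [lieL_one])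
  · rw [_root_.mul_apply_eq_comp, norm_exp_lieL, h3]
  · have hc : Commute T (lieL x y) := by
      have hx : Commute T (L x) := hT x
      have hy : Commute T (L y) := hT y
      exact (hx.mul_right hy).sub_right (hy.mul_right hx)
    have he : Commute T (exp (t • lieL x y)) := (hc.smul_right t).exp_right
    rw [← mul_assoc, he.eq, mul_assoc, h4 T hT, mul_assoc]

theorem isClosed_isoAut : IsClosed (isoAut V) := by
  have hev : ∀ x : V, Continuous fun k : V →L[ℝ] V => k x := fun x =>
    continuous_id.clm_apply continuous_const
  have e : isoAut V = (⋂ (x : V) (y : V), {k | k (x * y) = k x * k y}) ∩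
      ({k | k 1 = 1} ∩ ((⋂ x : V, {k | ‖k x‖ = ‖x‖}) ∩
        ⋂ (T : V →L[ℝ] V) (_ : ∀ x, T * L x = L x * T), {k | T * k = k * T})) := by
    ext k; simp [isoAut]
  rw [e]
  refine IsClosed.inter ?_ (IsClosed.inter ?_ (IsClosed.inter ?_ ?_))
  · exact isClosed_iInter fun x => isClosed_iInter fun y =>
      isClosed_eq (hev _) (continuous_mul' (hev x) (hev y))
  · exact isClosed_eq (hev 1) continuous_const
  · exact isClosed_iInter fun x => isClosed_eq (hev x).norm continuous_const
  · exact isClosed_iInter fun T => isClosed_iInter fun _ =>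
      isClosed_eq (continuous_const.mul continuous_id) (continuous_id.mul continuous_const)

theorem isCompact_isoAut : IsCompact (isoAut V) := by
  have : ProperSpace (V →L[ℝ] V) := FiniteDimensional.proper ℝ _
  refine Metric.isCompact_of_isClosed_isBounded isClosed_isoAut ?_
  refine (Metric.isBounded_closedBall (x := (0 : V →L[ℝ] V)) (r := 1)).subset fun k hk => ?_
  rw [mem_closedBall_zero_iff]
  exact ContinuousLinearMap.opNorm_le_bound _ zero_le_one fun x => by rw [hk.2.2.1 x, one_mul]

theorem inner_of_mem_isoAut {k : V →L[ℝ] V} (hk : k ∈ isoAut V) (x y : V) :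
    inner ℝ (k x) (k y) = inner ℝ x y := by
  let e : V →ₗᵢ[ℝ] V := ⟨k.toLinearMap, hk.2.2.1⟩
  exact e.inner_map_map x y

theorem exists_inverse_of_mem_isoAut {k : V →L[ℝ] V} (hk : k ∈ isoAut V) :
    ∃ k' : V →L[ℝ] V, k * k' = 1 ∧ k' * k = 1 := by
  have hinj : Function.Injective k.toLinearMap := by
    rw [← LinearMap.ker_eq_bot, LinearMap.ker_eq_bot']
    intro x hx
    have := hk.2.2.1 x
    rw [show k x = 0 from hx, norm_zero] at this
    exact norm_eq_zero.mp this.symm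
  let e := (LinearEquiv.ofInjectiveEndo k.toLinearMap hinj).toContinuousLinearEquiv
  exact ⟨e.symm, ContinuousLinearMap.ext fun x => e.apply_symm_apply x,
    ContinuousLinearMap.ext fun x => e.symm_apply_apply x⟩

theorem surjective_of_mem_isoAut {k : V →L[ℝ] V} (hk : k ∈ isoAut V) : Function.Surjective k := by
  obtain ⟨k', h, _⟩ := exists_inverse_of_mem_isoAut hk
  exact fun x => ⟨k' x, DFunLike.congr_fun h x⟩

variable {l : ℕ} {c : Fin l → V}

/-- Every element is conjugate to a diagonal one, under any compact set of operators that is stable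
under the one-parameter groups of inner derivations. -/
theorem IsJordanFrame.exists_conj_diag (hc : IsJordanFrame c) {K : Set (V →L[ℝ] V)}
    (hK : IsCompact K) (h1 : (1 : V →L[ℝ] V) ∈ K)
    (hexp : ∀ k ∈ K, ∀ (x y : V) (t : ℝ), exp (t • lieL x y) * k ∈ K) (b : V) :
    ∃ k ∈ K, ∃ β, k b = diag c β := by
  -- Any element with pairwise distinct coefficients would do: an element commuting with it, as a
  -- multiplication operator, is diagonal.
  set a := diag c (fun j => (j : ℝ)) with ha
  have hcont : Continuous fun k : V →L[ℝ] V => (inner ℝ (k b) a : ℝ) :=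
    (continuous_id.clm_apply continuous_const).inner continuous_const
  obtain ⟨k, hk, hmax⟩ := hK.exists_isMaxOn ⟨1, h1⟩ hcont.continuousOn
  refine ⟨k, hk, ?_⟩
  set b' := k b with hb'
  -- Criticality of k ↦ (kb | a) along all inner derivations; by associativity of the inner product
  -- this says [L(b'), L(a)] = 0.
  have hcrit : ∀ x y : V, (inner ℝ (lieL x y b') a : ℝ) = 0 := by
    intro x y
    have hd : HasDerivAt (fun t : ℝ => (inner ℝ (exp (t • lieL x y) b') a : ℝ))
        (inner ℝ (lieL x y b') a) 0 := by
      have := (hasDerivAt_exp_smul_apply (lieL x y) b' 0).inner ℝ (hasDerivAt_const (0 : ℝ) a)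
      simpa using this
    refine IsLocalMax.hasDerivAt_eq_zero (Filter.Eventually.of_forall fun t => ?_) hd
    have := hmax (hexp k hk x y t)
    simpa using this
  have hcomm : ∀ x, b' * (a * x) = a * (b' * x) := by
    intro x
    refine ext_inner_left ℝ fun y => ?_
    have := hcrit x y
    rw [lieL_apply, inner_sub_left, inner_mul_left, inner_mul_left, inner_mul_left, inner_mul_left]
      at this
    have e1 : (inner ℝ b' (y * (x * a)) : ℝ) = inner ℝ (b' * y) (a * x) := by
      rw [mul_comm b' y, inner_mul_left, mul_comm x a]
    have e2 : (inner ℝ b' (x * (y * a)) : ℝ) = inner ℝ (a * y) (b' * x) := by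
      rw [inner_mul_right, real_inner_comm, mul_comm y a, mul_comm x b']
    rw [e1, e2] at this
    have e3 : (inner ℝ (b' * y) (a * x) : ℝ) = inner ℝ y (b' * (a * x)) := inner_mul_left _ _ _
    have e4 : (inner ℝ (a * y) (b' * x) : ℝ) = inner ℝ y (a * (b' * x)) := inner_mul_left _ _ _
    linarith
  apply hc.exists_diag
  intro i j hij
  -- In the V_ij component the two sides carry the factors i/2 and (i + j)/4, so that component of
  -- b' vanishes.
  have h2 := hcomm (c i)
  rw [mul_comm a (c i), ha, hc.diag_apply, mul_smul', mul_comm b' (c i)] at h2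
  have h3 := congrArg (peirce c i j) h2
  rw [hc.peirce_diag_mul, map_smul, hc.peirce_mul, hc.mul_peirce] at h3
  simp only [if_true, hij, if_false, add_zero, smul_smul] at h3
  rw [← sub_eq_zero, ← sub_smul] at h3
  refine (smul_eq_zero.mp h3).resolve_left ?_
  have : ((i : ℕ) : ℝ) ≠ ((j : ℕ) : ℝ) := by
    intro h; exact hij (Fin.ext (by exact_mod_cast h))
  intro h; apply this; linarith

theorem IsJordanFrame.exists_isoAut_diag (hc : IsJordanFrame c) (b : V) :
    ∃ k ∈ isoAut V, ∃ β, k b = diag c β :=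
  hc.exists_conj_diag isCompact_isoAut one_mem_isoAut
    (fun _ hk x y t => exp_lieL_mul_mem_isoAut x y t hk) b

end Aut

/-! ### The symmetric cone -/

section Cone

variable {V : Type*} [NormedAddCommGroup V] [InnerProductSpace ℝ V] [EuclideanJordanAlgebra V]
  [FiniteDimensional ℝ V] {l : ℕ} {c : Fin l → V}

/-- After diagonalization both conditions say that the coefficients are nonnegative. -/
theorem IsJordanFrame.mem_squares_iff (hc : IsJordanFrame c) (x : V) :
    x ∈ Set.range (fun y : V => y * y) ↔ ∀ u, 0 ≤ (inner ℝ (x * u) u : ℝ) := by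
  constructor
  · rintro ⟨y, rfl⟩ u
    obtain ⟨k, hk, β, hβ⟩ := hc.exists_isoAut_diag y
    have h := (hc.inner_diag_mul_nonneg_iff (fun j => β j * β j)).mpr
      (fun j => mul_self_nonneg _) (k u)
    rwa [← hc.diag_mul_diag, ← hβ, ← hk.1, ← hk.1, inner_of_mem_isoAut hk] at h
  · intro h
    obtain ⟨k, hk, β, hβ⟩ := hc.exists_isoAut_diag x
    have hβ0 := (hc.inner_diag_mul_nonneg_iff β).mp (fun u => by
      obtain ⟨v, rfl⟩ := surjective_of_mem_isoAut hk u
      rw [← hβ, ← hk.1, inner_of_mem_isoAut hk]; exact h v)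
    obtain ⟨y, hy⟩ := surjective_of_mem_isoAut hk (diag c fun j => Real.sqrt (β j))
    refine ⟨y, ?_⟩
    obtain ⟨k', hk', hk''⟩ := exists_inverse_of_mem_isoAut hk
    have : k (y * y) = k x := by
      rw [hk.1, hy, hc.diag_mul_diag, hβ]
      congr 1; funext j; exact Real.mul_self_sqrt (hβ0 j)
    have e := congrArg k' this
    have e2 : ∀ z, k' (k z) = z := DFunLike.congr_fun hk''
    rwa [e2, e2] at e

theorem isOpen_posDef : IsOpen {x : V | ∀ u, u ≠ 0 → 0 < (inner ℝ (x * u) u : ℝ)} := by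
  have hS : IsCompact (Metric.sphere (0 : V) 1) := isCompact_sphere 0 1
  have e : {x : V | ∀ u, u ≠ 0 → 0 < (inner ℝ (x * u) u : ℝ)} =
      {x : V | ∀ u ∈ Metric.sphere (0 : V) 1, (x, u) ∈ {p : V × V | 0 < (inner ℝ (p.1 * p.2) p.2 : ℝ)}} := by
    ext x
    simp only [Set.mem_ofPred_eq, mem_sphere_iff_norm, sub_zero]
    constructor
    · intro h u hu
      exact h u (by rintro rfl; simp at hu)
    · intro h u hu
      have hn : 0 < ‖u‖ := norm_pos_iff.mpr hu
      have := h (‖u‖⁻¹ • u) (by simp [norm_smul, hn.ne'])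
      rw [mul_smul', real_inner_smul_left, real_inner_smul_right] at this
      exact pos_of_mul_pos_right (pos_of_mul_pos_right this (by positivity)) (by positivity)
  rw [e]
  have hopen : IsOpen {p : V × V | 0 < (inner ℝ (p.1 * p.2) p.2 : ℝ)} :=
    isOpen_lt continuous_const ((continuous_mul' continuous_fst continuous_snd).inner continuous_snd)
  rw [isOpen_iff_mem_nhds]
  intro x hx
  exact hS.eventually_forall_of_forall_eventually fun u hu => hopen.mem_nhds (hx u hu)

/-- At an interior point x the element x - te is still a square for small t > 0, which upgrades
semidefinite to definite; conversely, definiteness is an open condition. -/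
theorem IsJordanFrame.mem_cone_iff (hc : IsJordanFrame c) (x : V) :
    x ∈ cone V ↔ ∀ u, u ≠ 0 → 0 < (inner ℝ (x * u) u : ℝ) := by
  constructor
  · intro hx u hu
    have h1 : Filter.Tendsto (fun t : ℝ => x - t • (1 : V)) (nhds 0) (nhds x) := by
      have : Continuous fun t : ℝ => x - t • (1 : V) := by fun_prop
      simpa using this.tendsto 0
    have h2 := h1.eventually (mem_interior_iff_mem_nhds.mp hx)
    obtain ⟨ε, hε, h3⟩ := Metric.eventually_nhds_iff.mp h2
    have h4 := h3 (y := ε / 2) (by simp [abs_of_pos hε]; linarith)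
    have h5 := (hc.mem_squares_iff _).mp h4 u
    rw [sub_mul', smul_mul', one_mul, inner_sub_left, real_inner_smul_left,
      real_inner_self_eq_norm_sq] at h5
    have : 0 < ε / 2 * ‖u‖ ^ 2 := by have := norm_pos_iff.mpr hu; positivity
    linarith
  · intro h
    refine interior_maximal (s := Set.range fun y : V => y * y) ?_ isOpen_posDef h
    intro y hy
    rw [hc.mem_squares_iff]
    intro u
    rcases eq_or_ne u 0 with rfl | hu
    · simp
    · exact (hy u hu).le

theorem IsJordanFrame.diag_mem_cone_iff (hc : IsJordanFrame c) (β : Fin l → ℝ) :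
    diag c β ∈ cone V ↔ ∀ j, 0 < β j := by
  rw [hc.mem_cone_iff]
  constructor
  · intro h j
    have h1 := h (c j) (hc.ne_zero j)
    rw [mul_comm, hc.diag_apply, real_inner_smul_left, real_inner_self_eq_norm_sq] at h1
    exact pos_of_mul_pos_left h1 (sq_nonneg _)
  · intro h u hu
    rcases isEmpty_or_nonempty (Fin l) with hl | hl
    · exact absurd (by rw [← hc.sum_peirce u]; simp) hu
    obtain ⟨j0, hj0⟩ := Finite.exists_min β
    have h1 := (hc.inner_diag_mul_nonneg_iff (fun j => β j - β j0)).mpr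
      (fun j => sub_nonneg.mpr (hj0 j)) u
    have e : diag c (fun j => β j - β j0) = diag c β - β j0 • (1 : V) := by
      rw [← hc.complete]; simp only [diag, sub_smul, Finset.sum_sub_distrib, Finset.smul_sum]
    rw [e, sub_mul', smul_mul', one_mul, inner_sub_left, real_inner_smul_left,
      real_inner_self_eq_norm_sq] at h1
    have : 0 < β j0 * ‖u‖ ^ 2 := by have := norm_pos_iff.mpr hu; have := h j0; positivity
    linarith

theorem IsJordanFrame.isoAut_mem_cone_iff (hc : IsJordanFrame c) {k : V →L[ℝ] V}
    (hk : k ∈ isoAut V) (x : V) : k x ∈ cone V ↔ x ∈ cone V := by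
  rw [hc.mem_cone_iff, hc.mem_cone_iff]
  constructor
  · intro h u hu
    have := h (k u) (by rw [← norm_pos_iff, hk.2.2.1]; exact norm_pos_iff.mpr hu)
    rwa [← hk.1, inner_of_mem_isoAut hk] at this
  · intro h u hu
    obtain ⟨v, rfl⟩ := surjective_of_mem_isoAut hk u
    rw [← hk.1, inner_of_mem_isoAut hk]
    exact h v (by rintro rfl; simp at hu)

end Cone

end EuclideanJordanAlgebra

namespace EuclideanJordanAlgebra

open NormedSpace (exp)

/-! ### Elements of the group of the cone -/

section ConeGroup

variable {V : Type*} [NormedAddCommGroup V] [InnerProductSpace ℝ V] [EuclideanJordanAlgebra V]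
  [FiniteDimensional ℝ V] {l : ℕ} {c : Fin l → V}

theorem map_Q_of_map_mul {k : V →L[ℝ] V} (hk : ∀ x y, k (x * y) = k x * k y) (x y u : V) :
    k (Q x y u) = Q (k x) (k y) (k u) := by
  simp only [Q_apply, map_add, map_sub, hk]

/-- P(∑ β_j c_j) has eigenvalues β_i β_j, so its injectivity excludes zero coefficients. In this
form membership can be followed along one-parameter groups. -/
theorem IsJordanFrame.mem_cone_iff_Q (hc : IsJordanFrame c) (x : V) :
    x ∈ cone V ↔ x ∈ Set.range (fun y : V => y * y) ∧ ∀ u, Q x x u = 0 → u = 0 := by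
  obtain ⟨k, hk, β, hβ⟩ := hc.exists_isoAut_diag x
  rw [← hc.isoAut_mem_cone_iff hk, hβ, hc.diag_mem_cone_iff]
  constructor
  · intro h
    have hx : x ∈ cone V := by rwa [← hc.isoAut_mem_cone_iff hk, hβ, hc.diag_mem_cone_iff]
    refine ⟨interior_subset hx, fun u hu => ?_⟩
    have h1 := map_Q_of_map_mul hk.1 x x u
    rw [hu, map_zero, hβ] at h1
    have h2 : ∀ i j, peirce c i j (k u) = 0 := by
      intro i j
      have h3 : peirce c i j (Q (diag c β) (diag c β) (k u)) =
          (β i * β j) • peirce c i j (k u) := by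
        simp only [Q_apply, map_add, map_sub, hc.peirce_diag_mul, hc.diag_mul_diag, smul_smul]
        module
      rw [← h1, map_zero] at h3
      exact (smul_eq_zero.mp h3.symm).resolve_left (mul_pos (h i) (h j)).ne'
    have h4 : k u = 0 := by rw [← hc.sum_peirce (k u)]; simp [h2]
    have := hk.2.2.1 u
    rw [h4, norm_zero] at this
    exact norm_eq_zero.mp this.symm
  · rintro ⟨h1, h2⟩ j
    rw [hc.mem_squares_iff] at h1
    have hβ0 := (hc.inner_diag_mul_nonneg_iff β).mp (fun u => by
      obtain ⟨v, rfl⟩ := surjective_of_mem_isoAut hk u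
      rw [← hβ, ← hk.1, inner_of_mem_isoAut hk]; exact h1 v)
    refine lt_of_le_of_ne (hβ0 j) fun h0 => ?_
    obtain ⟨v, hv⟩ := surjective_of_mem_isoAut hk (c j)
    have h3 : k (Q x x v) = 0 := by
      rw [map_Q_of_map_mul hk.1, hβ, hv, Q_apply, mul_comm _ (c j), hc.diag_apply, ← h0, zero_smul,
        mul_zero', hc.diag_mul_diag, mul_comm, hc.diag_apply, ← h0]
      simp
    have h4 : Q x x v = 0 := by
      have := hk.2.2.1 (Q x x v)
      rw [h3, norm_zero] at this
      exact norm_eq_zero.mp this.symm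
    have h5 := h2 v h4
    rw [h5, map_zero] at hv
    exact hc.ne_zero j hv.symm

theorem IsJordanFrame.isClosed_squares (hc : IsJordanFrame c) :
    IsClosed (Set.range fun y : V => y * y) := by
  have e : (Set.range fun y : V => y * y) = ⋂ u : V, {x | 0 ≤ (inner ℝ (x * u) u : ℝ)} := by
    ext x; rw [hc.mem_squares_iff]; simp
  rw [e]
  exact isClosed_iInter fun u => isClosed_le continuous_const
    ((continuous_mul' continuous_id continuous_const).inner continuous_const)

/-- Connectedness of ℝ: the good times form an open set, and also a closed one, since `IsStr.Q_exp`
keeps P injective along the curve and being a square is a closed condition. -/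
theorem IsStr.exp_mem_cone {X X' : V →L[ℝ] V} (h : IsStr X X') (hc : IsJordanFrame c) (t : ℝ)
    {x : V} (hx : x ∈ cone V) : exp (t • X) x ∈ cone V := by
  set S : Set ℝ := {t | exp (t • X) x ∈ cone V} with hS
  have hcont : Continuous fun t : ℝ => exp (t • X) x :=
    (continuous_exp_smul X).clm_apply continuous_const
  have hopen : IsOpen S := isOpen_interior.preimage hcont
  have hinj := ((hc.mem_cone_iff_Q x).mp hx).2
  have e : S = {t | exp (t • X) x ∈ Set.range (fun y : V => y * y)} := by
    ext s
    change exp (s • X) x ∈ cone V ↔ _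
    rw [hc.mem_cone_iff_Q]
    refine ⟨fun h => h.1, fun h1 => ⟨h1, fun u hu => ?_⟩⟩
    rw [h.Q_exp] at hu
    have h2 : Q x x (exp (s • X') u) = 0 := by
      rw [← exp_neg_exp_apply (s • X) (Q x x (exp (s • X') u))]
      exact (congrArg (exp (-(s • X)) : V →L[ℝ] V) hu).trans (map_zero _)
    rw [← exp_neg_exp_apply (s • X') u, hinj _ h2, map_zero]
  have hclosed : IsClosed S := by
    rw [e]; exact hc.isClosed_squares.preimage hcont
  have huniv : S = Set.univ := IsClopen.eq_univ ⟨hclosed, hopen⟩ ⟨0, by simpa [hS] using hx⟩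
  have : t ∈ S := huniv ▸ Set.mem_univ t
  exact this

theorem mem_autCone_of_mapsTo {g : (V →L[ℝ] V)ˣ} (h1 : ∀ x ∈ cone V, (g : V →L[ℝ] V) x ∈ cone V)
    (h2 : ∀ x ∈ cone V, ((g⁻¹ : (V →L[ℝ] V)ˣ) : V →L[ℝ] V) x ∈ cone V) : g ∈ autCone V := by
  change (g : V →L[ℝ] V) '' cone V = cone V
  refine Set.Subset.antisymm (Set.image_subset_iff.mpr h1) fun x hx => ?_
  exact ⟨_, h2 x hx, DFunLike.congr_fun (Units.mul_inv g) x⟩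

theorem autCone_apply_mem {g : (V →L[ℝ] V)ˣ} (hg : g ∈ autCone V) {x : V} (hx : x ∈ cone V) :
    (g : V →L[ℝ] V) x ∈ cone V := by
  have h : (g : V →L[ℝ] V) '' cone V = cone V := hg
  rw [← h]; exact ⟨x, hx, rfl⟩

theorem IsStr.expUnit_mem_autCone {X X' : V →L[ℝ] V} (h : IsStr X X') (hc : IsJordanFrame c)
    (t : ℝ) : expUnit (t • X) ∈ autCone V := by
  refine mem_autCone_of_mapsTo (fun x hx => h.exp_mem_cone hc t hx) fun x hx => ?_
  change exp (-(t • X)) x ∈ cone V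
  rw [← neg_smul]
  exact h.exp_mem_cone hc (-t) hx

theorem G_le_autCone : G V ≤ autCone V := by
  rintro _ ⟨g, _, rfl⟩
  exact g.2

/-- Connectedness in End(V) passes to Aut(W) because the units of a complete algebra embed
topologically. -/
theorem mem_G_of_isPreconnected {T : Set (V →L[ℝ] V)} (hT : IsPreconnected T)
    (h1 : (1 : V →L[ℝ] V) ∈ T) (h : ∀ k ∈ T, ∃ g ∈ autCone V, (g : V →L[ℝ] V) = k)
    {g : (V →L[ℝ] V)ˣ} (hg : (g : V →L[ℝ] V) ∈ T) : g ∈ G V := by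
  have : CompleteSpace V := FiniteDimensional.complete ℝ V
  let f : autCone V → (V →L[ℝ] V) := fun g => ((g : (V →L[ℝ] V)ˣ) : V →L[ℝ] V)
  have hf : Topology.IsInducing f :=
    (Units.isOpenEmbedding_val (R := V →L[ℝ] V)).isInducing.comp Topology.IsInducing.subtypeVal
  have himg : f '' (f ⁻¹' T) = T := by
    refine Set.image_preimage_eq_of_subset fun k hk => ?_
    obtain ⟨g, hg, rfl⟩ := h k hk
    exact ⟨⟨g, hg⟩, rfl⟩
  have hpre : IsPreconnected (f ⁻¹' T) := hf.isPreconnected_image.mp (by rwa [himg])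
  obtain ⟨g', hg', hgg'⟩ := h g hg
  obtain rfl : g' = g := Units.ext hgg'
  have hsub := hpre.subset_connectedComponent (x := 1) h1
  exact ⟨⟨g', hg'⟩, hsub hg, rfl⟩

theorem IsStr.expUnit_mem_G {X X' : V →L[ℝ] V} (h : IsStr X X') (hc : IsJordanFrame c) :
    expUnit X ∈ G V := by
  have hT : IsPreconnected (Set.range fun t : ℝ => exp (t • X)) :=
    isPreconnected_range (continuous_exp_smul X)
  refine mem_G_of_isPreconnected hT ⟨0, by simp⟩ ?_ ⟨1, by simp⟩
  rintro _ ⟨t, rfl⟩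
  exact ⟨expUnit (t • X), h.expUnit_mem_autCone hc t, rfl⟩

theorem IsStr.mem_lieG {X X' : V →L[ℝ] V} (h : IsStr X X') (hc : IsJordanFrame c) :
    X ∈ lieG V := by
  intro t
  refine ⟨expUnit (t • X), IsStr.expUnit_mem_G (X' := t • X') (fun x u => ?_) hc, rfl⟩
  have := h x u
  simp only [_root_.smul_apply, map_smul, Q_smul_left, ← smul_add, this, smul_comm t (2 : ℝ)]

/-- Here s is the logarithm of a, taken on the eigenvalues. Since exp L(s) lies in G, this gives
transitivity of G on the cone. -/
theorem IsJordanFrame.exists_exp_eq (hc : IsJordanFrame c) {a : V} (ha : a ∈ cone V) :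
    ∃ s : V, exp (L s) 1 = a := by
  obtain ⟨k, hk, α, hα⟩ := hc.exists_isoAut_diag a
  rw [← hc.isoAut_mem_cone_iff hk, hα, hc.diag_mem_cone_iff] at ha
  obtain ⟨k', hkk', hk'k⟩ := exists_inverse_of_mem_isoAut hk
  have e1 : ∀ z, k' (k z) = z := DFunLike.congr_fun hk'k
  have e2 : ∀ z, k (k' z) = z := DFunLike.congr_fun hkk'
  refine ⟨k' (diag c fun j => Real.log (α j)), ?_⟩
  have h1 : (1 : V) = ∑ j, k' (c j) := by
    rw [← map_sum, hc.complete]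
    conv_rhs => rw [← hk.2.1, e1]
  have h2 : ∀ j, exp (L (k' (diag c fun j => Real.log (α j)))) (k' (c j)) = α j • k' (c j) := by
    intro j
    rw [exp_apply_of_eigenvector (r := Real.log (α j)), Real.exp_log (ha j)]
    have h3 : k (k' (diag c fun j => Real.log (α j)) * k' (c j)) = Real.log (α j) • c j := by
      rw [hk.1, e2, e2, mul_comm, hc.diag_apply]
    rw [L_apply, ← e1 (k' (diag c fun j => Real.log (α j)) * k' (c j)), h3, map_smul]
  rw [h1, map_sum]
  simp only [h2]
  rw [← e1 a, hα, diag, map_sum]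
  simp only [map_smul]

/-- Every element is conjugate to a diagonal one under isometric automorphisms belonging to `G`. -/
theorem IsJordanFrame.exists_G_diag (hc : IsJordanFrame c) (b : V) :
    ∃ g ∈ G V, (g : V →L[ℝ] V) ∈ isoAut V ∧ ∃ β, (g : V →L[ℝ] V) b = diag c β := by
  -- Restricting to the identity component keeps the group compact and stable under inner
  -- derivations, and puts the conjugating element in G.
  set K := connectedComponentIn (isoAut V) (1 : V →L[ℝ] V) with hK
  have hsub : K ⊆ isoAut V := connectedComponentIn_subset _ _
  have h1 : (1 : V →L[ℝ] V) ∈ K := mem_connectedComponentIn one_mem_isoAut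
  have hpre : IsPreconnected K := isPreconnected_connectedComponentIn
  have hclosed : IsClosed K := by
    have h2 : closure K ⊆ K := by
      refine hpre.closure.subset_connectedComponentIn (subset_closure h1) ?_
      exact closure_minimal hsub isClosed_isoAut
    exact isClosed_of_closure_subset h2
  have hcomp : IsCompact K := isCompact_isoAut.of_isClosed_subset hclosed hsub
  have hexp : ∀ k ∈ K, ∀ (x y : V) (t : ℝ), exp (t • lieL x y) * k ∈ K := by
    intro k hk x y t
    have hp : IsPreconnected (Set.range fun t : ℝ => exp (t • lieL x y) * k) :=
      isPreconnected_range ((continuous_exp_smul _).mul continuous_const)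
    have h3 := hp.subset_connectedComponentIn (F := isoAut V) (x := k) ⟨0, by simp⟩ (by
      rintro _ ⟨s, rfl⟩
      exact exp_lieL_mul_mem_isoAut x y s (hsub hk))
    rw [hK, connectedComponentIn_eq hk]
    exact h3 ⟨t, rfl⟩
  obtain ⟨k, hk, β, hβ⟩ := hc.exists_conj_diag hcomp h1 hexp b
  have hunit : ∀ k ∈ K, ∃ g ∈ autCone V, (g : V →L[ℝ] V) = k := by
    intro k hk
    obtain ⟨k', h2, h3⟩ := exists_inverse_of_mem_isoAut (hsub hk)
    refine ⟨⟨k, k', h2, h3⟩, mem_autCone_of_mapsTo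
      (fun x hx => (hc.isoAut_mem_cone_iff (hsub hk) x).mpr hx) (fun x hx => ?_), rfl⟩
    rw [← hc.isoAut_mem_cone_iff (hsub hk)]
    change k (k' x) ∈ cone V
    rwa [show k (k' x) = x from DFunLike.congr_fun h2 x]
  obtain ⟨g, _, rfl⟩ := hunit k hk
  exact ⟨g, mem_G_of_isPreconnected hpre h1 hunit hk, hsub hk, β, hβ⟩

/-! ### The structure of the automorphism group of the cone -/

theorem IsJordanFrame.one_mem_cone (hc : IsJordanFrame c) : (1 : V) ∈ cone V := by
  rw [← hc.diag_one, hc.diag_mem_cone_iff]; exact fun _ => one_pos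

theorem IsJordanFrame.map_squares (hc : IsJordanFrame c) {g : (V →L[ℝ] V)ˣ} (hg : g ∈ autCone V)
    {x : V} (hx : x ∈ Set.range fun y : V => y * y) :
    (g : V →L[ℝ] V) x ∈ Set.range fun y : V => y * y := by
  have h1 : ∀ ε : ℝ, 0 < ε → (g : V →L[ℝ] V) (x + ε • (1 : V)) ∈ Set.range fun y : V => y * y := by
    intro ε hε
    refine interior_subset (autCone_apply_mem hg ?_)
    rw [hc.mem_cone_iff]
    intro u hu
    have := (hc.mem_squares_iff x).mp hx u
    rw [add_mul', smul_mul', one_mul, inner_add_left, real_inner_smul_left,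
      real_inner_self_eq_norm_sq]
    have : 0 < ε * ‖u‖ ^ 2 := by have := norm_pos_iff.mpr hu; positivity
    linarith
  have hcont : Continuous fun ε : ℝ => (g : V →L[ℝ] V) (x + ε • (1 : V)) := by fun_prop
  have hlim := (hcont.tendsto 0).mono_left (nhdsWithin_le_nhds (s := Set.Ioi 0))
  simp only [zero_smul, add_zero] at hlim
  exact hc.isClosed_squares.mem_of_tendsto hlim
    (Filter.eventually_of_mem self_mem_nhdsWithin fun ε hε => h1 ε hε)

theorem IsJordanFrame.inner_squares_nonneg (hc : IsJordanFrame c) {x y : V}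
    (hx : x ∈ Set.range fun y : V => y * y) (hy : y ∈ Set.range fun y : V => y * y) :
    0 ≤ (inner ℝ x y : ℝ) := by
  obtain ⟨z, rfl⟩ := hy
  have := (hc.mem_squares_iff x).mp hx z
  rwa [mul_comm, inner_mul_left] at this

/-- A square orthogonal to an idempotent has product zero with it. -/
theorem IsJordanFrame.mul_eq_zero_of_inner (hc : IsJordanFrame c) {x p : V}
    (hx : x ∈ Set.range fun y : V => y * y) (hp : p * p = p) (h : (inner ℝ x p : ℝ) = 0) :
    x * p = 0 := by
  rw [hc.mem_squares_iff] at hx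
  have h0 : (inner ℝ (x * p) p : ℝ) = 0 := by rw [mul_comm, inner_mul_left, hp, h]
  have key : ∀ t : ℝ, 0 ≤ 2 * t * ‖x * p‖ ^ 2 + t ^ 2 * inner ℝ (x * (x * p)) (x * p) := by
    intro t
    have := hx (p + t • (x * p))
    simp only [mul_add', mul_smul', inner_add_left, inner_add_right, real_inner_smul_left,
      real_inner_smul_right, h0] at this
    rw [real_inner_self_eq_norm_sq, inner_mul_left x (x * p) p, real_inner_self_eq_norm_sq] at this
    linarith
  set A := ‖x * p‖ ^ 2 with hA
  set B := (inner ℝ (x * (x * p)) (x * p) : ℝ)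
  have hB : 0 ≤ B := hx _
  by_contra hne
  have hApos : 0 < A := by have := norm_pos_iff.mpr hne; positivity
  have h1 := key (-(A / (B + 1)))
  have h2 : (A / (B + 1)) ^ 2 * B ≤ A / (B + 1) * A := by
    have e : (A / (B + 1)) ^ 2 * B = A / (B + 1) * A * (B / (B + 1)) := by field_simp
    rw [e]
    exact mul_le_of_le_one_right (by positivity) (by rw [div_le_one (by positivity)]; linarith)
  have h3 : 0 < A / (B + 1) * A := by positivity
  nlinarith

/-- A linear automorphism of the cone fixing the unit maps idempotents to idempotents, since these
are the extreme points of the order interval `[0, e]`. -/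
theorem IsJordanFrame.map_idempotent (hc : IsJordanFrame c) {g : (V →L[ℝ] V)ˣ}
    (hg : g ∈ autCone V) (hg1 : (g : V →L[ℝ] V) 1 = 1) {p : V} (hp : p * p = p) :
    (g : V →L[ℝ] V) p * (g : V →L[ℝ] V) p = (g : V →L[ℝ] V) p := by
  set C := Set.range fun y : V => y * y with hC
  have hp' : (1 - p) * (1 - p) = 1 - p := by
    rw [sub_mul', mul_sub', mul_sub', hp]; simp
  have hpC : p ∈ C := ⟨p, hp⟩
  have hpC' : 1 - p ∈ C := ⟨1 - p, hp'⟩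
  set y := (g : V →L[ℝ] V) p with hy
  have hyC : y ∈ C := hc.map_squares hg hpC
  have hyC' : 1 - y ∈ C := by
    have := hc.map_squares hg hpC'
    rwa [map_sub, hg1] at this
  have hginv : g⁻¹ ∈ autCone V := (autCone V).inv_mem hg
  have e1 : ∀ z, ((g⁻¹ : (V →L[ℝ] V)ˣ) : V →L[ℝ] V) ((g : V →L[ℝ] V) z) = z :=
    DFunLike.congr_fun (Units.inv_mul g)
  have hg1' : ((g⁻¹ : (V →L[ℝ] V)ˣ) : V →L[ℝ] V) 1 = 1 := by
    conv_lhs => rw [← hg1]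
    rw [e1]
  obtain ⟨k, hk, η, hη⟩ := hc.exists_isoAut_diag y
  have hC_iff : ∀ (z : V) (β : Fin l → ℝ), k z = diag c β → (z ∈ C ↔ ∀ j, 0 ≤ β j) := by
    intro z β hz
    rw [hC, hc.mem_squares_iff, ← hc.inner_diag_mul_nonneg_iff]
    constructor
    · intro h u
      obtain ⟨v, rfl⟩ := surjective_of_mem_isoAut hk u
      rw [← hz, ← hk.1, inner_of_mem_isoAut hk]; exact h v
    · intro h u
      have := h (k u)
      rwa [← hz, ← hk.1, inner_of_mem_isoAut hk] at this
  have hdsub : ∀ α β : Fin l → ℝ, diag c α - diag c β = diag c (fun j => α j - β j) := by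
    intro α β; simp only [diag, sub_smul, Finset.sum_sub_distrib]
  have hdadd : ∀ α β : Fin l → ℝ, diag c α + diag c β = diag c (fun j => α j + β j) := by
    intro α β; simp only [diag, add_smul, Finset.sum_add_distrib]
  have hη0 := (hC_iff y η hη).mp hyC
  have hη1 := (hC_iff (1 - y) (fun j => 1 - η j)
    (by rw [map_sub, hk.2.1, hη, ← hc.diag_one, hdsub])).mp hyC'
  -- The defect from idempotency. As 0 ≤ η_j ≤ 1, both y ± u and e - y ± u remain squares, and so do
  -- their preimages p ± w and e - p ± w.
  set u := y - y * y with hu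
  have hku : k u = diag c (fun j => η j - η j * η j) := by
    rw [hu, map_sub, hk.1, hη, hc.diag_mul_diag, hdsub]
  have hη1' : ∀ j, η j ≤ 1 := fun j => by have := hη1 j; linarith
  have a1 : y + u ∈ C := (hC_iff _ _ (by rw [map_add, hη, hku, hdadd])).mpr
    (fun j => by nlinarith [hη0 j, hη1' j])
  have a2 : y - u ∈ C := (hC_iff _ _ (by rw [map_sub, hη, hku, hdsub])).mpr
    (fun j => by nlinarith [hη0 j, hη1' j])
  have a3 : 1 - y + u ∈ C := (hC_iff _ _
    (by rw [map_add, map_sub, hk.2.1, hη, hku, ← hc.diag_one, hdsub, hdadd])).mpr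
    (fun j => by nlinarith [hη0 j, hη1' j])
  have a4 : 1 - y - u ∈ C := (hC_iff _ _
    (by rw [map_sub, map_sub, hk.2.1, hη, hku, ← hc.diag_one, hdsub, hdsub])).mpr
    (fun j => by nlinarith [hη0 j, hη1' j])
  set w := ((g⁻¹ : (V →L[ℝ] V)ˣ) : V →L[ℝ] V) u with hw
  have b1 := hc.map_squares hginv a1
  have b2 := hc.map_squares hginv a2
  have b3 := hc.map_squares hginv a3
  have b4 := hc.map_squares hginv a4
  simp only [map_add, map_sub, hg1', hy, e1] at b1 b2 b3 b4
  rw [← hw] at b1 b2 b3 b4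
  have horth : (inner ℝ p (1 - p) : ℝ) = 0 := by
    have : (inner ℝ (p * p) (1 - p) : ℝ) = inner ℝ p (p * (1 - p)) := inner_mul_left _ _ _
    rw [hp, mul_sub', hp, mul_one, sub_self, inner_zero_right] at this
    exact this
  -- Both p + w and p - w pair nonnegatively with e - p, while p is orthogonal to e - p.
  have i1 : (inner ℝ w (1 - p) : ℝ) = 0 := by
    have h1 := hc.inner_squares_nonneg b1 hpC'
    have h2 := hc.inner_squares_nonneg b2 hpC'
    rw [inner_add_left, horth] at h1
    rw [inner_sub_left, horth] at h2
    linarith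
  have i2 : (inner ℝ w p : ℝ) = 0 := by
    have h1 := hc.inner_squares_nonneg b3 hpC
    have h2 := hc.inner_squares_nonneg b4 hpC
    rw [inner_add_left, real_inner_comm, horth] at h1
    rw [inner_sub_left, real_inner_comm, horth] at h2
    linarith
  have m1 := hc.mul_eq_zero_of_inner b1 hp' (by rw [inner_add_left, horth, i1, add_zero])
  have m2 := hc.mul_eq_zero_of_inner b3 hp
    (by rw [inner_add_left, real_inner_comm, horth, i2, add_zero])
  -- The two vanishing products read w - pw = 0 and pw = 0.
  have hw0 : w = 0 := by
    rw [add_mul', mul_sub', mul_sub', hp, mul_one, mul_one] at m1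
    rw [add_mul', sub_mul', hp, one_mul] at m2
    linear_combination (norm := module) m1 + m2
  have hu0 : u = 0 := by
    have : (g : V →L[ℝ] V) w = u := DFunLike.congr_fun (Units.mul_inv g) u
    rw [← this, hw0, map_zero]
  rw [hu, sub_eq_zero] at hu0
  exact hu0.symm

/-- Orthogonality of two idempotents is seen from idempotency of their sum, so g carries frames to
systems of orthogonal idempotents. Diagonalizing x gives g(x²) = (gx)², and polarization does the
rest. -/
theorem IsJordanFrame.map_mul_of_mem_autCone (hc : IsJordanFrame c) {g : (V →L[ℝ] V)ˣ}
    (hg : g ∈ autCone V) (hg1 : (g : V →L[ℝ] V) 1 = 1) (x y : V) :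
    (g : V →L[ℝ] V) (x * y) = (g : V →L[ℝ] V) x * (g : V →L[ℝ] V) y := by
  have sq : ∀ x, (g : V →L[ℝ] V) (x * x) = (g : V →L[ℝ] V) x * (g : V →L[ℝ] V) x := by
    intro x
    obtain ⟨k, hk, β, hβ⟩ := hc.exists_isoAut_diag x
    obtain ⟨k', hkk', hk'k⟩ := exists_inverse_of_mem_isoAut hk
    have e1 : ∀ z, k' (k z) = z := DFunLike.congr_fun hk'k
    have e2 : ∀ z, k (k' z) = z := DFunLike.congr_fun hkk'
    have hk'm : ∀ a b, k' (a * b) = k' a * k' b := by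
      intro a b
      rw [← e1 (k' a * k' b), hk.1, e2, e2]
    have hd : ∀ i j, k' (c i) * k' (c j) = if i = j then k' (c i) else 0 := by
      intro i j
      rw [← hk'm, hc.mul_eq]; split_ifs <;> simp
    have hgd : ∀ i j, (g : V →L[ℝ] V) (k' (c i)) * (g : V →L[ℝ] V) (k' (c j)) =
        if i = j then (g : V →L[ℝ] V) (k' (c i)) else 0 := by
      intro i j
      split_ifs with hij
      · subst hij
        exact hc.map_idempotent hg hg1 (by simpa using hd i i)
      · have h1 := hc.map_idempotent hg hg1 (p := k' (c i)) (by simpa using hd i i)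
        have h2 := hc.map_idempotent hg hg1 (p := k' (c j)) (by simpa using hd j j)
        have h3 := hc.map_idempotent hg hg1 (p := k' (c i) + k' (c j)) (by
          rw [add_mul', mul_add', mul_add', hd, hd, hd, hd]
          simp [hij, Ne.symm hij])
        rw [map_add, add_mul', mul_add', mul_add', h1, h2,
          mul_comm ((g : V →L[ℝ] V) (k' (c j)))] at h3
        linear_combination (norm := module) (1 / 2 : ℝ) • h3
    have hx : x = ∑ j, β j • k' (c j) := by
      rw [← e1 x, hβ, diag, map_sum]; simp only [map_smul]
    rw [hx]
    simp only [sum_mul', mul_sum', smul_mul', mul_smul', map_sum, map_smul, hd, hgd, smul_ite,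
      smul_zero, apply_ite (g : V →L[ℝ] V), map_zero]
  have e := sq (x + y)
  simp only [add_mul', mul_add', map_add, sq, mul_comm y x,
    mul_comm ((g : V →L[ℝ] V) y) ((g : V →L[ℝ] V) x)] at e
  linear_combination (norm := module) (1 / 2 : ℝ) • e

/-- Polar decomposition: an automorphism of the cone is `exp L(s)` times a Jordan automorphism. -/
theorem IsJordanFrame.exists_polar (hc : IsJordanFrame c) {g : (V →L[ℝ] V)ˣ}
    (hg : g ∈ autCone V) : ∃ (s : V) (h : (V →L[ℝ] V)ˣ),
      (∀ x y, (h : V →L[ℝ] V) (x * y) = (h : V →L[ℝ] V) x * (h : V →L[ℝ] V) y) ∧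
      g = expUnit (L s) * h := by
  obtain ⟨s, hs⟩ := hc.exists_exp_eq (autCone_apply_mem hg hc.one_mem_cone)
  have hE : expUnit (L s) ∈ autCone V := by
    have := (isStr_L s).expUnit_mem_autCone hc 1
    rwa [one_smul] at this
  refine ⟨s, (expUnit (L s))⁻¹ * g, ?_, by group⟩
  apply hc.map_mul_of_mem_autCone ((autCone V).mul_mem ((autCone V).inv_mem hE) hg)
  change exp (-(L s)) ((g : V →L[ℝ] V) 1) = 1
  rw [← hs, exp_neg_exp_apply]

theorem Q_exp_L (s x : V) : Q (exp (L s) x) (exp (L s) x) = exp (L s) * Q x x * exp (L s) := by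
  have := (isStr_L s).Q_exp 1 x
  rwa [one_smul] at this

/-- Automorphisms of the cone belong to the structure group. -/
theorem IsJordanFrame.Q_autCone (hc : IsJordanFrame c) {g : (V →L[ℝ] V)ˣ} (hg : g ∈ autCone V)
    (x u : V) :
    Q ((g : V →L[ℝ] V) x) ((g : V →L[ℝ] V) x) u = (g : V →L[ℝ] V) (Q x x
      (((g⁻¹ : (V →L[ℝ] V)ˣ) : V →L[ℝ] V) (Q ((g : V →L[ℝ] V) 1) ((g : V →L[ℝ] V) 1) u))) := by
  obtain ⟨s, h, hh, rfl⟩ := hc.exists_polar hg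
  have hinv : ∀ z, (h : V →L[ℝ] V) (((h⁻¹ : (V →L[ℝ] V)ˣ) : V →L[ℝ] V) z) = z :=
    DFunLike.congr_fun (Units.mul_inv h)
  have hinv' : ∀ z, ((h⁻¹ : (V →L[ℝ] V)ˣ) : V →L[ℝ] V) ((h : V →L[ℝ] V) z) = z :=
    DFunLike.congr_fun (Units.inv_mul h)
  have h1 : (h : V →L[ℝ] V) 1 = 1 := by
    have := hh 1 (((h⁻¹ : (V →L[ℝ] V)ˣ) : V →L[ℝ] V) 1)
    rwa [one_mul, hinv, mul_one, eq_comm] at this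
  simp only [mul_inv_rev, Units.val_mul, _root_.mul_apply_eq_comp, coe_expUnit]
  rw [Q_exp_L, Q_exp_L, h1]
  have hQ1 : Q (1 : V) 1 = 1 := by rw [Q_one_right, L_one]
  rw [hQ1, mul_one]
  simp only [_root_.mul_apply_eq_comp]
  congr 1
  rw [map_Q_of_map_mul hh]
  congr 1
  rw [hinv]
  exact (exp_neg_exp_apply (L s) (exp (L s) u)).symm

end ConeGroup

end EuclideanJordanAlgebra

namespace EuclideanJordanAlgebra

open NormedSpace (exp)

/-! ### Restricted roots -/

section Roots

variable {V : Type*} [NormedAddCommGroup V] [InnerProductSpace ℝ V] [EuclideanJordanAlgebra V]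
  [FiniteDimensional ℝ V] {l : ℕ} {c : Fin l → V}

theorem mem_frakA_iff (X : V →L[ℝ] V) : X ∈ frakA c ↔ ∃ ξ : Fin l → ℝ, X = L (diag c ξ) := by
  rw [frakA, Submodule.mem_span_range_iff_exists_fun]
  simp only [diag, L_sum, L_smul, eq_comm]

/-- An element of the Lie algebra of `G` is a multiplication operator plus a derivation. -/
theorem IsJordanFrame.lieG_derivation (hc : IsJordanFrame c) {X : V →L[ℝ] V} (hX : X ∈ lieG V)
    (x y : V) : X (x * y) - X 1 * (x * y) = (X x - X 1 * x) * y + x * (X y - X 1 * y) := by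
  -- Derivative at t = 0 of `Q_autCone` along exp(tX).
  have key : ∀ x, (2 : ℝ) • Q (X x) x = X * Q x x - Q x x * X + (2 : ℝ) • (Q x x * L (X 1)) := by
    intro x
    have e : ∀ t : ℝ, Q (exp (t • X) x) (exp (t • X) x) =
        exp (t • X) * Q x x * exp (t • (-X)) * Q (exp (t • X) 1) (exp (t • X) 1) := by
      intro t
      obtain ⟨g, hg, hgX⟩ := hX t
      obtain rfl : g = expUnit (t • X) := Units.ext hgX
      ext u
      rw [smul_neg]
      exact hc.Q_autCone (G_le_autCone hg) x u
    have h1 := hasDerivAt_Q (hasDerivAt_exp_smul_apply X x 0) (hasDerivAt_exp_smul_apply X x 0)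
    have h2 := hasDerivAt_Q (hasDerivAt_exp_smul_apply X 1 0) (hasDerivAt_exp_smul_apply X 1 0)
    have h3 := (((hasDerivAt_exp_smul_const X (0 : ℝ)).mul_const (Q x x)).mul
      (hasDerivAt_exp_smul_const (-X) (0 : ℝ))).mul h2
    rw [funext e] at h1
    have h4 := h1.unique h3
    simp only [zero_smul, NormedSpace.exp_zero, _root_.one_apply_eq_self, one_mul, mul_one,
      Pi.mul_apply] at h4
    have hQ1 : Q (1 : V) 1 = 1 := by rw [Q_one_right, L_one]
    rw [Q_comm x (X x), Q_comm 1 (X 1), Q_one_right (X 1), hQ1, mul_one, ← two_smul ℝ, ← two_smul ℝ] at h4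
    rw [h4]
    simp only [mul_smul_comm]
    noncomm_ring
  have sq : ∀ x, X (x * x) - X 1 * (x * x) = (2 : ℝ) • ((X x - X 1 * x) * x) := by
    intro x
    have h1 := DFunLike.congr_fun (key x) 1
    have h2 := mul_Q_add_Q_mul (X 1) x 1
    simp only [_root_.add_apply, _root_.sub_apply, _root_.smul_apply, _root_.mul_apply_eq_comp,
      L_apply, mul_one, Q_self_one] at h1 h2
    have h3 : ∀ a b : V, Q a b 1 = a * b := by
      intro a b; simp only [Q_apply, mul_one, mul_comm b a]; abel
    rw [h3] at h1 h2
    rw [sub_mul']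
    linear_combination (norm := module) -h1 - h2
  have e := sq (x + y)
  have e1 := sq x
  have e2 := sq y
  simp only [add_mul', mul_add', map_add, sub_mul', mul_sub', mul_comm y x,
    mul_comm x (X y), mul_comm x (X 1 * y)] at e e1 e2 ⊢
  linear_combination (norm := module) (1 / 2 : ℝ) • (e - e1 - e2)

/-- The restricted roots are among the functionals `± (x_i - x_j) / 2` with `V_ij ≠ 0`. -/
theorem IsJordanFrame.root_sq (hc : IsJordanFrame c) {α : Module.Dual ℝ (frakA c)}
    (hα : IsRestrictedRoot c α) : ∃ i j, peirce c i j ≠ 0 ∧ ∀ (H : frakA c) (ξ : Fin l → ℝ),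
      (H : V →L[ℝ] V) = L (diag c ξ) → (α H) ^ 2 = ((ξ i - ξ j) / 2) ^ 2 := by
  obtain ⟨hα0, X, hX, hX0, hroot⟩ := hα
  set v := X 1 with hv
  have hD := hc.lieG_derivation hX
  rw [← hv] at hD
  have hH : ∀ (H : frakA c) (h : V), (H : V →L[ℝ] V) = L h →
      (∀ u, h * (v * u) - v * (h * u) = α H • (X u - v * u)) ∧
      α H ^ 2 • v = v * (h * h) - h * (h * v) := by
    intro H h hHh
    have h1 : ∀ u, h * X u - X (h * u) = α H • X u := by
      intro u
      have := DFunLike.congr_fun (hroot H) u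
      rwa [hHh] at this
    have h2 := h1 1
    rw [mul_one, ← hv] at h2
    have h3 : ∀ u, h * (v * u) - v * (h * u) = α H • (X u - v * u) := by
      intro u
      have h4 := hD h u
      have h5 := h1 u
      have h6 := congrArg (· * u) h2
      simp only [sub_mul', smul_mul', mul_sub'] at h4 h6
      rw [mul_comm h v] at h6
      linear_combination (norm := module) h4 + h5 - h6
    refine ⟨h3, ?_⟩
    have h4 := h3 h
    have h5 : α H • (X h - v * h) = -(α H ^ 2 • v) := by
      rw [mul_comm v h]
      have := congrArg (α H • ·) h2
      linear_combination (norm := module) -this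
    rw [h5, mul_comm v h] at h4
    linear_combination (norm := module) h4
  have hv0 : v ≠ 0 := by
    intro hv0
    apply hX0
    obtain ⟨H, hH0⟩ : ∃ H, α H ≠ 0 := by
      by_contra hcon; push Not at hcon; exact hα0 (LinearMap.ext hcon)
    obtain ⟨ξ, hξ⟩ := (mem_frakA_iff _).mp H.2
    ext u
    have := (hH H _ hξ).1 u
    rw [hv0, zero_mul', zero_mul', mul_zero', sub_zero, sub_zero] at this
    exact (smul_eq_zero.mp this.symm).resolve_left hH0
  obtain ⟨i, j, hij⟩ : ∃ i j, peirce c i j v ≠ 0 := by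
    by_contra hcon
    push Not at hcon
    apply hv0
    rw [← hc.sum_peirce v]; simp [hcon]
  refine ⟨i, j, fun h0 => hij (by rw [h0]; rfl), fun H ξ hξ => ?_⟩
  -- On V_ij the equation reads α² = (ξ_i² + ξ_j²)/2 - ((ξ_i + ξ_j)/2)² = ((ξ_i - ξ_j)/2)².
  have h1 := congrArg (peirce c i j) (hH H _ hξ).2
  rw [mul_comm v, hc.diag_mul_diag, map_sub, map_smul, hc.peirce_diag_mul, hc.peirce_diag_mul,
    hc.peirce_diag_mul, smul_smul, ← sub_smul] at h1
  have := smul_left_injective ℝ hij h1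
  rw [this]; ring

/-- The coordinate `x_i` on `𝔞`. -/
def frakCoord (c : Fin l → V) (i : Fin l) : Module.Dual ℝ (frakA c) where
  toFun H := inner ℝ ((H : V →L[ℝ] V) 1) (c i) / ‖c i‖ ^ 2
  map_add' H K := by simp [inner_add_left, add_div]
  map_smul' r H := by simp [real_inner_smul_left, mul_div_assoc]

theorem IsJordanFrame.frakCoord_apply (hc : IsJordanFrame c) {H : frakA c} {ξ : Fin l → ℝ}
    (hξ : (H : V →L[ℝ] V) = L (diag c ξ)) (i : Fin l) : frakCoord c i H = ξ i := by
  change inner ℝ ((H : V →L[ℝ] V) 1) (c i) / ‖c i‖ ^ 2 = ξ i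
  rw [hξ, L_apply, mul_one, hc.inner_diag]
  have := norm_pos_iff.mpr (hc.ne_zero i)
  field_simp

/-- For 0 ≠ u ∈ V_ij the root vector is L(u) + 2[L(c_i), L(u)]: bracketing with 𝔞 exchanges its two
parts up to a scalar. -/
theorem IsJordanFrame.isRestrictedRoot (hc : IsJordanFrame c) {i j : Fin l} (hij : i ≠ j)
    (h : peirce c i j ≠ 0) :
    IsRestrictedRoot c ((1 / 2 : ℝ) • (frakCoord c i - frakCoord c j)) := by
  obtain ⟨x, hx⟩ : ∃ x, peirce c i j x ≠ 0 := by
    by_contra hcon; push Not at hcon; exact h (ContinuousLinearMap.ext hcon)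
  have happ : ∀ (H : frakA c) (ξ : Fin l → ℝ), (H : V →L[ℝ] V) = L (diag c ξ) →
      ((1 / 2 : ℝ) • (frakCoord c i - frakCoord c j)) H = (ξ i - ξ j) / 2 := by
    intro H ξ hξ
    rw [LinearMap.smul_apply, LinearMap.sub_apply, hc.frakCoord_apply hξ, hc.frakCoord_apply hξ,
      smul_eq_mul]
    ring
  set u := peirce c i j x with hu
  have hiu : c i * u = (1 / 2 : ℝ) • u := by rw [hu, hc.mul_peirce]; simp [hij]
  refine ⟨fun h0 => ?_, L u + lieL ((2 : ℝ) • c i) u, (isStr _ _ _).mem_lieG hc, fun h0 => ?_, ?_⟩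
  · have hmem : L (diag c (Pi.single i 1)) ∈ frakA c := (mem_frakA_iff _).mpr ⟨_, rfl⟩
    have := happ ⟨_, hmem⟩ (Pi.single i 1) rfl
    rw [h0] at this
    simp [hij.symm] at this
  · have := DFunLike.congr_fun h0 1
    simp only [_root_.add_apply, L_apply, mul_one, lieL_one, add_zero] at this
    exact hx this
  · intro H
    obtain ⟨ξ, hξ⟩ := (mem_frakA_iff _).mp H.2
    rw [happ H ξ hξ, hξ]
    ext v
    have h1 := hc.lie_diag_peirce hij ξ x v
    have h2 := lie_lie (c i) u (diag c ξ) v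
    rw [← hu] at h1
    have h3 : c i * (u * diag c ξ) - u * (c i * diag c ξ) = (-(ξ i - ξ j) / 4) • u := by
      rw [hc.diag_apply, mul_comm u (diag c ξ), hu, hc.diag_mul_peirce, ← hu, mul_smul', mul_smul',
        mul_comm u (c i), hiu]
      module
    rw [h3, smul_mul'] at h2
    simp only [_root_.sub_apply, _root_.mul_apply_eq_comp, _root_.add_apply, L_apply, lieL_apply,
      _root_.smul_apply, smul_mul', mul_add', mul_sub', mul_smul']
    linear_combination (norm := module) h1 - (2 : ℝ) • h2

/-- In coordinates, `Ω` is given by `|x_i - x_j| < π` whenever `V_ij ≠ 0`. -/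
theorem IsJordanFrame.mem_Omega_iff (hc : IsJordanFrame c) {X : frakA c} {ξ : Fin l → ℝ}
    (hξ : (X : V →L[ℝ] V) = L (diag c ξ)) :
    X ∈ Omega c ↔ ∀ i j, peirce c i j ≠ 0 → |ξ i - ξ j| < Real.pi := by
  constructor
  · intro h i j hij
    rcases eq_or_ne i j with rfl | hne
    · simpa using Real.pi_pos
    have h1 := h _ (hc.isRestrictedRoot hne hij)
    rw [LinearMap.smul_apply, LinearMap.sub_apply, hc.frakCoord_apply hξ, hc.frakCoord_apply hξ,
      smul_eq_mul, abs_mul, abs_of_pos (by norm_num : (0 : ℝ) < 1 / 2)] at h1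
    linarith
  · intro h α hα
    obtain ⟨i, j, hij, hsq⟩ := hc.root_sq hα
    have h1 := h i j hij
    have h2 := sq_eq_sq_iff_abs_eq_abs _ _ |>.mp (hsq X ξ hξ)
    rw [h2, abs_div, abs_of_pos (by norm_num : (0 : ℝ) < 2)]
    linarith

end Roots

end EuclideanJordanAlgebra

namespace EuclideanJordanAlgebra

open NormedSpace (exp)

/-- A function whose oscillation on the classes of an equivalence relation is less than `2δ` is
within `δ` of a function that is constant on the classes. -/
theorem exists_class_midpoint {ι : Type*} [Fintype ι] {R : ι → ι → Prop} (hrefl : ∀ i, R i i)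
    (hsymm : ∀ i j, R i j → R j i) (htrans : ∀ i j k, R i j → R j k → R i k) {x : ι → ℝ} {δ : ℝ}
    (hx : ∀ i j, R i j → |x i - x j| < 2 * δ) :
    ∃ θ : ι → ℝ, (∀ i j, R i j → θ i = θ j) ∧ ∀ i, |x i - θ i| < δ := by
  classical
  set S : ι → Finset ι := fun i => Finset.univ.filter (R i) with hS
  have hmem : ∀ i j, j ∈ S i ↔ R i j := fun i j => by simp [hS]
  have hne : ∀ i, (S i).Nonempty := fun i => ⟨i, (hmem i i).mpr (hrefl i)⟩
  refine ⟨fun i => ((S i).sup' (hne i) x + (S i).inf' (hne i) x) / 2, fun i j hij => ?_,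
    fun i => ?_⟩
  · have hSS : S i = S j := by
      ext k
      rw [hmem, hmem]
      exact ⟨htrans j i k (hsymm i j hij), htrans i j k hij⟩
    simp only [hSS]
  · obtain ⟨p, hp, hp'⟩ := Finset.exists_mem_eq_sup' (hne i) x
    obtain ⟨q, hq, hq'⟩ := Finset.exists_mem_eq_inf' (hne i) x
    have h1 := Finset.le_sup' x ((hmem i i).mpr (hrefl i))
    have h2 := Finset.inf'_le x ((hmem i i).mpr (hrefl i))
    have h3 := hx p q (htrans p i q (hsymm i p ((hmem i p).mp hp)) ((hmem i q).mp hq))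
    simp only [hp', hq'] at h1 h2 ⊢
    rw [abs_lt] at h3 ⊢
    constructor <;> linarith

section Central

variable {V : Type*} [NormedAddCommGroup V] [InnerProductSpace ℝ V] [EuclideanJordanAlgebra V]
  [FiniteDimensional ℝ V] {l : ℕ} {c : Fin l → V}

/-- Diagonal elements that are constant on the simple components are central. -/
theorem IsJordanFrame.central (hc : IsJordanFrame c) {f : Fin l → ℝ}
    (hf : ∀ i j, peirce c i j ≠ 0 → f i = f j) (x : V) :
    L (diag c f) * L x = L x * L (diag c f) := by
  ext v
  simp only [_root_.mul_apply_eq_comp, L_apply]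
  rw [← hc.sum_peirce x]
  simp only [sum_mul', mul_sum']
  refine Finset.sum_congr rfl fun i _ => Finset.sum_congr rfl fun j _ => ?_
  by_cases h0 : peirce c i j = 0
  · simp [h0, zero_mul', mul_zero']
  rcases eq_or_ne i j with rfl | hij
  · obtain ⟨r, hr⟩ := hc.peirce_self i x
    rw [hr]
    simp only [diag, sum_mul', smul_mul', mul_smul', mul_sum', hc.mul_left_comm _ i, Finset.smul_sum]
    exact Finset.sum_congr rfl fun k _ => smul_comm _ _ _
  · have := hc.lie_diag_peirce hij f x v
    rw [hf i j h0, sub_self, zero_smul, sub_eq_zero] at this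
    exact this

theorem exp_comm_of_comm {T X : V →L[ℝ] V} (h : T * X = X * T) : T * exp X = exp X * T :=
  (Commute.exp_right (show Commute T X from h)).eq

/-- Pairs of elements of the cone of the form `(a + b, a - b)` are, up to `G` and central rotations,
diagonal. -/
theorem IsJordanFrame.exists_polar_diag (hc : IsJordanFrame c) {a b : V} (h1 : a + b ∈ cone V)
    (h2 : a - b ∈ cone V) : ∃ g ∈ G V, ∃ y : Fin l → ℝ, (∀ j, |y j| < Real.pi / 4) ∧
      a = (g : V →L[ℝ] V) (diag c fun j => Real.cos (y j)) ∧
      b = (g : V →L[ℝ] V) (diag c fun j => Real.sin (y j)) ∧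
      ∀ T : V →L[ℝ] V, (∀ x, T * L x = L x * T) →
        T * (g : V →L[ℝ] V) = (g : V →L[ℝ] V) * T := by
  have ha : a ∈ cone V := by
    rw [hc.mem_cone_iff] at h1 h2 ⊢
    intro u hu
    have e1 := h1 u hu
    have e2 := h2 u hu
    rw [add_mul', inner_add_left] at e1
    rw [sub_mul', inner_sub_left] at e2
    linarith
  obtain ⟨s, hs⟩ := hc.exists_exp_eq ha
  have hE : expUnit (-(L s)) ∈ autCone V := by
    have := (isStr_L s).expUnit_mem_autCone hc (-1)
    rwa [neg_one_smul] at this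
  set b' := exp (-(L s)) b with hb'
  have hb : exp (L s) b' = b := exp_exp_neg_apply _ _
  have ha' : exp (-(L s)) a = 1 := by rw [← hs, exp_neg_exp_apply]
  have h1' : 1 + b' ∈ cone V := by
    have := autCone_apply_mem hE h1
    rwa [coe_expUnit, map_add, ha'] at this
  have h2' : 1 - b' ∈ cone V := by
    have := autCone_apply_mem hE h2
    rwa [coe_expUnit, map_sub, ha'] at this
  obtain ⟨k, hkG, hk, β, hβ⟩ := hc.exists_G_diag b'
  have h1'' : ∀ j, 0 < 1 + β j := by
    rw [← hc.diag_mem_cone_iff, show diag c (fun j => 1 + β j) = (k : V →L[ℝ] V) (1 + b') by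
      rw [map_add, hk.2.1, hβ, ← hc.diag_one]; simp only [diag, add_smul, Finset.sum_add_distrib]]
    exact (hc.isoAut_mem_cone_iff hk _).mpr h1'
  have h2'' : ∀ j, 0 < 1 - β j := by
    rw [← hc.diag_mem_cone_iff, show diag c (fun j => 1 - β j) = (k : V →L[ℝ] V) (1 - b') by
      rw [map_sub, hk.2.1, hβ, ← hc.diag_one]; simp only [diag, sub_smul, Finset.sum_sub_distrib]]
    exact (hc.isoAut_mem_cone_iff hk _).mpr h2'
  set y : Fin l → ℝ := fun j => Real.arctan (β j) with hy
  have hcos : ∀ j, 0 < Real.cos (y j) := fun j => Real.cos_arctan_pos _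
  set M := L (diag c fun j => Real.log (Real.cos (y j))⁻¹) with hM
  have hMdiag : ∀ γ : Fin l → ℝ, exp M (diag c γ) = diag c fun j => (Real.cos (y j))⁻¹ * γ j := by
    intro γ
    simp only [diag, map_sum, map_smul]
    refine Finset.sum_congr rfl fun j _ => ?_
    rw [exp_apply_of_eigenvector (r := Real.log (Real.cos (y j))⁻¹),
      Real.exp_log (inv_pos.mpr (hcos j)), smul_smul, mul_comm]
    rw [hM, L_apply, mul_comm, hc.diag_apply]
  have hinv : ∀ z, ((k⁻¹ : (V →L[ℝ] V)ˣ) : V →L[ℝ] V) ((k : V →L[ℝ] V) z) = z :=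
    DFunLike.congr_fun (Units.inv_mul k)
  refine ⟨expUnit (L s) * k⁻¹ * expUnit M, (G V).mul_mem ((G V).mul_mem
    ((isStr_L s).expUnit_mem_G hc) ((G V).inv_mem hkG)) ((isStr_L _).expUnit_mem_G hc), y,
    fun j => ?_, ?_, ?_, fun T hT => ?_⟩
  · rw [abs_lt]
    have e1 := Real.arctan_strictMono (show β j < 1 by linarith [h2'' j])
    have e2 := Real.arctan_strictMono (show -1 < β j by linarith [h1'' j])
    rw [Real.arctan_one] at e1
    rw [Real.arctan_neg, Real.arctan_one] at e2
    exact ⟨e2, e1⟩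
  · simp only [Units.val_mul, _root_.mul_apply_eq_comp, coe_expUnit]
    rw [hMdiag, show (diag c fun j => (Real.cos (y j))⁻¹ * Real.cos (y j)) = (k : V →L[ℝ] V) 1 by
      rw [hk.2.1, ← hc.diag_one]; congr 1; funext j; exact inv_mul_cancel₀ (hcos j).ne', hinv, hs]
  · simp only [Units.val_mul, _root_.mul_apply_eq_comp, coe_expUnit]
    rw [hMdiag, show (diag c fun j => (Real.cos (y j))⁻¹ * Real.sin (y j)) = (k : V →L[ℝ] V) b' by
      rw [hβ]; congr 1; funext j
      rw [inv_mul_eq_div, ← Real.tan_eq_sin_div_cos, hy, Real.tan_arctan], hinv, hb]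
  · have e1 := exp_comm_of_comm (hT s)
    have e2 := exp_comm_of_comm (hT (diag c fun j => Real.log (Real.cos (y j))⁻¹))
    have e3 := hk.2.2.2 T hT
    have e4 : T * ((k⁻¹ : (V →L[ℝ] V)ˣ) : V →L[ℝ] V) = ((k⁻¹ : (V →L[ℝ] V)ˣ) : V →L[ℝ] V) * T :=
      (Commute.units_inv_right (show Commute T (k : V →L[ℝ] V) from e3)).eq
    simp only [Units.val_mul, coe_expUnit]
    rw [← mul_assoc, ← mul_assoc, e1, mul_assoc (exp (L s)), e4, mul_assoc, mul_assoc, mul_assoc,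
      hM, e2]
    simp only [mul_assoc]

end Central

/-! ### The square-root domain -/

namespace Cx

section Topology

variable {V : Type*} [NormedAddCommGroup V] [InnerProductSpace ℝ V]

theorem re_real_smul (r : ℝ) (z : Cx V) : (r • z).re = r • z.re := by
  rw [← Complex.coe_smul, re_smul]; simp

theorem im_real_smul (r : ℝ) (z : Cx V) : (r • z).im = r • z.im := by
  rw [← Complex.coe_smul, im_smul]; simp

/-- The real part as a real linear map. -/
def reLin : Cx V →ₗ[ℝ] V := ⟨⟨re, re_add⟩, re_real_smul⟩

/-- The imaginary part as a real linear map. -/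
def imLin : Cx V →ₗ[ℝ] V := ⟨⟨im, im_add⟩, im_real_smul⟩

@[simp] theorem re_sum {ι : Type*} (s : Finset ι) (f : ι → Cx V) :
    (∑ i ∈ s, f i).re = ∑ i ∈ s, (f i).re := map_sum reLin f s

@[simp] theorem im_sum {ι : Type*} (s : Finset ι) (f : ι → Cx V) :
    (∑ i ∈ s, f i).im = ∑ i ∈ s, (f i).im := map_sum imLin f s

@[simp] theorem re_sub (z w : Cx V) : (z - w).re = z.re - w.re := map_sub reLin z w

@[simp] theorem im_sub (z w : Cx V) : (z - w).im = z.im - w.im := map_sub imLin z w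

variable [FiniteDimensional ℝ V]

theorem continuous_re : Continuous (re : Cx V → V) :=
  LinearMap.continuous_of_finiteDimensional (reLin (V := V))

theorem continuous_im : Continuous (im : Cx V → V) :=
  LinearMap.continuous_of_finiteDimensional (imLin (V := V))

@[simp] theorem re_complexify (A : V →L[ℝ] V) (z : Cx V) : (complexify A z).re = A z.re := rfl

@[simp] theorem im_complexify (A : V →L[ℝ] V) (z : Cx V) : (complexify A z).im = A z.im := rfl

end Topology

section Domain

variable {V : Type*} [NormedAddCommGroup V] [InnerProductSpace ℝ V] [EuclideanJordanAlgebra V]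
  [FiniteDimensional ℝ V] {l : ℕ} {c : Fin l → V}

@[simp] theorem re_one : (1 : Cx V).re = 1 := rfl

@[simp] theorem im_one : (1 : Cx V).im = 0 := rfl

theorem exp_diag_one (hc : IsJordanFrame c) (ξ : Fin l → ℝ) :
    exp (Complex.I • complexify ((1 / 2 : ℝ) • L (diag c ξ))) 1 =
      mk (diag c fun j => Real.cos (ξ j / 2)) (diag c fun j => Real.sin (ξ j / 2)) := by
  have : CompleteSpace (Cx V) := FiniteDimensional.complete ℂ _
  have h1 : (1 : Cx V) = ∑ j, mk (c j) 0 := by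
    ext
    · simp [hc.complete]
    · simp
  have h2 : ∀ j, exp (Complex.I • complexify ((1 / 2 : ℝ) • L (diag c ξ))) (mk (c j) 0) =
      Complex.exp ((ξ j / 2 : ℝ) * Complex.I) • mk (c j) 0 := by
    intro j
    rw [Complex.exp_eq_exp_ℂ]
    apply exp_apply_of_eigenvector'
    have h3 : diag c ξ * c j = ξ j • c j := by rw [mul_comm, hc.diag_apply]
    ext
    · simp [mul_zero']
    · simp [h3, smul_smul]; ring_nf
  rw [h1, map_sum]
  simp only [h2]
  ext
  · simp only [re_sum, re_smul, re_mk, im_mk, smul_zero, sub_zero, Complex.exp_ofReal_mul_I_re, diag]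
  · simp only [im_sum, im_smul, re_mk, im_mk, smul_zero, zero_add, Complex.exp_ofReal_mul_I_im, diag]

/-- The coordinates here are those of X/2, which halves the bound π of `mem_Omega_iff`. -/
theorem mem_sqrtDomain_iff (hc : IsJordanFrame c) (z : Cx V) :
    z ∈ sqrtDomain c ↔ ∃ g ∈ G V, ∃ x : Fin l → ℝ,
      (∀ i j, peirce c i j ≠ 0 → |x i - x j| < Real.pi / 2) ∧
      z.re = (g : V →L[ℝ] V) (diag c fun j => Real.cos (x j)) ∧
      z.im = (g : V →L[ℝ] V) (diag c fun j => Real.sin (x j)) := by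
  constructor
  · rintro ⟨g, hg, X, hX, rfl⟩
    obtain ⟨ξ, hξ⟩ := (mem_frakA_iff _).mp X.2
    refine ⟨g, hg, fun j => ξ j / 2, fun i j hij => ?_, ?_, ?_⟩
    · have := (hc.mem_Omega_iff hξ).mp hX i j hij
      rw [← sub_div, abs_div, abs_of_pos (by norm_num : (0 : ℝ) < 2)]
      linarith
    · rw [hξ, exp_diag_one hc]; rfl
    · rw [hξ, exp_diag_one hc]; rfl
  · rintro ⟨g, hg, x, hx, h1, h2⟩
    have hmem : L (diag c fun j => 2 * x j) ∈ frakA c := (mem_frakA_iff _).mpr ⟨_, rfl⟩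
    refine ⟨g, hg, ⟨_, hmem⟩, (hc.mem_Omega_iff rfl).mpr fun i j hij => ?_, ?_⟩
    · have := hx i j hij
      rw [← mul_sub, abs_mul, abs_of_pos (by norm_num : (0 : ℝ) < 2)]
      linarith
    · rw [exp_diag_one hc]
      ext
      · rw [h1]; simp
      · rw [h2]; simp

theorem isOpen_sqrtDomain (hc : IsJordanFrame c) : IsOpen (sqrtDomain c) := by
  rw [isOpen_iff_mem_nhds]
  intro z hz
  obtain ⟨g, hg, x, hx, hre, him⟩ := (mem_sqrtDomain_iff hc z).mp hz
  -- The relation V_ij ≠ 0 is an equivalence whose classes index the simple components. Since θ is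
  -- constant on classes, the multiplications by cos θ and sin θ are central.
  obtain ⟨θ, hθ, hxθ⟩ := exists_class_midpoint (R := fun i j => peirce c i j ≠ 0)
    (δ := Real.pi / 4)
    (fun i h => hc.ne_zero i (by rw [← hc.peirce_apply_self i, h]; rfl))
    (fun i j h => by rwa [peirce_comm])
    (fun i j k => hc.peirce_trans) (x := x) (fun i j h => by linarith [hx i j h])
  set C := L (diag c fun j => Real.cos (θ j)) with hC
  set S := L (diag c fun j => Real.sin (θ j)) with hS
  have hCc : ∀ x, C * L x = L x * C := hc.central fun i j h => by rw [hθ i j h]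
  have hSc : ∀ x, S * L x = L x * S := hc.central fun i j h => by rw [hθ i j h]
  set g' := ((g⁻¹ : (V →L[ℝ] V)ˣ) : V →L[ℝ] V) with hg'
  have e1 : ∀ u, g' ((g : V →L[ℝ] V) u) = u := DFunLike.congr_fun (Units.inv_mul g)
  have e2 : ∀ u, (g : V →L[ℝ] V) (g' u) = u := DFunLike.congr_fun (Units.mul_inv g)
  -- A + iB is the rotation of g⁻¹w by e^{-iθ}.
  set A : Cx V → V := fun w => C (g' w.re) + S (g' w.im) with hA
  set B : Cx V → V := fun w => C (g' w.im) - S (g' w.re) with hB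
  have hAc : Continuous A := (C.continuous.comp (g'.continuous.comp continuous_re)).add
    (S.continuous.comp (g'.continuous.comp continuous_im))
  have hBc : Continuous B := (C.continuous.comp (g'.continuous.comp continuous_im)).sub
    (S.continuous.comp (g'.continuous.comp continuous_re))
  have hdadd : ∀ α β : Fin l → ℝ, diag c α + diag c β = diag c (fun j => α j + β j) := by
    intro α β; simp only [diag, add_smul, Finset.sum_add_distrib]
  have hdsub : ∀ α β : Fin l → ℝ, diag c α - diag c β = diag c (fun j => α j - β j) := by
    intro α β; simp only [diag, sub_smul, Finset.sum_sub_distrib]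
  have hnhds : {w | A w + B w ∈ cone V ∧ A w - B w ∈ cone V} ∈ nhds z := by
    refine (IsOpen.inter (isOpen_interior.preimage (hAc.add hBc))
      (isOpen_interior.preimage (hAc.sub hBc))).mem_nhds ?_
    have hAz : A z = diag c fun j => Real.cos (x j - θ j) := by
      simp only [hA, hre, him, e1, hC, hS, L_apply, hc.diag_mul_diag, hdadd]
      congr 1; funext j; rw [Real.cos_sub]; ring
    have hBz : B z = diag c fun j => Real.sin (x j - θ j) := by
      simp only [hB, hre, him, e1, hC, hS, L_apply, hc.diag_mul_diag, hdsub]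
      congr 1; funext j; rw [Real.sin_sub]; ring
    -- Here cos t + sin t = √2 cos(t - π/4).
    have key : ∀ t : ℝ, |t| < Real.pi / 4 → 0 < Real.cos t + Real.sin t := by
      intro t ht
      rw [abs_lt] at ht
      have h1 : 0 < Real.cos (t - Real.pi / 4) :=
        Real.cos_pos_of_mem_Ioo ⟨by linarith [Real.pi_pos], by linarith [Real.pi_pos]⟩
      rw [Real.cos_sub, Real.cos_pi_div_four, Real.sin_pi_div_four, ← add_mul] at h1
      exact pos_of_mul_pos_left h1 (by positivity)
    constructor
    · change A z + B z ∈ cone V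
      rw [hAz, hBz, hdadd, hc.diag_mem_cone_iff]
      exact fun j => key _ (hxθ j)
    · change A z - B z ∈ cone V
      rw [hAz, hBz, hdsub, hc.diag_mem_cone_iff]
      intro j
      have := key (-(x j - θ j)) (by rw [abs_neg]; exact hxθ j)
      rwa [Real.cos_neg, Real.sin_neg, ← sub_eq_add_neg] at this
  refine Filter.mem_of_superset hnhds fun w hw => ?_
  obtain ⟨k, hk, y, hy, hAk, hBk, hcomm⟩ := hc.exists_polar_diag hw.1 hw.2
  have hCk : ∀ u, C ((k : V →L[ℝ] V) u) = (k : V →L[ℝ] V) (C u) :=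
    DFunLike.congr_fun (hcomm C hCc)
  have hSk : ∀ u, S ((k : V →L[ℝ] V) u) = (k : V →L[ℝ] V) (S u) :=
    DFunLike.congr_fun (hcomm S hSc)
  have hCS : ∀ u, C (S u) = S (C u) := DFunLike.congr_fun (hCc _)
  -- The relation cos² θ + sin² θ = 1 for the central operators; it inverts the rotation.
  have hCS1 : ∀ u, C (C u) + S (S u) = u := by
    intro u
    have h1 : ∀ u, L (diag c fun j => Real.cos (θ j) * Real.cos (θ j)) u = C (C u) := by
      intro u
      have := DFunLike.congr_fun (hCc u) (diag c fun j => Real.cos (θ j))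
      simp only [hC, _root_.mul_apply_eq_comp, L_apply, hc.diag_mul_diag] at this ⊢
      rw [mul_comm, ← this, mul_comm u]
    have h2 : ∀ u, L (diag c fun j => Real.sin (θ j) * Real.sin (θ j)) u = S (S u) := by
      intro u
      have := DFunLike.congr_fun (hSc u) (diag c fun j => Real.sin (θ j))
      simp only [hS, _root_.mul_apply_eq_comp, L_apply, hc.diag_mul_diag] at this ⊢
      rw [mul_comm, ← this, mul_comm u]
    rw [← h1, ← h2, ← _root_.add_apply, ← L_add, hdadd]
    simp only [← sq, Real.cos_sq_add_sin_sq, hc.diag_one, L_one]; rfl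
  have hre' : g' w.re = C (A w) - S (B w) := by
    simp only [hA, hB, map_add, map_sub, hCS]
    rw [← sub_eq_zero]
    linear_combination (norm := module) -(hCS1 (g' w.re))
  have him' : g' w.im = C (B w) + S (A w) := by
    simp only [hA, hB, map_add, map_sub, hCS]
    linear_combination (norm := module) -(hCS1 (g' w.im))
  refine (mem_sqrtDomain_iff hc w).mpr ⟨g * k, (G V).mul_mem hg hk, fun j => y j + θ j,
    fun i j hij => ?_, ?_, ?_⟩
  · simp only [hθ i j hij, add_sub_add_right_eq_sub]
    have h1 := abs_lt.mp (hy i)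
    have h2 := abs_lt.mp (hy j)
    rw [abs_lt]; constructor <;> linarith
  · rw [← e2 w.re, hre', hAk, hBk, hCk, hSk, ← map_sub]
    simp only [hC, hS, L_apply, hc.diag_mul_diag, hdsub, Units.val_mul, _root_.mul_apply_eq_comp]
    congr 3; funext j; rw [Real.cos_add]; ring
  · rw [← e2 w.im, him', hAk, hBk, hCk, hSk, ← map_add]
    simp only [hC, hS, L_apply, hc.diag_mul_diag, hdadd, Units.val_mul, _root_.mul_apply_eq_comp]
    congr 3; funext j; rw [Real.sin_add]; ring

end Domain

end Cx

end EuclideanJordanAlgebra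

/-! ### Symmetric operators -/

section Symmetric

variable {E : Type*} [NormedAddCommGroup E] [InnerProductSpace ℝ E] [FiniteDimensional ℝ E]

theorem LinearMap.IsSymmetric.inner_eq_sum {S : E →ₗ[ℝ] E} (hS : S.IsSymmetric) {n : ℕ}
    (hn : Module.finrank ℝ E = n) (x : E) : (inner ℝ (S x) x : ℝ) =
      ∑ i, hS.eigenvalues hn i * (inner ℝ (hS.eigenvectorBasis hn i) x) ^ 2 := by
  rw [← (hS.eigenvectorBasis hn).sum_inner_mul_inner]
  refine Finset.sum_congr rfl fun i _ => ?_
  rw [hS, hS.apply_eigenvectorBasis, real_inner_comm]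
  simp only [RCLike.ofReal_real_eq_id, id_eq, real_inner_smul_left, real_inner_smul_right]
  ring

theorem LinearMap.IsSymmetric.inner_pos {S : E →ₗ[ℝ] E} (hS : S.IsSymmetric)
    (h : ∀ (μ : ℝ) (v : E), v ≠ 0 → S v = μ • v → 0 < μ) {x : E} (hx : x ≠ 0) :
    0 < (inner ℝ (S x) x : ℝ) := by
  rw [hS.inner_eq_sum rfl]
  have hμ : ∀ i, 0 < hS.eigenvalues rfl i := fun i =>
    h _ (hS.eigenvectorBasis rfl i) ((hS.eigenvectorBasis rfl).orthonormal.ne_zero i)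
      (hS.apply_eigenvectorBasis rfl i)
  refine Finset.sum_pos' (fun i _ => mul_nonneg (hμ i).le (sq_nonneg _)) ?_
  by_contra hcon
  push Not at hcon
  apply hx
  have h0 : ∀ i, (inner ℝ (hS.eigenvectorBasis rfl i) x : ℝ) = 0 := fun i => by
    have h1 := hcon i (Finset.mem_univ i)
    have h2 : (inner ℝ (hS.eigenvectorBasis rfl i) x) ^ 2 ≤ (0 : ℝ) := by
      by_contra h3; push Not at h3
      exact absurd h1 (not_le.mpr (mul_pos (hμ i) h3))
    exact pow_eq_zero_iff (two_ne_zero) |>.mp (le_antisymm h2 (sq_nonneg _))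
  rw [← (hS.eigenvectorBasis rfl).sum_repr' x]
  simp [h0]

/-- On an eigenvector the hypothesis says μ³ ≤ 0. It lets the curvature form be tested on the range
of the curvature operator only. -/
theorem LinearMap.IsSymmetric.inner_nonpos_of_cube {S : E →ₗ[ℝ] E} (hS : S.IsSymmetric)
    (h : ∀ x, (inner ℝ (S (S x)) (S x) : ℝ) ≤ 0) (x : E) : (inner ℝ (S x) x : ℝ) ≤ 0 := by
  rw [hS.inner_eq_sum rfl]
  refine Finset.sum_nonpos fun i _ => mul_nonpos_of_nonpos_of_nonneg ?_ (sq_nonneg _)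
  have h1 := h (hS.eigenvectorBasis rfl i)
  have h2 := hS.apply_eigenvectorBasis rfl i
  rw [h2, map_smul, h2] at h1
  simp only [RCLike.ofReal_real_eq_id, id_eq, real_inner_smul_left, real_inner_smul_right,
    real_inner_self_eq_norm_sq, OrthonormalBasis.norm_eq_one] at h1
  by_contra h3
  push Not at h3
  have : 0 < hS.eigenvalues rfl i * (hS.eigenvalues rfl i * (hS.eigenvalues rfl i * 1 ^ 2)) := by
    positivity
  linarith

theorem OrthonormalBasis.sum_bilin {ι W : Type*} [Fintype ι] [AddCommGroup W] [Module ℝ W]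
    (b : OrthonormalBasis ι ℝ E) (f : E →ₗ[ℝ] E →ₗ[ℝ] W) (x y : E) :
    ∑ p : ι × ι, (inner ℝ (b p.1) x * inner ℝ (b p.2) y : ℝ) • f (b p.1) (b p.2) = f x y := by
  conv_rhs => rw [← b.sum_repr' x, ← b.sum_repr' y]
  simp only [map_sum, map_smul, LinearMap.sum_apply, LinearMap.smul_apply]
  rw [Fintype.sum_prod_type]
  simp only [mul_smul, Finset.smul_sum]
  rw [Finset.sum_comm]
  exact Finset.sum_congr rfl fun i _ => Finset.sum_congr rfl fun j _ => smul_comm _ _ _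

end Symmetric

namespace EuclideanJordanAlgebra

open NormedSpace (exp)

/-! ### Negativity of the curvature form -/

section Curvature

variable {V : Type*} [NormedAddCommGroup V] [InnerProductSpace ℝ V] [EuclideanJordanAlgebra V]
  [FiniteDimensional ℝ V] {l : ℕ} {c : Fin l → V}

/-- The commutator of multiplication operators as a bilinear map. -/
def lieBilin : V →ₗ[ℝ] V →ₗ[ℝ] (V →L[ℝ] V) :=
  LinearMap.mk₂ ℝ lieL
    (fun x y z => by
      ext u; simp only [lieL_apply, _root_.add_apply, add_mul', mul_add']; abel)
    (fun r x y => by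
      ext u; simp only [lieL_apply, _root_.smul_apply, smul_mul', mul_smul', smul_sub])
    (fun x y z => by
      ext u; simp only [lieL_apply, _root_.add_apply, add_mul', mul_add']; abel)
    (fun r x y => by
      ext u; simp only [lieL_apply, _root_.smul_apply, smul_mul', mul_smul', smul_sub])

@[simp] theorem lieBilin_apply (x y : V) : lieBilin x y = lieL x y := rfl

/-- Pair symmetry of the curvature tensor; it makes the curvature operator on V ⊗ V symmetric. -/
theorem inner_lieL_symm (x y z w : V) :
    (inner ℝ (lieL x y z) w : ℝ) = inner ℝ (lieL z w x) y := by
  simp only [lieL_apply, inner_sub_left, inner_mul_left]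
  rw [inner_mul_right y z, inner_mul_right x z, inner_mul_right w x, inner_mul_right z x,
    mul_comm w x, mul_comm z y, mul_comm z x, mul_comm w y, real_inner_comm (x * w)]

/-- For a skew derivation `D` the trace of `Dᵀ [L(e), L(De)]` is nonpositive. -/
theorem sum_inner_lieL_derivation {ι : Type*} [Fintype ι] (b : OrthonormalBasis ι ℝ V)
    {D : V →L[ℝ] V} (hD : ∀ x y, D (x * y) = D x * y + x * D y)
    (hskew : ∀ x y, (inner ℝ (D x) y : ℝ) = -inner ℝ x (D y)) (e : V) :
    ∑ a, (inner ℝ (lieL e (D e) (b a)) (D (b a)) : ℝ) ≤ 0 := by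
  have h1 : ∀ a, (inner ℝ (lieL e (D e) a) (D a) : ℝ) =
      inner ℝ a ((D * L (D e) * L e) a) - inner ℝ a ((L e * (D * L (D e))) a) -
        ‖D e * a‖ ^ 2 := by
    intro a
    simp only [lieL_apply, inner_sub_left, _root_.mul_apply_eq_comp, L_apply]
    have h2 : e * D a = D (e * a) - D e * a := by rw [hD]; abel
    have h3 : (inner ℝ a (e * D (D e * a)) : ℝ) = -inner ℝ (D e * a) (D (e * a)) := by
      rw [inner_mul_right, real_inner_comm, hskew]
    have h4 : (inner ℝ a (D (D e * (e * a))) : ℝ) = -inner ℝ (D e * (e * a)) (D a) := by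
      rw [real_inner_comm, hskew]
    rw [inner_mul_left, h2, inner_sub_right, h3, h4, real_inner_self_eq_norm_sq]
    ring
  simp only [h1, Finset.sum_sub_distrib]
  have t1 := LinearMap.trace_eq_sum_inner (D * L (D e) * L e : V →L[ℝ] V).toLinearMap b
  have t2 := LinearMap.trace_eq_sum_inner (L e * (D * L (D e)) : V →L[ℝ] V).toLinearMap b
  have t3 : LinearMap.trace ℝ V (D * L (D e) * L e : V →L[ℝ] V).toLinearMap =
      LinearMap.trace ℝ V (L e * (D * L (D e)) : V →L[ℝ] V).toLinearMap :=
    LinearMap.trace_mul_comm ℝ (D * L (D e) : V →L[ℝ] V).toLinearMap (L e).toLinearMap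
  rw [t3, t2] at t1
  have t4 : ∑ a, (inner ℝ (b a) ((L e * (D * L (D e))) (b a)) : ℝ) =
    ∑ a, (inner ℝ (b a) ((D * L (D e) * L e) (b a)) : ℝ) := t1
  rw [t4, sub_self, zero_sub, neg_nonpos]
  exact Finset.sum_nonneg fun a _ => sq_nonneg _

/-- The curvature form `∑ ([L(x_k), L(y_k)] x_m | y_m)` is negative semidefinite. -/
theorem sum_inner_lieL_nonpos {κ : Type*} [Fintype κ] (x y : κ → V) :
    ∑ m, ∑ k, (inner ℝ (lieL (x k) (y k) (x m)) (y m) : ℝ) ≤ 0 := by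
  classical
  set b := stdOrthonormalBasis ℝ V with hb
  set ι := Fin (Module.finrank ℝ V)
  let DT : EuclideanSpace ℝ (ι × ι) →ₗ[ℝ] (V →L[ℝ] V) :=
    { toFun := fun T => ∑ p : ι × ι, T p • lieL (b p.1) (b p.2)
      map_add' := fun T T' => by simp [add_smul, Finset.sum_add_distrib]
      map_smul' := fun r T => by simp [mul_smul, Finset.smul_sum] }
  -- The curvature operator on V ⊗ V. Its values are the matrices of the skew derivations D_T, to
  -- which `sum_inner_lieL_derivation` applies.
  let S : EuclideanSpace ℝ (ι × ι) →ₗ[ℝ] EuclideanSpace ℝ (ι × ι) :=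
    { toFun := fun T => WithLp.toLp 2 fun p => inner ℝ (DT T (b p.1)) (b p.2)
      map_add' := fun T T' => by ext p; simp [inner_add_left]
      map_smul' := fun r T => by ext p; simp [real_inner_smul_left] }
  have hDT : ∀ T, DT T = ∑ p : ι × ι, T p • lieL (b p.1) (b p.2) := fun _ => rfl
  have hSp : ∀ T p, S T p = inner ℝ (DT T (b p.1)) (b p.2) := fun _ _ => rfl
  have hinner : ∀ T T' : EuclideanSpace ℝ (ι × ι), (inner ℝ T T' : ℝ) = ∑ p, T p * T' p := by
    intro T T'
    simp [PiLp.inner_apply, mul_comm]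
  have hSsymm : S.IsSymmetric := by
    intro T T'
    rw [hinner, hinner]
    simp only [hSp, hDT, _root_.sum_apply, _root_.smul_apply, sum_inner, real_inner_smul_left,
      Finset.sum_mul, Finset.mul_sum]
    rw [Finset.sum_comm]
    refine Finset.sum_congr rfl fun p _ => Finset.sum_congr rfl fun q _ => ?_
    rw [inner_lieL_symm]; ring
  have hDTder : ∀ T x y, DT T (x * y) = DT T x * y + x * DT T y := by
    intro T x y
    simp only [hDT, _root_.sum_apply, _root_.smul_apply, lieL_mul, sum_mul', mul_sum', smul_mul',
      mul_smul', smul_add, Finset.sum_add_distrib]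
  have hDTskew : ∀ T x y, (inner ℝ (DT T x) y : ℝ) = -inner ℝ x (DT T y) := by
    intro T x y
    simp only [hDT, _root_.sum_apply, _root_.smul_apply, sum_inner, inner_sum,
      real_inner_smul_left, real_inner_smul_right, inner_lieL, mul_neg, Finset.sum_neg_distrib]
  have hcube : ∀ T, (inner ℝ (S (S T)) (S T) : ℝ) ≤ 0 := by
    intro T
    -- For D = D_T this turns ⟨S(ST), ST⟩ into a double sum of ([L(e), L(De)]a | Da) over basis
    -- vectors, nonpositive for each fixed e.
    have hD2 : DT (S T) = ∑ a, lieL (b a) (DT T (b a)) := by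
      rw [hDT, Fintype.sum_prod_type]
      refine Finset.sum_congr rfl fun a _ => ?_
      conv_rhs => rw [← b.sum_repr' (DT T (b a)), ← lieBilin_apply, map_sum]
      refine Finset.sum_congr rfl fun q _ => ?_
      rw [map_smul, hSp, real_inner_comm]; rfl
    have h1 : (inner ℝ (S (S T)) (S T) : ℝ) = ∑ a, (inner ℝ (DT (S T) (b a)) (DT T (b a)) : ℝ) := by
      rw [hinner, Fintype.sum_prod_type]
      refine Finset.sum_congr rfl fun a _ => ?_
      rw [← b.sum_inner_mul_inner]
      refine Finset.sum_congr rfl fun q _ => ?_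
      rw [hSp, hSp, real_inner_comm (b q) (DT T (b a))]
    rw [h1, hD2]
    simp only [_root_.sum_apply, sum_inner]
    rw [Finset.sum_comm]
    exact Finset.sum_nonpos fun e _ =>
      sum_inner_lieL_derivation b (hDTder T) (hDTskew T) (b e)
  let T0 : EuclideanSpace ℝ (ι × ι) :=
    WithLp.toLp 2 fun p => ∑ k, inner ℝ (b p.1) (x k) * inner ℝ (b p.2) (y k)
  have hT0 : ∀ p, T0 p = ∑ k, inner ℝ (b p.1) (x k) * inner ℝ (b p.2) (y k) := fun _ => rfl
  have hD0 : DT T0 = ∑ k, lieL (x k) (y k) := by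
    rw [hDT]
    simp only [hT0, Finset.sum_smul]
    rw [Finset.sum_comm]
    exact Finset.sum_congr rfl fun k _ => b.sum_bilin lieBilin (x k) (y k)
  have h := hSsymm.inner_nonpos_of_cube hcube T0
  have e : (inner ℝ (S T0) T0 : ℝ) = ∑ m, (inner ℝ (DT T0 (x m)) (y m) : ℝ) := by
    rw [hinner]
    simp only [hT0, hSp, Finset.mul_sum]
    rw [Finset.sum_comm]
    refine Finset.sum_congr rfl fun m _ => ?_
    refine Eq.trans ?_ (b.sum_bilin ((innerₗ V).comp (DT T0).toLinearMap) (x m) (y m))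
    refine Finset.sum_congr rfl fun p _ => ?_
    rw [smul_eq_mul, mul_comm]; rfl
  rw [e, hD0] at h
  simpa only [_root_.sum_apply, sum_inner] using h

end Curvature

/-! ### Positivity of P(x) + P(y) on the square-root domain -/

section Positivity

variable {V : Type*} [NormedAddCommGroup V] [InnerProductSpace ℝ V] [EuclideanJordanAlgebra V]
  [FiniteDimensional ℝ V] {l : ℕ} {c : Fin l → V}

theorem IsJordanFrame.inner_Q_diag_pos (hc : IsJordanFrame c) {x : Fin l → ℝ}
    (hx : ∀ i j, peirce c i j ≠ 0 → |x i - x j| < Real.pi / 2) {u : V} (hu : u ≠ 0) :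
    0 < (inner ℝ (Q (diag c fun j => Real.cos (x j)) (diag c fun j => Real.cos (x j)) u +
      Q (diag c fun j => Real.sin (x j)) (diag c fun j => Real.sin (x j)) u) u : ℝ) := by
  have hQ : ∀ h : Fin l → ℝ, Q (diag c h) (diag c h) u =
      ∑ i, ∑ j, (h i * h j) • peirce c i j u := by
    intro h
    conv_lhs => rw [← hc.sum_peirce u]
    simp only [map_sum, hc.Q_diag_peirce]
    refine Finset.sum_congr rfl fun i _ => Finset.sum_congr rfl fun j _ => ?_
    congr 1; ring
  rw [hQ, hQ, ← Finset.sum_add_distrib]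
  simp only [← Finset.sum_add_distrib, ← add_smul, sum_inner, real_inner_smul_left]
  simp only [← Real.cos_sub, ← Finset.sum_product']
  have hpos : ∀ i j, peirce c i j ≠ 0 → 0 < Real.cos (x i - x j) := fun i j h =>
    Real.cos_pos_of_mem_Ioo (abs_lt.mp (hx i j h))
  have hsum : ∑ p ∈ Finset.univ ×ˢ Finset.univ, (inner ℝ (peirce c p.1 p.2 u) u : ℝ) = ‖u‖ ^ 2 := by
    rw [Finset.sum_product, ← real_inner_self_eq_norm_sq]
    simp only [← sum_inner, hc.sum_peirce]
  refine Finset.sum_pos' (fun p _ => ?_) ?_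
  · by_cases h : peirce c p.1 p.2 = 0
    · simp [h]
    · exact mul_nonneg (hpos _ _ h).le (hc.inner_peirce_nonneg _ _ _)
  · by_contra hcon
    push Not at hcon
    have h0 : ∑ p ∈ Finset.univ ×ˢ Finset.univ, (inner ℝ (peirce c p.1 p.2 u) u : ℝ) ≤ 0 := by
      refine Finset.sum_nonpos fun p hp => ?_
      by_cases h : peirce c p.1 p.2 = 0
      · simp [h]
      · exact nonpos_of_mul_nonpos_right (hcon p hp) (hpos _ _ h)
    rw [hsum] at h0
    have := norm_pos_iff.mpr hu
    nlinarith [sq_nonneg ‖u‖, pow_pos this 2]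

/-- The operator `P(x) + P(y)` is positive definite when `x + iy` is in the square-root domain. -/
theorem inner_Q_pos_of_mem_sqrtDomain (hc : IsJordanFrame c) {z : Cx V}
    (hz : z ∈ Cx.sqrtDomain c) {u : V} (hu : u ≠ 0) :
    0 < (inner ℝ (Q z.re z.re u + Q z.im z.im u) u : ℝ) := by
  obtain ⟨g, hg, x, hx, hre, him⟩ := (Cx.mem_sqrtDomain_iff hc z).mp hz
  obtain ⟨s, h, hh, rfl⟩ := hc.exists_polar (G_le_autCone hg)
  have hinv : ∀ z, (h : V →L[ℝ] V) (((h⁻¹ : (V →L[ℝ] V)ˣ) : V →L[ℝ] V) z) = z :=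
    DFunLike.congr_fun (Units.mul_inv h)
  have hinv' : ∀ z, ((h⁻¹ : (V →L[ℝ] V)ˣ) : V →L[ℝ] V) ((h : V →L[ℝ] V) z) = z :=
    DFunLike.congr_fun (Units.inv_mul h)
  simp only [Units.val_mul, _root_.mul_apply_eq_comp, coe_expUnit] at hre him
  rw [hre, him, Q_exp_L, Q_exp_L]
  simp only [_root_.mul_apply_eq_comp]
  set p := diag c fun j => Real.cos (x j)
  set q := diag c fun j => Real.sin (x j)
  rw [← map_add, inner_exp_of_symm (fun u v => inner_mul' s u v)]
  set B : V →L[ℝ] V := Q ((h : V →L[ℝ] V) p) ((h : V →L[ℝ] V) p) +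
    Q ((h : V →L[ℝ] V) q) ((h : V →L[ℝ] V) q) with hB
  have hsymm : B.toLinearMap.IsSymmetric := fun u v => by
    change (inner ℝ (B u) v : ℝ) = inner ℝ u (B v)
    simp only [hB, _root_.add_apply, inner_add_left, inner_add_right, inner_Q]
  -- The automorphism h is not known to be isometric, so the quadratic form cannot simply be
  -- transported; eigenvalues, however, are invariant under conjugation by h.
  refine hsymm.inner_pos (fun μ v hv hμ => ?_) (x := exp (L s) u) ?_
  · have hv' : ((h⁻¹ : (V →L[ℝ] V)ˣ) : V →L[ℝ] V) v ≠ 0 := by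
      intro h0; apply hv; rw [← hinv v, h0, map_zero]
    have h1 := hc.inner_Q_diag_pos hx hv'
    have h2 : Q p p (((h⁻¹ : (V →L[ℝ] V)ˣ) : V →L[ℝ] V) v) +
        Q q q (((h⁻¹ : (V →L[ℝ] V)ˣ) : V →L[ℝ] V) v) =
        μ • ((h⁻¹ : (V →L[ℝ] V)ˣ) : V →L[ℝ] V) v := by
      rw [← hinv' (Q p p _ + Q q q _), map_add, map_Q_of_map_mul hh, map_Q_of_map_mul hh, hinv,
        ← map_smul]
      exact congrArg _ hμ
    rw [h2, real_inner_smul_left, real_inner_self_eq_norm_sq] at h1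
    exact pos_of_mul_pos_left h1 (sq_nonneg _)
  · intro h0
    apply hu
    rw [← exp_neg_exp_apply (L s) u, h0, map_zero]

end Positivity

end EuclideanJordanAlgebra

/-! ### Determinants of Hermitian operators -/

section Det

variable {E : Type*} [NormedAddCommGroup E] [InnerProductSpace ℂ E] [FiniteDimensional ℂ E]

/-- If the eigenvalues of an operator lie in a multiplicatively closed set of real numbers, then so
does its determinant. -/
theorem LinearMap.det_mem_of_eigenvalues (T : E →ₗ[ℂ] E) {S : Submonoid ℝ}
    (h : ∀ (μ : ℂ) (v : E), v ≠ 0 → T v = μ • v → ∃ r ∈ S, μ = (r : ℂ)) :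
    ∃ r ∈ S, LinearMap.det T = (r : ℂ) := by
  rw [Module.End.det_eq_prod_roots_charpoly_of_splits (IsAlgClosed.splits _)]
  have hroots : ∀ μ ∈ T.charpoly.roots, μ ∈ S.map Complex.ofRealHom.toMonoidHom := by
    intro μ hμ
    have h1 := Polynomial.isRoot_of_mem_roots hμ
    rw [← Module.End.hasEigenvalue_iff_isRoot_charpoly] at h1
    obtain ⟨v, hv⟩ := h1.exists_hasEigenvector
    obtain ⟨r, hr, hr'⟩ := h μ v hv.2 hv.apply_eq_smul
    exact ⟨r, hr, hr'.symm⟩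
  obtain ⟨r, hr, hr'⟩ := Submonoid.multiset_prod_mem _ _ hroots
  exact ⟨r, hr, hr'.symm⟩

theorem LinearMap.det_pos_of_inner_pos {A : E →ₗ[ℂ] E} (hs : A.IsSymmetric)
    (hp : ∀ u, u ≠ 0 → 0 < (inner ℂ u (A u)).re) :
    ∃ r : ℝ, 0 < r ∧ LinearMap.det A = (r : ℂ) := by
  refine A.det_mem_of_eigenvalues (S := Submonoid.pos ℝ) fun μ v hv hμ => ?_
  have h1 := hp v hv
  have h2 : (inner ℂ v (A v)).im = 0 := hs.im_inner_self_apply v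
  rw [hμ, inner_smul_right, inner_self_eq_norm_sq_to_K] at h1 h2
  have hv' : 0 < ‖v‖ ^ 2 := by have := norm_pos_iff.mpr hv; positivity
  have e : ((‖v‖ : ℂ)) ^ 2 = ((‖v‖ ^ 2 : ℝ) : ℂ) := by push_cast; rfl
  simp only [Complex.coe_algebraMap] at h1 h2
  rw [e, Complex.re_mul_ofReal] at h1
  rw [e, Complex.im_mul_ofReal] at h2
  refine ⟨μ.re, pos_of_mul_pos_left h1 hv'.le, ?_⟩
  apply Complex.ext
  · simp
  · simpa using (mul_eq_zero.mp h2).resolve_right hv'.ne'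

theorem LinearMap.det_adjoint_eq (S : E →ₗ[ℂ] E) :
    LinearMap.det (LinearMap.adjoint S) = star (LinearMap.det S) := by
  let b := stdOrthonormalBasis ℂ E
  rw [← LinearMap.det_toMatrix b.toBasis, ← LinearMap.det_toMatrix b.toBasis S,
    LinearMap.toMatrix_adjoint, Matrix.det_conjTranspose]

theorem LinearMap.isUnit_of_inner_pos {A : E →ₗ[ℂ] E}
    (hp : ∀ u, u ≠ 0 → 0 < (inner ℂ u (A u)).re) : Function.Bijective A := by
  have hinj : Function.Injective A := by
    rw [← LinearMap.ker_eq_bot, LinearMap.ker_eq_bot']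
    intro u hu
    by_contra hne
    have := hp u hne
    rw [hu, inner_zero_right] at this
    exact lt_irrefl _ this
  exact ⟨hinj, LinearMap.injective_iff_surjective.mp hinj⟩

/-- Monotonicity of the determinant: `A' ≤ S* A S` implies `det A' ≤ |det S|² det A`. -/
theorem LinearMap.det_le_of_inner_le {A A' S : E →ₗ[ℂ] E} (hs : A.IsSymmetric)
    (hs' : A'.IsSymmetric) (hp : ∀ u, u ≠ 0 → 0 < (inner ℂ u (A u)).re)
    (hp' : ∀ u, u ≠ 0 → 0 < (inner ℂ u (A' u)).re)
    (hle : ∀ u, (inner ℂ u (A' u)).re ≤ (inner ℂ (S u) (A (S u))).re) :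
    (LinearMap.det A').re ≤ ‖LinearMap.det S‖ ^ 2 * (LinearMap.det A).re := by
  set N := LinearMap.adjoint S ∘ₗ A ∘ₗ S with hN
  have hNi : ∀ u v, inner ℂ u (N v) = inner ℂ (S u) (A (S v)) := fun u v => by
    rw [hN, LinearMap.comp_apply, LinearMap.adjoint_inner_right]; rfl
  have hNp : ∀ u, u ≠ 0 → 0 < (inner ℂ u (N u)).re := fun u hu => by
    rw [hNi]; exact (hp' u hu).trans_le (hle u)
  have hNs : N.IsSymmetric := fun u v => by
    rw [hNi, ← inner_conj_symm, hNi, inner_conj_symm, hs]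
  let e := LinearEquiv.ofBijective N (LinearMap.isUnit_of_inner_pos hNp)
  have heN : ∀ u, N (e.symm u) = u := fun u => e.apply_symm_apply u
  -- For N = S*AS the hypothesis is A' ≤ N, so each eigenvalue of N⁻¹A' is a quotient of form values
  -- in (0, 1].
  set T : E →ₗ[ℂ] E := e.symm.toLinearMap ∘ₗ A' with hT
  have hNT : N ∘ₗ T = A' := by
    ext u; simp only [hT, LinearMap.comp_apply, LinearEquiv.coe_coe, heN]
  obtain ⟨r, hr, hdet⟩ := T.det_mem_of_eigenvalues
    (S := { carrier := Set.Ioc 0 1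
            one_mem' := by simp
            mul_mem' := fun {a b} ha hb =>
              ⟨mul_pos ha.1 hb.1, mul_le_one₀ ha.2 hb.1.le hb.2⟩ }) (fun μ v hv hμ => by
    have h1 : A' v = μ • N v := by
      rw [← hNT, LinearMap.comp_apply, hμ, map_smul]
    have h2 := hp' v hv
    have h3 : (inner ℂ v (A' v)).im = 0 := hs'.im_inner_self_apply v
    have h4 := hNp v hv
    have h5 : (inner ℂ v (N v)).im = 0 := hNs.im_inner_self_apply v
    have h6 : (inner ℂ v (A' v)).re ≤ (inner ℂ v (N v)).re := by rw [hNi]; exact hle v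
    rw [h1, inner_smul_right, Complex.mul_re, h5, mul_zero, sub_zero] at h2 h6
    rw [h1, inner_smul_right, Complex.mul_im, h5, mul_zero, zero_add] at h3
    refine ⟨μ.re, ⟨pos_of_mul_pos_left h2 h4.le, ?_⟩, ?_⟩
    · by_contra hcon; push Not at hcon; nlinarith
    · apply Complex.ext
      · simp
      · simpa using (mul_eq_zero.mp h3).resolve_right h4.ne')
  obtain ⟨a, ha, hdetA⟩ := LinearMap.det_pos_of_inner_pos hs hp
  have hdetN : LinearMap.det N = ((‖LinearMap.det S‖ ^ 2 * a : ℝ) : ℂ) := by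
    rw [hN, LinearMap.det_comp, LinearMap.det_comp, LinearMap.det_adjoint_eq, hdetA]
    push_cast
    rw [← Complex.mul_conj']
    simp only [RCLike.star_def]
    ring
  have h1 : LinearMap.det A' = ((‖LinearMap.det S‖ ^ 2 * a * r : ℝ) : ℂ) := by
    rw [← hNT, LinearMap.det_comp, hdetN, hdet]; push_cast; ring
  rw [h1, hdetA, Complex.ofReal_re, Complex.ofReal_re]
  exact mul_le_of_le_one_right (by positivity) hr.2

end Det

namespace EuclideanJordanAlgebra

namespace Cx

/-! ### The Hermitian form of P(z, z̄) on the complexification -/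

section Hermitian

variable {V : Type*} [NormedAddCommGroup V] [InnerProductSpace ℝ V] [EuclideanJordanAlgebra V]

theorem re_inner (z w : Cx V) :
    (inner ℂ z w : ℂ).re = inner ℝ z.re w.re + inner ℝ z.im w.im := rfl

theorem im_inner (z w : Cx V) :
    (inner ℂ z w : ℂ).im = inner ℝ z.re w.im - inner ℝ z.im w.re := rfl

@[simp] theorem re_conj (z : Cx V) : (conj z).re = z.re := rfl

@[simp] theorem im_conj (z : Cx V) : (conj z).im = -z.im := rfl

@[simp] theorem mulLeft_apply (z w : Cx V) : mulLeft z w = z * w := rfl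

theorem cx_mul_comm (z w : Cx V) : z * w = w * z := by
  ext
  · simp only [re_mul, mul_comm]
  · simp only [im_mul]; rw [mul_comm z.re, mul_comm z.im]; abel

theorem cx_mul_add (z w u : Cx V) : z * (w + u) = z * w + z * u := map_add (mulLeft z) w u

theorem cx_mul_smul (a : ℂ) (z w : Cx V) : z * (a • w) = a • (z * w) := map_smul (mulLeft z) a w

theorem cx_add_mul (z w u : Cx V) : (z + w) * u = z * u + w * u := by
  rw [cx_mul_comm, cx_mul_add, cx_mul_comm u, cx_mul_comm u]

theorem cx_smul_mul (a : ℂ) (z w : Cx V) : (a • z) * w = a • (z * w) := by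
  rw [cx_mul_comm, cx_mul_smul, cx_mul_comm]

theorem conj_conj (z : Cx V) : conj (conj z) = z := by ext <;> simp

theorem conj_mul (z w : Cx V) : conj (z * w) = conj z * conj w := by
  ext
  · simp [mul_neg', neg_mul']
  · simp [mul_neg', neg_mul']; abel

theorem conj_add (z w : Cx V) : conj (z + w) = conj z + conj w := by
  ext <;> simp [add_comm]

theorem conj_smul (a : ℂ) (z : Cx V) : conj (a • z) = (starRingEnd ℂ a) • conj z := by
  ext <;> simp; abel

theorem inner_mul (z u v : Cx V) : inner ℂ (z * u) v = inner ℂ u (conj z * v) := by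
  apply Complex.ext
  · simp only [re_inner, re_mul, im_mul, re_conj, im_conj, inner_sub_left, inner_add_left,
      inner_sub_right, inner_add_right, neg_mul', inner_neg_right, inner_mul_left]
    ring
  · simp only [im_inner, re_mul, im_mul, re_conj, im_conj, inner_sub_left, inner_add_left,
      inner_sub_right, inner_add_right, neg_mul', inner_neg_right, inner_mul_left]
    ring

theorem P_apply (z w u : Cx V) : P z w u = z * (w * u) + w * (z * u) - (z * w) * u := rfl

theorem P_comm (z w : Cx V) : P z w = P w z := by
  ext1 u; simp only [P_apply, cx_mul_comm z w]; abel

theorem inner_P (z w u v : Cx V) :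
    inner ℂ (P z w u) v = inner ℂ u (P (conj w) (conj z) v) := by
  simp only [P_apply, inner_add_left, inner_sub_left, inner_add_right, inner_sub_right, inner_mul,
    conj_mul, cx_mul_comm (conj z) (conj w)]

theorem isSymmetric_P (z : Cx V) : (P z (conj z)).IsSymmetric := fun u v => by
  rw [inner_P, conj_conj]

variable [FiniteDimensional ℝ V]

theorem re_P (z u : Cx V) : (P z (conj z) u).re = Q z.re z.re u.re + Q z.im z.im u.re := by
  simp only [P_apply, Q_apply, re_add, re_sub, re_mul, im_mul, re_conj, im_conj, neg_mul', mul_neg',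
    mul_add', mul_sub', add_mul', sub_mul', mul_comm z.im z.re]
  abel

theorem im_P (z u : Cx V) : (P z (conj z) u).im = Q z.re z.re u.im + Q z.im z.im u.im := by
  simp only [P_apply, Q_apply, im_add, im_sub, re_mul, im_mul, re_conj, im_conj, neg_mul', mul_neg',
    mul_add', mul_sub', add_mul', sub_mul', mul_comm z.im z.re]
  abel

/-- On the square-root domain `P(z, z̄)` is positive definite. -/
theorem inner_P_pos {l : ℕ} {c : Fin l → V} (hc : IsJordanFrame c) {z : Cx V}
    (hz : z ∈ sqrtDomain c) {u : Cx V} (hu : u ≠ 0) :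
    0 < (inner ℂ u (P z (conj z) u)).re := by
  rw [re_inner, re_P, im_P, real_inner_comm, real_inner_comm _ u.im]
  have hnn : ∀ v : V,
      0 ≤ (inner ℝ (Q z.re z.re v + Q z.im z.im v) v : ℝ) := by
    intro v
    rcases eq_or_ne v 0 with rfl | hv
    · simp
    · exact (inner_Q_pos_of_mem_sqrtDomain hc hz hv).le
  by_cases h : u.re = 0
  · have h' : u.im ≠ 0 := fun h' => hu (Cx.ext h h')
    exact add_pos_of_nonneg_of_pos (hnn _) (inner_Q_pos_of_mem_sqrtDomain hc hz h')
  · exact add_pos_of_pos_of_nonneg (inner_Q_pos_of_mem_sqrtDomain hc hz h) (hnn _)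

theorem re_inner_lie (x a y b : Cx V) :
    (inner ℂ b (x * (a * conj y) - a * (x * conj y))).re =
      inner ℝ (lieL x.re a.re y.re) b.re - inner ℝ (lieL x.im a.im y.re) b.re +
      inner ℝ (lieL x.re a.im y.im) b.re + inner ℝ (lieL x.im a.re y.im) b.re +
      inner ℝ (lieL x.re a.im y.re) b.im + inner ℝ (lieL x.im a.re y.re) b.im -
      inner ℝ (lieL x.re a.re y.im) b.im + inner ℝ (lieL x.im a.im y.im) b.im := by
  rw [re_inner]
  simp only [re_sub, im_sub, re_mul, im_mul, re_conj, im_conj, lieL_apply, mul_neg',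
    mul_sub', mul_add', inner_sub_right, inner_add_right, inner_sub_left, inner_neg_right,
    real_inner_comm b.re, real_inner_comm b.im]
  ring

/-- The Hermitian form of `P` on the tensor `z ⊗ v - w ⊗ u` is nonpositive if `zv = wu`. -/
theorem re_inner_P_le (z w u v : Cx V) (h : z * v = w * u) :
    (inner ℂ v (P z (conj z) v)).re - 2 * (inner ℂ u (P z (conj w) v)).re +
      (inner ℂ u (P w (conj w) u)).re ≤ 0 := by
  -- The form splits into a product part and a curvature part. On z ⊗ v - w ⊗ u the product parts
  -- add up to ‖zv - wu‖² = 0.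
  have key : ∀ x y a b : Cx V, (inner ℂ b (P x (conj y) a)).re = (inner ℂ (y * b) (x * a)).re +
      (inner ℂ b (x * (a * conj y) - a * (x * conj y))).re := by
    intro x y a b
    rw [inner_mul, P_apply, ← Complex.add_re, ← inner_add_right, cx_mul_comm a (conj y),
      cx_mul_comm a (x * conj y)]
    congr 2; abel
  rw [key, key, key, h]
  -- These four pairs represent the real part of the tensor z ⊗ v - w ⊗ u, and those of `hI` its
  -- imaginary part.
  have hR := sum_inner_lieL_nonpos ![z.re, -z.im, -w.re, w.im] ![v.re, v.im, u.re, u.im]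
  have hI := sum_inner_lieL_nonpos ![z.re, z.im, -w.re, -w.im] ![v.im, v.re, u.im, u.re]
  have hneg : ∀ a b : V, lieL (-a) b = -lieL a b := fun a b => by
    rw [← lieBilin_apply, map_neg]; rfl
  simp only [Fin.sum_univ_four, Matrix.cons_val_zero, Matrix.cons_val_one, Matrix.cons_val,
    hneg, _root_.neg_apply, map_neg, inner_neg_left, neg_neg] at hR hI
  simp only [re_inner_lie]
  have s := fun a b c d : V => inner_lieL_symm a b c d
  linarith [hR, hI, s w.re u.re z.re v.re, s w.im u.im z.re v.re, s w.re u.re z.im v.im,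
    s w.im u.im z.im v.im, s w.re u.im z.re v.im, s w.im u.re z.re v.im, s w.re u.im z.im v.re,
    s w.im u.re z.im v.re, s z.im v.im z.re v.re, s z.im v.re z.re v.im, s w.im u.im w.re u.re,
    s w.im u.re w.re u.im]

end Hermitian

end Cx

end EuclideanJordanAlgebra

namespace EuclideanJordanAlgebra

namespace Cx

/-! ### The sub-mean value inequality -/

section SubMean

variable {V : Type*} [NormedAddCommGroup V] [InnerProductSpace ℝ V] [EuclideanJordanAlgebra V]

theorem P_add_add (z w z' w' : Cx V) :
    P (z + z') (w + w') = P z w + P z' w + P z w' + P z' w' := by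
  ext1 u
  simp only [P_apply, LinearMap.add_apply, cx_mul_add, cx_add_mul]
  abel

theorem P_smul_left (a : ℂ) (z w : Cx V) : P (a • z) w = a • P z w := by
  ext1 u
  simp only [P_apply, LinearMap.smul_apply, cx_mul_smul, cx_smul_mul, smul_add, smul_sub]

theorem P_smul_right (a : ℂ) (z w : Cx V) : P z (a • w) = a • P z w := by
  rw [P_comm, P_smul_left, P_comm]

variable [FiniteDimensional ℝ V]

/-- If zv = 0, then `re_inner_P_le` with w = u = 0 gives ⟨v, P(z, z̄)v⟩ ≤ 0, so v = 0. -/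
theorem mulLeft_surjective {z : Cx V} (hz : ∀ u, u ≠ 0 → 0 < (inner ℂ u (P z (conj z) u)).re) :
    Function.Surjective (mulLeft z) := by
  refine LinearMap.injective_iff_surjective.mp ?_
  rw [← LinearMap.ker_eq_bot, LinearMap.ker_eq_bot']
  intro v hv
  by_contra hne
  have h := re_inner_P_le z 0 0 v (by rw [← mulLeft_apply, hv, ← mulLeft_apply, map_zero])
  simp only [inner_zero_left, Complex.zero_re] at h
  linarith [hz v hne]

/-- Take S = P(z, z̄)⁻¹P(w, z̄) and solve zv = wu. The cross term of `re_inner_P_le` is then that of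
the square ⟨v - Su, P(z, z̄)(v - Su)⟩ ≥ 0, and adding the two inequalities eliminates v. -/
theorem exists_inner_P_le {z : Cx V} (hz : ∀ u, u ≠ 0 → 0 < (inner ℂ u (P z (conj z) u)).re)
    (w : Cx V) : ∃ S : Cx V →ₗ[ℂ] Cx V, (∀ u, P z (conj z) (S u) = P w (conj z) u) ∧
      ∀ u, (inner ℂ u (P w (conj w) u)).re ≤ (inner ℂ (S u) (P z (conj z) (S u))).re := by
  let e := LinearEquiv.ofBijective _ (LinearMap.isUnit_of_inner_pos hz)
  refine ⟨e.symm.toLinearMap ∘ₗ P w (conj z), fun u => e.apply_symm_apply _, fun u => ?_⟩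
  set S : Cx V →ₗ[ℂ] Cx V := e.symm.toLinearMap ∘ₗ P w (conj z) with hS
  have hSu : P w (conj z) u = P z (conj z) (S u) := (e.apply_symm_apply _).symm
  obtain ⟨v, hv⟩ := mulLeft_surjective hz (w * u)
  have h1 := re_inner_P_le z w u v hv
  have h2 : inner ℂ u (P z (conj w) v) = inner ℂ (P z (conj z) (S u)) v := by
    rw [← hSu, inner_P, conj_conj]
  have h3 : 0 ≤ (inner ℂ (v - S u) (P z (conj z) (v - S u))).re := by
    rcases eq_or_ne (v - S u) 0 with h | h
    · rw [h]; simp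
    · exact (hz _ h).le
  have h4 : inner ℂ (S u) (P z (conj z) v) = inner ℂ (P z (conj z) (S u)) v :=
    (isSymmetric_P z _ _).symm
  have h5 : (inner ℂ v (P z (conj z) (S u))).re = (inner ℂ (P z (conj z) (S u)) v).re := by
    rw [← inner_conj_symm, Complex.conj_re]
  rw [map_sub, inner_sub_left, inner_sub_right, inner_sub_right, h4, Complex.sub_re,
    Complex.sub_re, Complex.sub_re, h5] at h3
  rw [h2] at h1
  linarith

/-- Expanded in ζ and its conjugate, the two sides agree except in the |ζ|² term, where `hle`
applies. -/
theorem re_inner_P_add_smul_le {z w : Cx V} {S : Cx V →ₗ[ℂ] Cx V}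
    (hS : ∀ u, P z (conj z) (S u) = P w (conj z) u)
    (hle : ∀ u, (inner ℂ u (P w (conj w) u)).re ≤ (inner ℂ (S u) (P z (conj z) (S u))).re)
    (ζ : ℂ) (u : Cx V) :
    (inner ℂ u (P (z + ζ • w) (conj (z + ζ • w)) u)).re ≤
      (inner ℂ ((1 + ζ • S) u) (P z (conj z) ((1 + ζ • S) u))).re := by
  have h2 : inner ℂ u (P z (conj w) u) = inner ℂ (P z (conj z) (S u)) u := by
    rw [hS, inner_P, conj_conj]
  have h4 : inner ℂ (S u) (P z (conj z) u) = inner ℂ (P z (conj z) (S u)) u :=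
    (isSymmetric_P z _ _).symm
  have e1 : (starRingEnd ℂ ζ) * ζ = ((‖ζ‖ ^ 2 : ℝ) : ℂ) := by
    rw [mul_comm, Complex.mul_conj']; push_cast; rfl
  have hl : inner ℂ u (P (z + ζ • w) (conj (z + ζ • w)) u) =
      inner ℂ u (P z (conj z) u) + ζ * inner ℂ u (P z (conj z) (S u)) +
        starRingEnd ℂ ζ * inner ℂ (P z (conj z) (S u)) u +
        ((‖ζ‖ ^ 2 : ℝ) : ℂ) * inner ℂ u (P w (conj w) u) := by
    rw [conj_add, conj_smul, P_add_add, P_smul_left, P_smul_right, P_smul_right, P_smul_left,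
      ← e1, ← h2, hS]
    simp only [LinearMap.add_apply, LinearMap.smul_apply, inner_add_right, inner_smul_right]
    ring
  have hr : inner ℂ ((1 + ζ • S) u) (P z (conj z) ((1 + ζ • S) u)) =
      inner ℂ u (P z (conj z) u) + ζ * inner ℂ u (P z (conj z) (S u)) +
        starRingEnd ℂ ζ * inner ℂ (P z (conj z) (S u)) u +
        ((‖ζ‖ ^ 2 : ℝ) : ℂ) * inner ℂ (S u) (P z (conj z) (S u)) := by
    rw [← e1, ← h4]
    simp only [LinearMap.add_apply, LinearMap.smul_apply, Module.End.one_apply, map_add, map_smul,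
      inner_add_right, inner_add_left, inner_smul_right, inner_smul_left]
    ring
  rw [hl, hr, Complex.add_re, Complex.add_re _ (_ * inner ℂ (S u) _), Complex.re_ofReal_mul,
    Complex.re_ofReal_mul]
  have := mul_le_mul_of_nonneg_left (hle u) (sq_nonneg ‖ζ‖)
  linarith

theorem phi_eq {z : Cx V} (hz : ∀ u, u ≠ 0 → 0 < (inner ℂ u (P z (conj z) u)).re) :
    phi z = -Real.log (LinearMap.det (P z (conj z))).re := by
  obtain ⟨r, -, hr⟩ := LinearMap.det_pos_of_inner_pos (isSymmetric_P z) hz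
  rw [phi, hr, ← Complex.ofReal_inv, Complex.ofReal_re, Complex.ofReal_re, Real.log_inv]

theorem det_P_re_pos {z : Cx V} (hz : ∀ u, u ≠ 0 → 0 < (inner ℂ u (P z (conj z) u)).re) :
    0 < (LinearMap.det (P z (conj z))).re := by
  obtain ⟨r, h, hr⟩ := LinearMap.det_pos_of_inner_pos (isSymmetric_P z) hz
  rwa [hr, Complex.ofReal_re]

theorem continuous_inner_P (a u : Cx V) :
    Continuous fun z : Cx V => (inner ℂ a (P z (conj z) u) : ℂ) := by
  have hQ : ∀ b : V, (Continuous fun z : Cx V => Q z.re z.re b) ∧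
      Continuous fun z : Cx V => Q z.im z.im b := by
    intro b
    have key : ∀ {f : Cx V → V}, Continuous f → Continuous fun z => Q (f z) (f z) b := by
      intro f hf
      simp only [Q_apply]
      have hb : Continuous fun _ : Cx V => b := continuous_const
      have h := continuous_mul' hf (continuous_mul' hf hb)
      exact (h.add h).sub (continuous_mul' (continuous_mul' hf hf) hb)
    exact ⟨key continuous_re, key continuous_im⟩
  have hre : Continuous fun z : Cx V => (P z (conj z) u).re := by
    simp only [re_P]; exact (hQ _).1.add (hQ _).2
  have him : Continuous fun z : Cx V => (P z (conj z) u).im := by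
    simp only [im_P]; exact (hQ _).1.add (hQ _).2
  have ha : Continuous fun _ : Cx V => a.re := continuous_const
  have ha' : Continuous fun _ : Cx V => a.im := continuous_const
  have hI : Continuous fun _ : Cx V => Complex.I := continuous_const
  have h := (Complex.continuous_ofReal.comp ((ha.inner (𝕜 := ℝ) hre).add (ha'.inner him))).add
    ((Complex.continuous_ofReal.comp ((ha.inner (𝕜 := ℝ) him).sub (ha'.inner hre))).mul hI)
  refine h.congr fun z => ?_
  exact Complex.re_add_im (inner ℂ a (P z (conj z) u))

theorem continuous_det_P : Continuous fun z : Cx V => LinearMap.det (P z (conj z)) := by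
  let b := stdOrthonormalBasis ℂ (Cx V)
  simp only [← LinearMap.det_toMatrix b.toBasis]
  refine Continuous.matrix_det (continuous_matrix fun i j => ?_)
  simp only [LinearMap.toMatrix_apply, OrthonormalBasis.coe_toBasis,
    OrthonormalBasis.coe_toBasis_repr_apply, OrthonormalBasis.repr_apply_apply]
  exact continuous_inner_P _ _

theorem continuousOn_phi {l : ℕ} {c : Fin l → V} (hc : IsJordanFrame c) :
    ContinuousOn phi (sqrtDomain c) := by
  have h : ContinuousOn (fun z : Cx V => -Real.log (LinearMap.det (P z (conj z))).re)
      (sqrtDomain c) :=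
    ((Complex.continuous_re.comp continuous_det_P).continuousOn.log fun z hz =>
      (det_P_re_pos fun _ => inner_P_pos hc hz).ne').neg
  exact h.congr fun z hz => phi_eq fun _ => inner_P_pos hc hz

theorem analyticAt_det_one_add_smul {E : Type*} [AddCommGroup E] [Module ℂ E]
    [FiniteDimensional ℂ E] (S : E →ₗ[ℂ] E) (ζ : ℂ) :
    AnalyticAt ℂ (fun ζ : ℂ => LinearMap.det (1 + ζ • S)) ζ := by
  refine Differentiable.analyticAt ?_ ζ
  let b := Module.finBasis ℂ E
  simp only [← LinearMap.det_toMatrix b, map_add, map_smul, Matrix.det_apply, Matrix.add_apply,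
    Matrix.smul_apply]
  fun_prop

theorem phi_le_circleAverage {l : ℕ} {c : Fin l → V} (hc : IsJordanFrame c) {z w : Cx V}
    (h : ∀ ζ : ℂ, ‖ζ‖ ≤ 1 → z + ζ • w ∈ sqrtDomain c) :
    CircleIntegrable (fun ζ : ℂ => phi (z + ζ • w)) 0 1 ∧
      phi z ≤ Real.circleAverage (fun ζ : ℂ => phi (z + ζ • w)) 0 1 := by
  have hz : ∀ u, u ≠ 0 → 0 < (inner ℂ u (P z (conj z) u)).re := fun _ =>
    inner_P_pos hc (by simpa using h 0 (by simp))
  have hzζ : ∀ ζ : ℂ, ‖ζ‖ ≤ 1 → ∀ u, u ≠ 0 →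
      0 < (inner ℂ u (P (z + ζ • w) (conj (z + ζ • w)) u)).re := fun ζ hζ _ =>
    inner_P_pos hc (h ζ hζ)
  obtain ⟨S, hS, hle⟩ := exists_inner_P_le hz w
  have hdet : ∀ ζ : ℂ, ‖ζ‖ ≤ 1 → (LinearMap.det (P (z + ζ • w) (conj (z + ζ • w)))).re ≤
      ‖LinearMap.det (1 + ζ • S)‖ ^ 2 * (LinearMap.det (P z (conj z))).re := fun ζ hζ =>
    LinearMap.det_le_of_inner_le (isSymmetric_P z) (isSymmetric_P _) hz (hzζ ζ hζ)
      (re_inner_P_add_smul_le hS hle ζ)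
  -- A zero would force det P ≤ 0 at z + ζw, a point of the domain.
  have hne : ∀ ζ : ℂ, ‖ζ‖ ≤ 1 → LinearMap.det (1 + ζ • S) ≠ 0 := by
    intro ζ hζ h0
    have h1 := hdet ζ hζ
    have h2 := det_P_re_pos (hzζ ζ hζ)
    rw [h0] at h1
    simp at h1
    linarith
  have hphi : ∀ ζ : ℂ, ‖ζ‖ ≤ 1 →
      phi z - 2 * Real.log ‖LinearMap.det (1 + ζ • S)‖ ≤ phi (z + ζ • w) := by
    intro ζ hζ
    rw [phi_eq hz, phi_eq (hzζ ζ hζ)]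
    have h1 := Real.log_le_log (det_P_re_pos (hzζ ζ hζ)) (hdet ζ hζ)
    rw [Real.log_mul (by simpa using hne ζ hζ) (det_P_re_pos hz).ne', Real.log_pow] at h1
    push_cast at h1
    linarith
  have hsph : ∀ ζ ∈ Metric.sphere (0 : ℂ) |1|, ‖ζ‖ ≤ 1 := by
    intro ζ hζ; simpa using (mem_sphere_zero_iff_norm.mp hζ).le
  have hint : CircleIntegrable (fun ζ : ℂ => phi (z + ζ • w)) 0 1 := by
    refine ContinuousOn.circleIntegrable' ?_
    exact (continuousOn_phi hc).comp (by fun_prop) fun ζ hζ => h ζ (hsph ζ hζ)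
  -- Mean value property of log |det(1 + ζS)|; its value at the centre ζ = 0 is log 1 = 0.
  have hmean := AnalyticOnNhd.circleAverage_log_norm_of_ne_zero
    (g := fun ζ : ℂ => LinearMap.det (1 + ζ • S)) (c := 0) (R := 1)
    (fun ζ _ => analyticAt_det_one_add_smul S ζ) (fun ζ hζ => hne ζ (by simpa using hζ))
  have hint' : CircleIntegrable (fun ζ : ℂ => Real.log ‖LinearMap.det (1 + ζ • S)‖) 0 1 := by
    refine ContinuousOn.circleIntegrable' ?_
    refine ContinuousOn.log ?_ fun ζ hζ => by simpa using hne ζ (hsph ζ hζ)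
    exact fun ζ _ => (analyticAt_det_one_add_smul S ζ).continuousAt.norm.continuousWithinAt
  refine ⟨hint, ?_⟩
  have hmono := Real.circleAverage_mono ((circleIntegrable_const (phi z) 0 1).sub
    (hint'.const_smul (a := (2 : ℝ)))) hint fun ζ hζ => hphi ζ (hsph ζ hζ)
  rw [Real.circleAverage_sub (circleIntegrable_const (phi z) 0 1)
    (hint'.const_smul (a := (2 : ℝ))), Real.circleAverage_const, Real.circleAverage_smul,
    hmean] at hmono
  simpa using hmono

end SubMean

end Cx

end EuclideanJordanAlgebra

end

theorem theorem8p6 {V : Type*} [NormedAddCommGroup V] [InnerProductSpace ℝ V]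
    [FiniteDimensional ℝ V] [EuclideanJordanAlgebra V] {l : ℕ} (c : Fin l → V)
    (hc : EuclideanJordanAlgebra.IsJordanFrame c) :
    (∀ z ∈ EuclideanJordanAlgebra.Cx.sqrtDomain c,
      (LinearMap.det (EuclideanJordanAlgebra.Cx.P z (EuclideanJordanAlgebra.Cx.conj z))).im = 0 ∧
      0 < (LinearMap.det
        (EuclideanJordanAlgebra.Cx.P z (EuclideanJordanAlgebra.Cx.conj z))).re) ∧
    PlurisubharmonicOn (EuclideanJordanAlgebra.Cx.phi (V := V))
      (EuclideanJordanAlgebra.Cx.sqrtDomain c) := by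
  refine ⟨fun z hz => ?_, EuclideanJordanAlgebra.Cx.isOpen_sqrtDomain hc,
    (EuclideanJordanAlgebra.Cx.continuousOn_phi hc).upperSemicontinuousOn,
    fun z w => EuclideanJordanAlgebra.Cx.phi_le_circleAverage hc⟩
  obtain ⟨r, h, hr⟩ := LinearMap.det_pos_of_inner_pos
    (EuclideanJordanAlgebra.Cx.isSymmetric_P z)
    fun _ => EuclideanJordanAlgebra.Cx.inner_P_pos hc hz
  rw [hr]
  exact ⟨Complex.ofReal_im r, h⟩
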